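/- Let $\mathbb S=\{a_1,\dots,a_d\}\subset\mathbb R$ consist of $d\ge1$ distinct points and let $X=(X_n)_{n\ge0}$ be a Markov chain on $\mathbb S$ with transition matrix $\Lambda=(\lambda_{ij})$, $\lambda_{ij}=\mathrm P(X_n=a_j\mid X_{n-1}=a_i)$, and initial distribution $\nu$. Assume that $X$ is ergodic: for every initial distribution the limits $\mu_i=\lim_{n\to\infty}\mathrm P(X_n=a_i)$ exist, do not depend on the initial distribution, and are positive. Let $h:\mathbb S\to\mathbb R$, identified with the vector with entries $h_i=h(a_i)$, and let $$Y^\sigma_n=h(X_n)+\sigma\xi_n,\qquad n\ge1,\ \sigma>0,$$ where $\xi_1,\xi_2,\dots$ are i.i.d. standard Gaussian random variables independent of $X$. Let $\mathcal S^{d-1}$ be the simplex of probability vectors in $\mathbb R^d$ and let $g$ be the standard Gaussian density. The filter $\pi^\sigma_n(i)=\mathrm P(X_n=a_i\mid Y^\sigma_1,\dots,Y^\sigma_n)$ satisfies $\pi^\sigma_0=\nu$ and $$\pi^\sigma_n=\frac{G^\sigma(Y^\sigma_n)\Lambda^*\pi^\sigma_{n-1}}{|G^\sigma(Y^\sigma_n)\Lambda^*\pi^\sigma_{n-1}|},\qquad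 G^\sigma(y)=\mathrm{diag}\Big(g\big(\tfrac{y-h_i}{\sigma}\big)\Big),\quad |x|=\sum_i|x_i|,$$ and it is a Markov process on $\mathcal S^{d-1}$: its transition kernel sends $\eta\in\mathcal S^{d-1}$ to the law of $\pi^\sigma_1$ for the model with $\nu=\eta$. Let $$\mathcal P^\sigma_n=\min_\theta\mathrm P(X_n\ne\theta),$$ the minimum being over bounded random variables $\theta$ that are measurable with respect to $\sigma\{Y^\sigma_1,\dots,Y^\sigma_n\}$. Put $\mathcal P^\infty=1-\max_i\mu_i$ and $\mathcal J=\{i:\mu_i=\max_j\mu_j\}$. Then the following hold. 1. The equation $$P=\Lambda^*P\Lambda+\big(\mathrm{diag}(\mu)-\mu\mu^*\big)hh^*\big(\mathrm{diag}(\mu)-\mu\mu^*\big)$$ has a unique solution $P$ among the nonnegative definite matrices with $\sum_{i,j}P_{ij}=0$. For every $\sigma>0$ the filter has a unique invariant probability measure $\mathcal M^\sigma_\pi$ on $\mathcal S^{d-1}$, and the limit $\mathcal P^\sigma=\lim_{n\to\infty}\mathcal P^\sigma_n$ exists and does not depend on $\nu$. 2. Let $Z$ be a zero mean Gaussian vector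 in $\mathbb R^d$ with covariance matrix $P$. For every continuous $F:\mathbb R^d\to\mathbb R$ growing not faster than polynomially, $F(Z)$ is integrable and $$\lim_{\sigma\to\infty}\int_{\mathcal S^{d-1}}F\big(\sigma(\eta-\mu)\big)\,\mathcal M^\sigma_\pi(d\eta)=\mathrm E\,F(Z).$$ 3. $\displaystyle\lim_{\sigma\to\infty}\sigma\big(\mathcal P^\infty-\mathcal P^\sigma\big)=\mathrm E\max_{j\in\mathcal J}Z_j.$ 4. If $\mu$ has a unique maximal atom, i.e. $\mathcal J$ has exactly one element, then $\displaystyle\lim_{\sigma\to\infty}\sigma^p\big(\mathcal P^\infty-\mathcal P^\sigma\big)=0$ for every integer $p\ge1$. -/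

import Mathlib

open MeasureTheory ProbabilityTheory Filter Topology Matrix

namespace StrongNoise

noncomputable section

/-- The chain with transition matrix `Λ` (`Λ i j` is the probability of going from `i` to `j`) is
ergodic with limit distribution `μ`: whatever the initial distribution `ν`, the distribution
`(Λᵀ) ^ n ν` of the chain at time `n` converges to `μ`, and all limit probabilities are positive. -/
def IsErgodic {d : ℕ} (Λ : Matrix (Fin d) (Fin d) ℝ) (μ : Fin d → ℝ) : Prop :=
  (∀ ν ∈ stdSimplex ℝ (Fin d), Tendsto (fun n : ℕ => (Λᵀ ^ n) *ᵥ ν) atTop (𝓝 μ)) ∧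
    ∀ i, 0 < μ i

/-- The signal `X` and the noise `ξ` of the filtering model. The signal is described by the index
`X n ω` of its value at time `n`; it is a Markov chain with initial distribution `ν` and transition
matrix `Λ`. The noise variables `ξ 1, ξ 2, …` are i.i.d. standard Gaussian and independent of the
signal (`ξ 0` is not used). -/
structure IsModel {d : ℕ} (Λ : Matrix (Fin d) (Fin d) ℝ) (ν : Fin d → ℝ)
    {Ω : Type*} [MeasurableSpace Ω] (prob : Measure Ω)
    (X : ℕ → Ω → Fin d) (ξ : ℕ → Ω → ℝ) : Prop where
  measurable_signal : ∀ n, Measurable (X n)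
  law_signal : ∀ (n : ℕ) (x : ℕ → Fin d),
    prob {ω | ∀ k ≤ n, X k ω = x k} =
      ENNReal.ofReal (ν (x 0) * ∏ k ∈ Finset.range n, Λ (x k) (x (k + 1)))
  measurable_noise : ∀ n, Measurable (ξ n)
  law_noise : ∀ n, prob.map (ξ (n + 1)) = gaussianReal 0 1
  indep_noise : iIndepFun (fun n => ξ (n + 1)) prob
  indep_signal_noise : IndepFun (fun ω n => X n ω) (fun ω n => ξ (n + 1) ω) prob

/-- The observation `Y_n = h(X_n) + σ ξ_n`. -/
def obs {d : ℕ} (h : Fin d → ℝ) (σ : ℝ) {Ω : Type*} (X : ℕ → Ω → Fin d) (ξ : ℕ → Ω → ℝ)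
    (n : ℕ) (ω : Ω) : ℝ :=
  h (X n ω) + σ * ξ n ω

/-- The σ-algebra generated by the observations `Y_1, …, Y_n`. -/
abbrev obsSigma {d : ℕ} (h : Fin d → ℝ) (σ : ℝ) {Ω : Type*} (X : ℕ → Ω → Fin d) (ξ : ℕ → Ω → ℝ)
    (n : ℕ) : MeasurableSpace Ω :=
  ⨆ m ∈ Finset.Icc 1 n, MeasurableSpace.comap (obs h σ X ξ m) inferInstance

/-- The minimal error probability of estimating the signal value `a (X n)` by a bounded random
variable `θ` that is a function of the observations up to time `n`. -/
def minError {d : ℕ} (a h : Fin d → ℝ) (σ : ℝ) {Ω : Type*} [MeasurableSpace Ω] (prob : Measure Ω)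
    (X : ℕ → Ω → Fin d) (ξ : ℕ → Ω → ℝ) (n : ℕ) : ℝ :=
  sInf {r : ℝ | ∃ θ : Ω → ℝ, Measurable[obsSigma h σ X ξ n] θ ∧ (∃ C, ∀ ω, |θ ω| ≤ C) ∧
    r = prob.real {ω | a (X n ω) ≠ θ ω}}

/-- One step of the filtering equation: `G(y) Λᵀ x / |G(y) Λᵀ x|`, with the `ℓ¹`-norm in the
denominator, where `G(y)` is the diagonal matrix with entries `g((y - h_i) / σ)` and `g` is the
standard Gaussian density. -/
def filterStep {d : ℕ} (Λ : Matrix (Fin d) (Fin d) ℝ) (h : Fin d → ℝ) (σ : ℝ) (y : ℝ)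
    (x : Fin d → ℝ) : Fin d → ℝ :=
  let v := Matrix.diagonal (fun i => gaussianPDFReal 0 1 ((y - h i) / σ)) *ᵥ (Λᵀ *ᵥ x)
  (∑ i, |v i|)⁻¹ • v

theorem measurable_filterStep {d : ℕ} (Λ : Matrix (Fin d) (Fin d) ℝ) (h : Fin d → ℝ) (σ : ℝ) :
    Measurable (fun p : (Fin d → ℝ) × ℝ => filterStep Λ h σ p.2 p.1) := by
  have hv : ∀ i, Measurable (fun p : (Fin d → ℝ) × ℝ =>
      (Matrix.diagonal (fun i => gaussianPDFReal 0 1 ((p.2 - h i) / σ)) *ᵥ (Λᵀ *ᵥ p.1)) i) := by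
    intro i
    simp only [Matrix.mulVec_diagonal]
    refine Measurable.mul ?_ ?_
    · exact (measurable_gaussianPDFReal 0 1).comp (by fun_prop)
    · simp only [Matrix.mulVec, dotProduct]
      fun_prop
  refine measurable_pi_lambda _ fun i => ?_
  simp only [filterStep, Pi.smul_apply, smul_eq_mul]
  refine Measurable.mul (Measurable.inv ?_) (hv i)
  refine Finset.measurable_sum _ fun j _ => ?_
  simpa only [Real.norm_eq_abs] using (hv j).norm

/-- The law of `π_1` when the filter is started at `π_0 = η`: the initial state is `i` with
probability `η i`, it moves to `j` with probability `Λ i j`, the observation is `h j + σ u` with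
`u` standard Gaussian, and `η` is updated by one step of the filtering equation. -/
def filterLaw {d : ℕ} (Λ : Matrix (Fin d) (Fin d) ℝ) (h : Fin d → ℝ) (σ : ℝ)
    (η : Fin d → ℝ) : Measure (Fin d → ℝ) :=
  ∑ i, ∑ j, ENNReal.ofReal (η i * Λ i j) •
    (gaussianReal 0 1).map (fun u => filterStep Λ h σ (h j + σ * u) η)

theorem measurable_map_section {α β : Type*} [MeasurableSpace α] [MeasurableSpace β]
    (f : α → ℝ → β) (hf : Measurable (fun p : α × ℝ => f p.1 p.2)) :
    Measurable (fun η => (gaussianReal 0 1).map (f η)) := by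
  refine Measure.measurable_of_measurable_coe _ fun s hs => ?_
  have he : ∀ η, (gaussianReal 0 1).map (f η) s =
      gaussianReal 0 1 (Prod.mk η ⁻¹' ((fun p : α × ℝ => f p.1 p.2) ⁻¹' s)) := fun η =>
    Measure.map_apply (hf.comp measurable_prodMk_left) hs
  simp only [he]
  exact measurable_measure_prodMk_left (hf hs)

theorem measurable_filterLaw {d : ℕ} (Λ : Matrix (Fin d) (Fin d) ℝ) (h : Fin d → ℝ) (σ : ℝ) :
    Measurable (filterLaw Λ h σ) := by
  have hp : ∀ j, Measurable (fun p : (Fin d → ℝ) × ℝ => (p.1, h j + σ * p.2)) := by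
    intro j
    fun_prop
  have hm : ∀ j, Measurable (fun η : Fin d → ℝ =>
      (gaussianReal 0 1).map (fun u => filterStep Λ h σ (h j + σ * u) η)) := by
    intro j
    have hf := measurable_filterStep Λ h σ
    generalize filterStep Λ h σ = T at hf ⊢
    exact measurable_map_section (fun η u => T (h j + σ * u) η) (hf.comp (hp j))
  have hc : ∀ i j, Measurable (fun η : Fin d → ℝ => ENNReal.ofReal (η i * Λ i j)) := by
    intro i j
    have hi : Measurable (fun η : Fin d → ℝ => η i * Λ i j) := by fun_prop
    exact hi.ennreal_ofReal
  refine Measure.measurable_of_measurable_coe _ fun s hs => ?_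
  simp only [filterLaw, Measure.finsetSum_apply, Measure.smul_apply, smul_eq_mul]
  exact Finset.measurable_sum _ fun i _ => Finset.measurable_sum _ fun j _ =>
    (hc i j).mul (Measure.measurable_coe hs |>.comp (hm j))

/-- The transition kernel of the Markov process `π_n`. (It is written on all of `ℝ^d`, but only
points of the simplex matter.) -/
def filterKernel {d : ℕ} (Λ : Matrix (Fin d) (Fin d) ℝ) (h : Fin d → ℝ) (σ : ℝ) :
    Kernel (Fin d → ℝ) (Fin d → ℝ) where
  toFun := filterLaw Λ h σ
  measurable' := measurable_filterLaw Λ h σ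

/-- `M` is an invariant probability measure, on the simplex, of the filtering process `π_n` with
noise intensity `σ`. -/
structure IsInvariantFilterMeasure {d : ℕ} (Λ : Matrix (Fin d) (Fin d) ℝ) (h : Fin d → ℝ) (σ : ℝ)
    (M : Measure (Fin d → ℝ)) : Prop where
  isProbabilityMeasure : IsProbabilityMeasure M
  simplex : ∀ᵐ η ∂M, η ∈ stdSimplex ℝ (Fin d)
  invariant : Kernel.Invariant (filterKernel Λ h σ) M

/-- `P` is nonnegative definite, its entries sum to zero, and it solves the Lyapunov equation
`P = Λ* P Λ + (diag(μ) - μ μ*) h I h* (diag(μ) - μ μ*)`. -/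
structure IsLyapunovSolution {d : ℕ} (Λ : Matrix (Fin d) (Fin d) ℝ) (μ h : Fin d → ℝ) (I : ℝ)
    (P : Matrix (Fin d) (Fin d) ℝ) : Prop where
  posSemidef : P.PosSemidef
  sum_eq_zero : ∑ i, ∑ j, P i j = 0
  equation : P = Λᵀ * P * Λ +
    I • ((diagonal μ - vecMulVec μ μ) * vecMulVec h h * (diagonal μ - vecMulVec μ μ))

/-- `F` grows not faster than polynomially. -/
def PolynomialGrowth {d : ℕ} (F : (Fin d → ℝ) → ℝ) : Prop :=
  ∃ (C : ℝ) (k : ℕ), ∀ x, |F x| ≤ C * (1 + ‖x‖ ^ k)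

/-- The a priori error probability `1 - max_i μ_i`. -/
def priorError {d : ℕ} (μ : Fin d → ℝ) : ℝ := 1 - ⨆ i, μ i

/-- The set of maximal atoms of `μ`. -/
def maxAtoms {d : ℕ} (μ : Fin d → ℝ) : Set (Fin d) := {i | ∀ j, μ j ≤ μ i}

end

end StrongNoise

namespace StrongNoise
noncomputable section

/-- The `ℓ¹`-norm on `ℝ^d`. -/
def l1 {d : ℕ} (x : Fin d → ℝ) : ℝ := ∑ i, |x i|

section L1
variable {d : ℕ}

theorem l1_nonneg (x : Fin d → ℝ) : 0 ≤ l1 x := Finset.sum_nonneg fun _ _ => abs_nonneg _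

theorem l1_add_le (x y : Fin d → ℝ) : l1 (x + y) ≤ l1 x + l1 y := by
  unfold l1
  rw [← Finset.sum_add_distrib]
  exact Finset.sum_le_sum fun i _ => abs_add_le _ _

theorem l1_smul (a : ℝ) (x : Fin d → ℝ) : l1 (a • x) = |a| * l1 x := by
  simp [l1, abs_mul, Finset.mul_sum]

theorem l1_sub_comm (x y : Fin d → ℝ) : l1 (x - y) = l1 (y - x) := by
  simp [l1, abs_sub_comm]

theorem l1_zero : l1 (0 : Fin d → ℝ) = 0 := by simp [l1]

theorem abs_le_l1 (x : Fin d → ℝ) (i : Fin d) : |x i| ≤ l1 x :=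
  Finset.single_le_sum (f := fun i => |x i|) (fun _ _ => abs_nonneg _) (Finset.mem_univ i)

theorem norm_le_l1 (x : Fin d → ℝ) : ‖x‖ ≤ l1 x :=
  (pi_norm_le_iff_of_nonneg (l1_nonneg x)).2 fun i => by
    simpa using abs_le_l1 x i

theorem l1_eq_sum {x : Fin d → ℝ} (hx : ∀ i, 0 ≤ x i) : l1 x = ∑ i, x i :=
  Finset.sum_congr rfl fun i _ => abs_of_nonneg (hx i)

theorem l1_eq_one {x : Fin d → ℝ} (hx : x ∈ stdSimplex ℝ (Fin d)) : l1 x = 1 := by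
  rw [l1_eq_sum hx.1, hx.2]

theorem abs_l1_sub_l1_le (x y : Fin d → ℝ) : |l1 x - l1 y| ≤ l1 (x - y) := by
  unfold l1
  rw [← Finset.sum_sub_distrib]
  exact (Finset.abs_sum_le_sum_abs _ _).trans
    (Finset.sum_le_sum fun i _ => abs_abs_sub_abs_le _ _)

theorem abs_dotProduct_le_l1 (c x : Fin d → ℝ) {C : ℝ} (hc : ∀ i, |c i| ≤ C) :
    |c ⬝ᵥ x| ≤ C * l1 x := by
  unfold l1 dotProduct
  rw [Finset.mul_sum]
  refine (Finset.abs_sum_le_sum_abs _ _).trans (Finset.sum_le_sum fun i _ => ?_)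
  rw [abs_mul]
  exact mul_le_mul_of_nonneg_right (hc i) (abs_nonneg _)

theorem measurable_l1 : Measurable (l1 : (Fin d → ℝ) → ℝ) := by
  unfold l1
  fun_prop

theorem continuous_l1 : Continuous (l1 : (Fin d → ℝ) → ℝ) := by
  unfold l1
  fun_prop

end L1

section Chain
variable {d : ℕ} {Λ : Matrix (Fin d) (Fin d) ℝ} (hΛ : Λ ∈ Matrix.rowStochastic ℝ (Fin d))
include hΛ

theorem mulVec_transpose_nonneg {x : Fin d → ℝ} (hx : ∀ i, 0 ≤ x i) (j : Fin d) :
    0 ≤ (Λᵀ *ᵥ x) j := by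
  simp only [mulVec, dotProduct, transpose_apply]
  exact Finset.sum_nonneg fun i _ => mul_nonneg (hΛ.1 i j) (hx i)

theorem sum_mulVec_transpose (x : Fin d → ℝ) : ∑ j, (Λᵀ *ᵥ x) j = ∑ i, x i := by
  simp only [mulVec, dotProduct, transpose_apply]
  rw [Finset.sum_comm]
  refine Finset.sum_congr rfl fun i _ => ?_
  rw [← Finset.sum_mul, sum_row_of_mem_rowStochastic hΛ, one_mul]

theorem l1_mulVec_transpose_le (x : Fin d → ℝ) : l1 (Λᵀ *ᵥ x) ≤ l1 x := by
  unfold l1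
  calc ∑ j, |(Λᵀ *ᵥ x) j| ≤ ∑ j, (Λᵀ *ᵥ fun i => |x i|) j := by
        refine Finset.sum_le_sum fun j _ => ?_
        simp only [mulVec, dotProduct, transpose_apply]
        refine (Finset.abs_sum_le_sum_abs _ _).trans (Finset.sum_le_sum fun i _ => ?_)
        rw [abs_mul, abs_of_nonneg (hΛ.1 i j)]
    _ = _ := sum_mulVec_transpose hΛ _

theorem mulVec_transpose_mem {x : Fin d → ℝ} (hx : x ∈ stdSimplex ℝ (Fin d)) :
    Λᵀ *ᵥ x ∈ stdSimplex ℝ (Fin d) :=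
  ⟨mulVec_transpose_nonneg hΛ hx.1, by rw [sum_mulVec_transpose hΛ, hx.2]⟩

theorem pow_mulVec_transpose_mem {x : Fin d → ℝ} (hx : x ∈ stdSimplex ℝ (Fin d)) (n : ℕ) :
    Λᵀ ^ n *ᵥ x ∈ stdSimplex ℝ (Fin d) := by
  rw [← transpose_pow]
  exact mulVec_transpose_mem (pow_mem hΛ n) hx

end Chain

section Ergodic
variable {d : ℕ} {Λ : Matrix (Fin d) (Fin d) ℝ} {μ : Fin d → ℝ}

theorem IsErgodic.tendsto_pow (hμ : IsErgodic Λ μ) (i j : Fin d) :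
    Tendsto (fun n : ℕ => (Λ ^ n) i j) atTop (𝓝 (μ j)) := by
  have h := (tendsto_pi_nhds.1 (hμ.1 (Pi.single i 1) (single_mem_stdSimplex ℝ i))) j
  simpa [← transpose_pow] using h

theorem IsErgodic.mem_stdSimplex (hd : 0 < d) (hΛ : Λ ∈ Matrix.rowStochastic ℝ (Fin d))
    (hμ : IsErgodic Λ μ) : μ ∈ stdSimplex ℝ (Fin d) := by
  have hs := single_mem_stdSimplex ℝ (⟨0, hd⟩ : Fin d)
  exact (isClosed_stdSimplex ℝ (Fin d)).mem_of_tendsto (hμ.1 _ hs)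
    (Eventually.of_forall fun n => pow_mulVec_transpose_mem hΛ hs n)

theorem IsErgodic.mulVec_eq (hd : 0 < d) (hμ : IsErgodic Λ μ) : Λᵀ *ᵥ μ = μ := by
  have hs := single_mem_stdSimplex ℝ (⟨0, hd⟩ : Fin d)
  have h1 := hμ.1 _ hs
  have h2 := (tendsto_add_atTop_iff_nat 1).2 h1
  have h3 : Tendsto (fun n : ℕ => Λᵀ *ᵥ (Λᵀ ^ n *ᵥ Pi.single (⟨0, hd⟩ : Fin d) (1 : ℝ))) atTop
      (𝓝 (Λᵀ *ᵥ μ)) :=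
    ((continuous_const.matrix_mulVec continuous_id).tendsto μ).comp h1
  refine tendsto_nhds_unique h3 (h2.congr fun n => ?_)
  rw [mulVec_mulVec, pow_succ']

theorem IsErgodic.exists_pow_pos (hμ : IsErgodic Λ μ) :
    ∃ N : ℕ, 0 < N ∧ ∀ i j, 0 < (Λ ^ N) i j := by
  have h : ∀ᶠ n : ℕ in atTop, ∀ i j, 0 < (Λ ^ n) i j := by
    simp only [eventually_all]
    exact fun i j => (hμ.tendsto_pow i j).eventually_const_lt (hμ.2 j)
  obtain ⟨N, hN, hN'⟩ := (h.and (eventually_gt_atTop 0)).exists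
  exact ⟨N, hN', hN⟩

theorem IsErgodic.exists_contraction (hμ : IsErgodic Λ μ) :
    ∃ N : ℕ, 0 < N ∧ ∀ x : Fin d → ℝ, ∑ i, x i = 0 → l1 (Λᵀ ^ N *ᵥ x) ≤ l1 x / 2 := by
  have h : ∀ᶠ n : ℕ in atTop, ∀ i, ∑ j, |(Λ ^ n) i j - μ j| < 1 / 2 := by
    rw [eventually_all]
    intro i
    have : Tendsto (fun n : ℕ => ∑ j, |(Λ ^ n) i j - μ j|) atTop (𝓝 (∑ j, |μ j - μ j|)) :=
      tendsto_finsetSum _ fun j _ => ((hμ.tendsto_pow i j).sub_const _).abs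
    refine this.eventually_lt_const ?_
    simp
  obtain ⟨N, hN, hN'⟩ := (h.and (eventually_gt_atTop 0)).exists
  refine ⟨N, hN', fun x hx => ?_⟩
  have he : ∀ j, (Λᵀ ^ N *ᵥ x) j = ∑ i, ((Λ ^ N) i j - μ j) * x i := by
    intro j
    simp only [sub_mul, Finset.sum_sub_distrib, ← Finset.mul_sum, hx, mul_zero, sub_zero]
    simp [← transpose_pow, mulVec, dotProduct]
  unfold l1
  calc ∑ j, |(Λᵀ ^ N *ᵥ x) j| ≤ ∑ j, ∑ i, |(Λ ^ N) i j - μ j| * |x i| := by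
        refine Finset.sum_le_sum fun j _ => ?_
        rw [he]
        refine (Finset.abs_sum_le_sum_abs _ _).trans_eq ?_
        simp [abs_mul]
    _ = ∑ i, (∑ j, |(Λ ^ N) i j - μ j|) * |x i| := by
        rw [Finset.sum_comm]
        simp [Finset.sum_mul]
    _ ≤ ∑ i, 1 / 2 * |x i| := Finset.sum_le_sum fun i _ =>
        mul_le_mul_of_nonneg_right (hN i).le (abs_nonneg _)
    _ = _ := by rw [← Finset.mul_sum]; ring

/-- A norm that is contracted by `Λᵀ` on the vectors with zero sum if `N` is large enough. -/
def adaptedNorm (Λ : Matrix (Fin d) (Fin d) ℝ) (N : ℕ) (x : Fin d → ℝ) : ℝ :=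
  ∑ k ∈ Finset.range N, l1 (Λᵀ ^ k *ᵥ x)

theorem adaptedNorm_nonneg (N : ℕ) (x : Fin d → ℝ) : 0 ≤ adaptedNorm Λ N x :=
  Finset.sum_nonneg fun _ _ => l1_nonneg _

theorem adaptedNorm_add_le (N : ℕ) (x y : Fin d → ℝ) :
    adaptedNorm Λ N (x + y) ≤ adaptedNorm Λ N x + adaptedNorm Λ N y := by
  unfold adaptedNorm
  rw [← Finset.sum_add_distrib]
  refine Finset.sum_le_sum fun k _ => ?_
  rw [mulVec_add]
  exact l1_add_le _ _

theorem continuous_adaptedNorm (N : ℕ) : Continuous (adaptedNorm Λ N) :=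
  continuous_finsetSum _ fun _ _ =>
    continuous_l1.comp (continuous_const.matrix_mulVec continuous_id)

theorem l1_le_adaptedNorm {N : ℕ} (hN : 0 < N) (x : Fin d → ℝ) : l1 x ≤ adaptedNorm Λ N x := by
  have := Finset.single_le_sum (f := fun k => l1 (Λᵀ ^ k *ᵥ x)) (fun _ _ => l1_nonneg _)
    (Finset.mem_range.2 hN)
  simpa [adaptedNorm] using this

theorem adaptedNorm_le (hΛ : Λ ∈ Matrix.rowStochastic ℝ (Fin d)) (N : ℕ) (x : Fin d → ℝ) :
    adaptedNorm Λ N x ≤ N * l1 x := by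
  calc adaptedNorm Λ N x ≤ ∑ _k ∈ Finset.range N, l1 x := Finset.sum_le_sum fun k _ => by
        rw [← transpose_pow]
        exact l1_mulVec_transpose_le (pow_mem hΛ k) x
    _ = _ := by simp

theorem adaptedNorm_mulVec_le (hΛ : Λ ∈ Matrix.rowStochastic ℝ (Fin d)) {N : ℕ} (hN : 0 < N)
    (hc : ∀ x : Fin d → ℝ, ∑ i, x i = 0 → l1 (Λᵀ ^ N *ᵥ x) ≤ l1 x / 2) {x : Fin d → ℝ}
    (hx : ∑ i, x i = 0) :
    adaptedNorm Λ N (Λᵀ *ᵥ x) ≤ (1 - 1 / (2 * N)) * adaptedNorm Λ N x := by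
  have h1 : adaptedNorm Λ N (Λᵀ *ᵥ x) + l1 x = adaptedNorm Λ N x + l1 (Λᵀ ^ N *ᵥ x) := by
    unfold adaptedNorm
    rw [← Finset.sum_range_succ, Finset.sum_range_succ']
    simp [mulVec_mulVec, pow_succ]
  have h2 := hc x hx
  have h3 := adaptedNorm_le hΛ N x
  have hN' : (0 : ℝ) < N := by exact_mod_cast hN
  have h4 : 1 / (2 * N) * adaptedNorm Λ N x ≤ l1 x / 2 := by
    rw [div_mul_eq_mul_div, div_le_div_iff₀ (by positivity) (by positivity)]
    linarith
  linarith

theorem IsErgodic.exists_geometric (hΛ : Λ ∈ Matrix.rowStochastic ℝ (Fin d))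
    (hμ : IsErgodic Λ μ) :
    ∃ C ρ : ℝ, 0 ≤ ρ ∧ ρ < 1 ∧ ∀ x : Fin d → ℝ, ∑ i, x i = 0 → ∀ n : ℕ,
      l1 (Λᵀ ^ n *ᵥ x) ≤ C * ρ ^ n * l1 x := by
  obtain ⟨N, hN, hc⟩ := hμ.exists_contraction
  have hN' : (1 : ℝ) ≤ N := by exact_mod_cast hN
  have hr0 : (0 : ℝ) ≤ 1 - 1 / (2 * N) := by
    rw [sub_nonneg, div_le_one (by positivity)]
    linarith
  refine ⟨N, 1 - 1 / (2 * N), hr0, by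
    have : (0 : ℝ) < 1 / (2 * N) := by positivity
    linarith, fun x hx n => ?_⟩
  have key : adaptedNorm Λ N (Λᵀ ^ n *ᵥ x) ≤ (1 - 1 / (2 * N)) ^ n * adaptedNorm Λ N x := by
    induction n with
    | zero => simp
    | succ n ih =>
      rw [pow_succ' Λᵀ, ← mulVec_mulVec]
      refine (adaptedNorm_mulVec_le hΛ hN hc ?_).trans ?_
      · rw [← transpose_pow, sum_mulVec_transpose (pow_mem hΛ n), hx]
      · rw [pow_succ', mul_assoc]
        exact mul_le_mul_of_nonneg_left ih hr0
  calc l1 (Λᵀ ^ n *ᵥ x) ≤ _ := (l1_le_adaptedNorm hN _).trans key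
    _ ≤ (1 - 1 / (2 * N)) ^ n * (N * l1 x) :=
        mul_le_mul_of_nonneg_left (adaptedNorm_le hΛ N x) (pow_nonneg hr0 n)
    _ = _ := by ring

end Ergodic

section Lyapunov
variable {d : ℕ} {Λ : Matrix (Fin d) (Fin d) ℝ} {μ h : Fin d → ℝ}

/-- The vector `(diag(μ) - μ μ*) h`. -/
def noiseVec (μ h : Fin d → ℝ) : Fin d → ℝ := (diagonal μ - vecMulVec μ μ) *ᵥ h

theorem noiseVec_apply (μ h : Fin d → ℝ) (i : Fin d) :
    noiseVec μ h i = μ i * (h i - μ ⬝ᵥ h) := by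
  simp [noiseVec, sub_mulVec, mulVec_diagonal, vecMulVec_mulVec]
  ring

theorem sum_noiseVec (hμ : μ ∈ stdSimplex ℝ (Fin d)) : ∑ i, noiseVec μ h i = 0 := by
  simp only [noiseVec_apply, mul_sub, Finset.sum_sub_distrib, ← Finset.sum_mul, hμ.2]
  simp [dotProduct]

theorem noise_matrix_eq (μ h : Fin d → ℝ) :
    (1 : ℝ) • ((diagonal μ - vecMulVec μ μ) * vecMulVec h h * (diagonal μ - vecMulVec μ μ)) =
      vecMulVec (noiseVec μ h) (noiseVec μ h) := by
  rw [one_smul, mul_vecMulVec, vecMulVec_mul]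
  congr 1
  rw [noiseVec, ← mulVec_transpose]
  congr 1
  ext i j
  simp [diagonal_apply, vecMulVec_apply, mul_comm, eq_comm]
  grind

theorem exists_isLyapunovSolution (hd : 0 < d) (hΛ : Λ ∈ Matrix.rowStochastic ℝ (Fin d))
    (hμ : IsErgodic Λ μ) (h : Fin d → ℝ) : ∃ P, IsLyapunovSolution Λ μ h 1 P := by
  set b := noiseVec μ h with hb
  have hb0 : ∑ i, b i = 0 := sum_noiseVec (hμ.mem_stdSimplex hd hΛ)
  obtain ⟨C, ρ, hρ0, hρ1, hC⟩ := hμ.exists_geometric hΛ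
  set B : ℕ → Fin d → ℝ := fun n => Λᵀ ^ n *ᵥ b with hB
  have hBs : ∀ n, ∑ i, B n i = 0 := fun n => by
    simp only [hB]
    rw [← transpose_pow, sum_mulVec_transpose (pow_mem hΛ n), hb0]
  have hsum : ∀ i j, Summable fun n => B n i * B n j := by
    intro i j
    have hg : Summable fun n : ℕ => (C * l1 b) ^ 2 * (ρ ^ 2) ^ n :=
      (summable_geometric_of_lt_one (by positivity) (by nlinarith)).mul_left _
    refine Summable.of_norm_bounded hg fun n => ?_
    have h1 : ∀ k, |B n k| ≤ C * ρ ^ n * l1 b := fun k => (abs_le_l1 _ k).trans (hC b hb0 n)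
    rw [Real.norm_eq_abs, abs_mul]
    calc |B n i| * |B n j| ≤ (C * ρ ^ n * l1 b) * (C * ρ ^ n * l1 b) :=
          mul_le_mul (h1 i) (h1 j) (abs_nonneg _) ((abs_nonneg _).trans (h1 i))
      _ = _ := by ring
  have hBsucc : ∀ n, B (n + 1) = Λᵀ *ᵥ B n := fun n => by
    simp only [hB, mulVec_mulVec, pow_succ']
  refine ⟨Matrix.of fun i j => ∑' n, B n i * B n j, ?_, ?_, ?_⟩
  · refine PosSemidef.of_dotProduct_mulVec_nonneg ?_ fun x => ?_
    · ext i j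
      simp [mul_comm]
    · have : star x ⬝ᵥ (Matrix.of fun i j => ∑' n, B n i * B n j) *ᵥ x =
          ∑' n, (∑ i, x i * B n i) ^ 2 := by
        simp only [dotProduct, mulVec, of_apply, Pi.star_apply, star_trivial]
        have h1 : ∀ n, (∑ i, x i * B n i) ^ 2 = ∑ i, ∑ j, x i * (B n i * B n j * x j) := by
          intro n
          rw [sq, Finset.sum_mul_sum]
          exact Finset.sum_congr rfl fun i _ => Finset.sum_congr rfl fun j _ => by ring
        simp only [h1]
        rw [Summable.tsum_finsetSum]
        · refine Finset.sum_congr rfl fun i _ => ?_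
          rw [Summable.tsum_finsetSum, Finset.mul_sum]
          · refine Finset.sum_congr rfl fun j _ => ?_
            rw [tsum_mul_left, tsum_mul_right]
          · exact fun j _ => ((hsum i j).mul_right _).mul_left _
        · exact fun i _ => summable_sum fun j _ => ((hsum i j).mul_right _).mul_left _
      rw [this]
      exact tsum_nonneg fun n => sq_nonneg _
  · simp only [of_apply]
    have : ∀ i, ∑ j, ∑' n, B n i * B n j = 0 := fun i => by
      rw [← Summable.tsum_finsetSum fun j _ => hsum i j]
      simp [← Finset.mul_sum, hBs]
    simp [this]
  · rw [noise_matrix_eq, ← hb]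
    ext i j
    simp only [of_apply, Matrix.add_apply, vecMulVec_apply]
    rw [(hsum i j).tsum_eq_zero_add, add_comm]
    congr 1
    · simp only [hBsucc]
      simp only [mul_apply, mulVec, dotProduct, of_apply]
      have h1 : ∀ n, (∑ k, Λᵀ i k * B n k) * ∑ k, Λᵀ j k * B n k =
          ∑ l, ∑ k, Λᵀ i k * (B n k * B n l) * Λ l j := by
        intro n
        rw [Finset.sum_mul_sum, Finset.sum_comm]
        refine Finset.sum_congr rfl fun l _ => Finset.sum_congr rfl fun k _ => ?_
        simp only [transpose_apply]
        ring
      simp only [h1]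
      rw [Summable.tsum_finsetSum]
      · refine Finset.sum_congr rfl fun l _ => ?_
        rw [Summable.tsum_finsetSum, Finset.sum_mul]
        · refine Finset.sum_congr rfl fun k _ => ?_
          rw [tsum_mul_right, tsum_mul_left]
        · exact fun k _ => ((hsum k l).mul_left _).mul_right _
      · exact fun l _ => summable_sum fun k _ => ((hsum k l).mul_left _).mul_right _
    · simp [hB]

theorem IsLyapunovSolution.mulVec_one {I : ℝ} {P : Matrix (Fin d) (Fin d) ℝ}
    (hP : IsLyapunovSolution Λ μ h I P) : P *ᵥ 1 = 0 := by
  refine (hP.posSemidef.dotProduct_mulVec_zero_iff 1).1 ?_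
  simpa [dotProduct, mulVec] using hP.sum_eq_zero

theorem IsLyapunovSolution.unique {I : ℝ} (hμ : IsErgodic Λ μ) {P P' : Matrix (Fin d) (Fin d) ℝ}
    (hP : IsLyapunovSolution Λ μ h I P) (hP' : IsLyapunovSolution Λ μ h I P') : P' = P := by
  set D := P' - P with hD
  have hD1 : D *ᵥ 1 = 0 := by rw [hD, sub_mulVec, hP.mulVec_one, hP'.mulVec_one, sub_zero]
  have hstep : D = Λᵀ * D * Λ := by
    rw [hD, Matrix.mul_sub, Matrix.sub_mul]
    conv_lhs => rw [hP.equation, hP'.equation]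
    abel
  have hn : ∀ n : ℕ, D = Λᵀ ^ n * D * Λ ^ n := by
    intro n
    induction n with
    | zero => simp
    | succ n ih =>
      conv_lhs => rw [ih, hstep]
      rw [pow_succ, pow_succ']
      simp only [Matrix.mul_assoc]
  have hlim : Tendsto (fun n : ℕ => Λᵀ ^ n * D * Λ ^ n) atTop
      (𝓝 ((Matrix.of fun _ j => μ j)ᵀ * D * (Matrix.of fun _ j => μ j))) := by
    have h1 : Tendsto (fun n : ℕ => Λ ^ n) atTop (𝓝 (Matrix.of fun _ j => μ j)) :=
      tendsto_pi_nhds.2 fun i => tendsto_pi_nhds.2 fun j => hμ.tendsto_pow i j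
    have h2 : Continuous fun A : Matrix (Fin d) (Fin d) ℝ => Aᵀ * D * A := by fun_prop
    have := (h2.tendsto _).comp h1
    simpa [Function.comp_def] using this
  have h0 : D = (Matrix.of fun _ j => μ j)ᵀ * D * (Matrix.of fun _ j => μ j) :=
    tendsto_nhds_unique (tendsto_const_nhds.congr hn) hlim
  have h3 : D * (Matrix.of fun (_ : Fin d) j => μ j) = 0 := by
    ext i j
    have := congrFun hD1 i
    simp only [mulVec, dotProduct, Pi.one_apply, mul_one, Pi.zero_apply] at this
    simp [mul_apply, ← Finset.sum_mul, this]
  rw [Matrix.mul_assoc, h3, Matrix.mul_zero] at h0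
  exact sub_eq_zero.1 h0

theorem IsLyapunovSolution.quadratic_form {P : Matrix (Fin d) (Fin d) ℝ}
    (hP : IsLyapunovSolution Λ μ h 1 P) (t : Fin d → ℝ) :
    t ⬝ᵥ P *ᵥ t = (Λ *ᵥ t) ⬝ᵥ P *ᵥ (Λ *ᵥ t) + (t ⬝ᵥ noiseVec μ h) ^ 2 := by
  conv_lhs => rw [hP.equation, noise_matrix_eq]
  rw [add_mulVec, dotProduct_add, vecMulVec_mulVec, Matrix.mul_assoc, ← mulVec_mulVec,
    ← mulVec_mulVec, dotProduct_mulVec, vecMul_transpose]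
  congr 1
  simp [dotProduct_smul, sq, dotProduct_comm]

end Lyapunov


/-- The likelihood ratio of `gaussianReal c 1` with respect to `gaussianReal 0 1`. -/
def shiftDensity (c v : ℝ) : ℝ := Real.exp (c * v - c ^ 2 / 2)

theorem shiftDensity_pos (c v : ℝ) : 0 < shiftDensity c v := Real.exp_pos _

theorem measurable_shiftDensity (c : ℝ) : Measurable (shiftDensity c) := by
  unfold shiftDensity
  fun_prop

theorem gaussianPDFReal_eq_mul (c v : ℝ) :
    gaussianPDFReal c 1 v = gaussianPDFReal 0 1 v * shiftDensity c v := by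
  simp only [gaussianPDFReal, shiftDensity, mul_assoc, ← Real.exp_add]
  congr 2
  simp
  ring

theorem lintegral_gaussian_shift (c : ℝ) {F : ℝ → ENNReal} (hF : Measurable F) :
    ∫⁻ u, F (c + u) ∂(gaussianReal 0 1) =
      ∫⁻ v, ENNReal.ofReal (shiftDensity c v) * F v ∂(gaussianReal 0 1) := by
  have h1 : ∫⁻ u, F (c + u) ∂(gaussianReal 0 1) = ∫⁻ u, F u ∂(gaussianReal c 1) := by
    have := gaussianReal_map_const_add (μ := 0) (v := 1) c
    rw [zero_add] at this
    rw [← this, lintegral_map hF (by fun_prop)]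
  rw [h1, gaussianReal_of_var_ne_zero _ one_ne_zero, gaussianReal_of_var_ne_zero _ one_ne_zero,
    lintegral_withDensity_eq_lintegral_mul _ (measurable_gaussianPDF _ _) hF,
    lintegral_withDensity_eq_lintegral_mul (g := fun v => ENNReal.ofReal (shiftDensity c v) * F v) _
      (measurable_gaussianPDF _ _) ((measurable_shiftDensity c).ennreal_ofReal.mul hF)]
  refine lintegral_congr fun v => ?_
  simp only [Pi.mul_apply, gaussianPDF, ← mul_assoc]
  rw [gaussianPDFReal_eq_mul, ENNReal.ofReal_mul (gaussianPDFReal_nonneg _ _ _)]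

/-- Normalization of a vector in the `ℓ¹`-norm. -/
def normalize {d : ℕ} (x : Fin d → ℝ) : Fin d → ℝ := (l1 x)⁻¹ • x

/-- One step of the unnormalized filter, with the observation `v` in units of the noise. -/
def obsMat {d : ℕ} (c : Fin d → ℝ) (Λ : Matrix (Fin d) (Fin d) ℝ) (v : ℝ) :
    Matrix (Fin d) (Fin d) ℝ :=
  diagonal (fun i => shiftDensity (c i) v) * Λᵀ

/-- The product of the first `n` matrices of the unnormalized filter. -/
def obsProd {d : ℕ} (c : Fin d → ℝ) (Λ : Matrix (Fin d) (Fin d) ℝ) :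
    (n : ℕ) → (Fin n → ℝ) → Matrix (Fin d) (Fin d) ℝ
  | 0, _ => 1
  | n + 1, v => obsMat c Λ (v (Fin.last n)) * obsProd c Λ n (Fin.init v)

/-- The standard Gaussian measure on `ℝⁿ`, as a product measure. -/
abbrev gaussPi (n : ℕ) : Measure (Fin n → ℝ) := Measure.pi fun _ => gaussianReal 0 1

theorem measurable_snoc (n : ℕ) :
    Measurable fun p : (Fin n → ℝ) × ℝ => (Fin.snoc p.1 p.2 : Fin (n + 1) → ℝ) := by
  refine measurable_pi_lambda _ fun i => ?_
  refine Fin.lastCases ?_ (fun i => ?_) i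
  · simpa using measurable_snd
  · simp only [Fin.snoc_castSucc]
    fun_prop

theorem lintegral_gaussPi_succ (n : ℕ) {F : (Fin (n + 1) → ℝ) → ENNReal} (hF : Measurable F) :
    ∫⁻ v, F v ∂(gaussPi (n + 1)) =
      ∫⁻ v, ∫⁻ t, F (Fin.snoc v t) ∂(gaussianReal 0 1) ∂(gaussPi n) := by
  have h := (measurePreserving_piFinSuccAbove (fun _ : Fin (n + 1) => gaussianReal 0 1)
    (Fin.last n)).symm
  rw [gaussPi, ← h.lintegral_comp hF, lintegral_prod_symm]
  · refine lintegral_congr fun v => lintegral_congr fun t => ?_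
    simp [MeasurableEquiv.piFinSuccAbove_symm_apply, Fin.insertNthEquiv]
  · exact (hF.comp (MeasurableEquiv.measurable _)).aemeasurable

section Obs
variable {d : ℕ} {c : Fin d → ℝ} {Λ : Matrix (Fin d) (Fin d) ℝ}

theorem measurable_normalize : Measurable (normalize : (Fin d → ℝ) → Fin d → ℝ) :=
  measurable_l1.inv.smul measurable_id

theorem _root_.Measurable.ofReal_l1 {α : Type*} [MeasurableSpace α] {f : α → Fin d → ℝ}
    (hf : Measurable f) : Measurable fun a => ENNReal.ofReal (l1 (f a)) :=
  (measurable_l1.comp hf).ennreal_ofReal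

theorem _root_.Measurable.normalize {α : Type*} [MeasurableSpace α] {f : α → Fin d → ℝ}
    (hf : Measurable f) : Measurable fun a => normalize (f a) :=
  measurable_normalize.comp hf

theorem _root_.Measurable.comp_normalize {α β : Type*} [MeasurableSpace α] [MeasurableSpace β]
    {F : (Fin d → ℝ) → β} (hF : Measurable F) {f : α → Fin d → ℝ} (hf : Measurable f) :
    Measurable fun a => F (StrongNoise.normalize (f a)) :=
  hF.comp hf.normalize

theorem normalize_smul {a : ℝ} (ha : 0 < a) (x : Fin d → ℝ) : normalize (a • x) = normalize x := by
  rw [normalize, l1_smul, abs_of_pos ha, smul_smul, mul_inv, mul_comm a⁻¹, mul_assoc,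
    inv_mul_cancel₀ ha.ne', mul_one, normalize]

theorem normalize_mem {x : Fin d → ℝ} (hx : ∀ i, 0 ≤ x i) (h : 0 < l1 x) :
    normalize x ∈ stdSimplex ℝ (Fin d) := by
  refine ⟨fun i => mul_nonneg (inv_nonneg.2 h.le) (hx i), ?_⟩
  simp only [normalize, Pi.smul_apply, smul_eq_mul, ← Finset.mul_sum]
  rw [← l1_eq_sum hx, inv_mul_cancel₀ h.ne']

theorem obsMat_mulVec (v : ℝ) (x : Fin d → ℝ) (i : Fin d) :
    (obsMat c Λ v *ᵥ x) i = shiftDensity (c i) v * (Λᵀ *ᵥ x) i := by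
  rw [obsMat, ← mulVec_mulVec, mulVec_diagonal]

theorem measurable_obsMat (c : Fin d → ℝ) (Λ : Matrix (Fin d) (Fin d) ℝ) (i j : Fin d) :
    Measurable fun v => obsMat c Λ v i j := by
  simp only [obsMat, diagonal_mul]
  exact (measurable_shiftDensity _).mul_const _

theorem measurable_obsMat_mulVec (c : Fin d → ℝ) (Λ : Matrix (Fin d) (Fin d) ℝ) :
    Measurable fun p : ℝ × (Fin d → ℝ) => obsMat c Λ p.1 *ᵥ p.2 := by
  refine measurable_pi_lambda _ fun i => ?_
  simp only [mulVec, dotProduct]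
  refine Finset.measurable_sum _ fun j _ => ?_
  have := measurable_obsMat c Λ i j
  fun_prop

theorem measurable_obsMat_mulVec_const (c : Fin d → ℝ) (Λ : Matrix (Fin d) (Fin d) ℝ)
    (x : Fin d → ℝ) : Measurable fun v => obsMat c Λ v *ᵥ x := by
  refine measurable_pi_lambda _ fun i => ?_
  simp only [mulVec, dotProduct]
  exact Finset.measurable_sum _ fun j _ => (measurable_obsMat c Λ i j).mul_const _

theorem measurable_obsProd (c : Fin d → ℝ) (Λ : Matrix (Fin d) (Fin d) ℝ) (n : ℕ) (i j : Fin d) :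
    Measurable fun v => obsProd c Λ n v i j := by
  induction n generalizing i j with
  | zero => exact measurable_const
  | succ n ih =>
    simp only [obsProd, mul_apply]
    refine Finset.measurable_sum _ fun k _ => ?_
    refine ((measurable_obsMat c Λ i k).comp (measurable_pi_apply _)).mul ((ih k j).comp ?_)
    exact measurable_pi_lambda _ fun i => measurable_pi_apply _

theorem measurable_obsProd_mulVec (c : Fin d → ℝ) (Λ : Matrix (Fin d) (Fin d) ℝ) (n : ℕ)
    (x : Fin d → ℝ) : Measurable fun v => obsProd c Λ n v *ᵥ x := by
  refine measurable_pi_lambda _ fun i => ?_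
  simp only [mulVec, dotProduct]
  exact Finset.measurable_sum _ fun j _ => (measurable_obsProd c Λ n i j).mul_const _

theorem obsProd_snoc (n : ℕ) (v : Fin n → ℝ) (t : ℝ) :
    obsProd c Λ (n + 1) (Fin.snoc v t) = obsMat c Λ t * obsProd c Λ n v := by
  simp [obsProd]

theorem filterStep_eq (h : Fin d → ℝ) {σ : ℝ} (hσ : 0 < σ) (v : ℝ) (x : Fin d → ℝ) :
    filterStep Λ h σ (σ * v) x = normalize (obsMat (fun i => h i / σ) Λ v *ᵥ x) := by
  have h1 : diagonal (fun i => gaussianPDFReal 0 1 ((σ * v - h i) / σ)) *ᵥ (Λᵀ *ᵥ x) =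
      gaussianPDFReal 0 1 v • (obsMat (fun i => h i / σ) Λ v *ᵥ x) := by
    ext i
    rw [mulVec_diagonal, Pi.smul_apply, obsMat_mulVec, smul_eq_mul, ← mul_assoc,
      ← gaussianPDFReal_eq_mul]
    congr 1
    simp only [gaussianPDFReal]
    congr 3
    field_simp
    ring
  rw [← normalize_smul (gaussianPDFReal_pos 0 1 v one_ne_zero), ← h1]
  rfl

variable (hΛ : Λ ∈ Matrix.rowStochastic ℝ (Fin d))
include hΛ

theorem obsMat_mulVec_nonneg (v : ℝ) {x : Fin d → ℝ} (hx : ∀ i, 0 ≤ x i) (i : Fin d) :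
    0 ≤ (obsMat c Λ v *ᵥ x) i := by
  rw [obsMat_mulVec]
  exact mul_nonneg (shiftDensity_pos _ _).le (mulVec_transpose_nonneg hΛ hx i)

theorem l1_obsMat_mulVec_pos (v : ℝ) {x : Fin d → ℝ} (hx : ∀ i, 0 ≤ x i) (h : 0 < l1 x) :
    0 < l1 (obsMat c Λ v *ᵥ x) := by
  rw [l1_eq_sum hx, ← sum_mulVec_transpose hΛ] at h
  rw [l1_eq_sum (obsMat_mulVec_nonneg hΛ v hx)]
  obtain ⟨i, -, hi⟩ := Finset.exists_lt_of_sum_lt (s := Finset.univ) (f := fun _ : Fin d => (0 : ℝ))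
    (by simpa using h)
  refine Finset.sum_pos' (fun i _ => obsMat_mulVec_nonneg hΛ v hx i) ⟨i, Finset.mem_univ i, ?_⟩
  rw [obsMat_mulVec]
  exact mul_pos (shiftDensity_pos _ _) hi

theorem obsProd_mulVec_nonneg (n : ℕ) (v : Fin n → ℝ) {x : Fin d → ℝ} (hx : ∀ i, 0 ≤ x i)
    (i : Fin d) : 0 ≤ (obsProd c Λ n v *ᵥ x) i := by
  induction n generalizing i with
  | zero => simpa [obsProd] using hx i
  | succ n ih =>
    rw [obsProd, ← mulVec_mulVec]
    exact obsMat_mulVec_nonneg hΛ _ (ih _) i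

theorem l1_obsProd_mulVec_pos (n : ℕ) (v : Fin n → ℝ) {x : Fin d → ℝ} (hx : ∀ i, 0 ≤ x i)
    (h : 0 < l1 x) : 0 < l1 (obsProd c Λ n v *ᵥ x) := by
  induction n with
  | zero => simpa [obsProd] using h
  | succ n ih =>
    rw [obsProd, ← mulVec_mulVec]
    exact l1_obsMat_mulVec_pos hΛ _ (obsProd_mulVec_nonneg hΛ n _ hx) (ih _)

theorem lintegral_filterLaw (h : Fin d → ℝ) {σ : ℝ} (hσ : 0 < σ) {η : Fin d → ℝ}
    (hη : ∀ i, 0 ≤ η i) {F : (Fin d → ℝ) → ENNReal} (hF : Measurable F) :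
    ∫⁻ x, F x ∂(filterLaw Λ h σ η) =
      ∫⁻ v, ENNReal.ofReal (l1 (obsMat (fun i => h i / σ) Λ v *ᵥ η)) *
        F (normalize (obsMat (fun i => h i / σ) Λ v *ᵥ η)) ∂(gaussianReal 0 1) := by
  have hm : Measurable fun v : ℝ => obsMat (fun i => h i / σ) Λ v *ᵥ η :=
    measurable_obsMat_mulVec_const _ Λ η
  set G : ℝ → ENNReal := fun v => F (normalize (obsMat (fun i => h i / σ) Λ v *ᵥ η)) with hG
  have hGm : Measurable G := hF.comp (measurable_normalize.comp hm)
  have hstep : ∀ j, Measurable fun u : ℝ => filterStep Λ h σ (h j + σ * u) η := by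
    intro j
    have hf := measurable_filterStep Λ h σ
    generalize filterStep Λ h σ = T at hf ⊢
    have hp : Measurable fun u : ℝ => (η, h j + σ * u) := by fun_prop
    exact hf.comp hp
  have h1 : ∀ i j, ∫⁻ x, F x ∂(ENNReal.ofReal (η i * Λ i j) •
      (gaussianReal 0 1).map (fun u => filterStep Λ h σ (h j + σ * u) η)) =
      ∫⁻ v, ENNReal.ofReal (η i * Λ i j) *
        (ENNReal.ofReal (shiftDensity (h j / σ) v) * G v) ∂(gaussianReal 0 1) := by
    intro i j
    have hs : ∫⁻ x, F x ∂(gaussianReal 0 1).map (fun u => filterStep Λ h σ (h j + σ * u) η) =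
        ∫⁻ u, G (h j / σ + u) ∂(gaussianReal 0 1) := by
      rw [lintegral_map hF (hstep j)]
      refine lintegral_congr fun u => ?_
      rw [hG, show h j + σ * u = σ * (h j / σ + u) by field_simp, filterStep_eq h hσ]
    rw [lintegral_smul_measure, hs, lintegral_gaussian_shift _ hGm, smul_eq_mul,
      lintegral_const_mul' _ _ ENNReal.ofReal_ne_top]
  simp only [filterLaw, lintegral_finsetSum_measure, h1]
  have h2 : ∀ i j, Measurable fun v => ENNReal.ofReal (η i * Λ i j) *
        (ENNReal.ofReal (shiftDensity (h j / σ) v) * G v) := fun i j =>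
    ((measurable_shiftDensity _).ennreal_ofReal.mul hGm).const_mul _
  simp only [← lintegral_finsetSum _ fun j _ => h2 _ j]
  rw [← lintegral_finsetSum _ fun i _ => Finset.measurable_fun_sum _ fun j _ => h2 i j]
  refine lintegral_congr fun v => ?_
  simp only [← mul_assoc, ← Finset.sum_mul]
  congr 1
  rw [l1_eq_sum (obsMat_mulVec_nonneg hΛ v hη), Finset.sum_comm,
    ENNReal.ofReal_sum_of_nonneg fun i _ => obsMat_mulVec_nonneg hΛ v hη i]
  refine Finset.sum_congr rfl fun j _ => ?_
  rw [← Finset.sum_mul, ← ENNReal.ofReal_sum_of_nonneg fun i _ => mul_nonneg (hη i) (hΛ.1 i j),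
    ← ENNReal.ofReal_mul (Finset.sum_nonneg fun i _ => mul_nonneg (hη i) (hΛ.1 i j)),
    obsMat_mulVec, mul_comm]
  simp [mulVec, dotProduct, mul_comm]

theorem lintegral_l1_obsMat {x : Fin d → ℝ} (hx : ∀ i, 0 ≤ x i) :
    ∫⁻ v, ENNReal.ofReal (l1 (obsMat c Λ v *ᵥ x)) ∂(gaussianReal 0 1) =
      ENNReal.ofReal (l1 x) := by
  have h1 : ∀ i, ∫⁻ v, ENNReal.ofReal (shiftDensity (c i) v) ∂(gaussianReal 0 1) = 1 := by
    intro i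
    have := lintegral_gaussian_shift (c i) (F := fun _ => 1) measurable_const
    simpa using this.symm
  have h2 : ∀ v, ENNReal.ofReal (l1 (obsMat c Λ v *ᵥ x)) =
      ∑ i, ENNReal.ofReal (shiftDensity (c i) v) * ENNReal.ofReal ((Λᵀ *ᵥ x) i) := by
    intro v
    rw [l1_eq_sum (obsMat_mulVec_nonneg hΛ v hx),
      ENNReal.ofReal_sum_of_nonneg fun i _ => obsMat_mulVec_nonneg hΛ v hx i]
    refine Finset.sum_congr rfl fun i _ => ?_
    rw [obsMat_mulVec, ENNReal.ofReal_mul (shiftDensity_pos _ _).le]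
  simp only [h2]
  rw [lintegral_finsetSum _ fun i _ => (measurable_shiftDensity _).ennreal_ofReal.mul_const _]
  simp only [lintegral_mul_const _ (measurable_shiftDensity _).ennreal_ofReal, h1, one_mul]
  rw [← ENNReal.ofReal_sum_of_nonneg fun i _ => mulVec_transpose_nonneg hΛ hx i,
    sum_mulVec_transpose hΛ, l1_eq_sum hx]

theorem lintegral_l1_obsProd (n : ℕ) {x : Fin d → ℝ} (hx : ∀ i, 0 ≤ x i) :
    ∫⁻ v, ENNReal.ofReal (l1 (obsProd c Λ n v *ᵥ x)) ∂(gaussPi n) = ENNReal.ofReal (l1 x) := by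
  induction n with
  | zero => simp [obsProd]
  | succ n ih =>
    rw [lintegral_gaussPi_succ n
      (measurable_obsProd_mulVec c Λ _ x).ofReal_l1, ← ih]
    refine lintegral_congr fun v => ?_
    simp only [obsProd_snoc, ← mulVec_mulVec]
    exact lintegral_l1_obsMat hΛ (obsProd_mulVec_nonneg hΛ n v hx)

end Obs

section Kernels
variable {d : ℕ} {Λ : Matrix (Fin d) (Fin d) ℝ}

theorem measurableSet_stdSimplex : MeasurableSet (stdSimplex ℝ (Fin d)) :=
  (isClosed_stdSimplex ℝ (Fin d)).measurableSet

open Classical in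
/-- The filter kernel, modified outside of the simplex such that it becomes a Markov kernel. -/
def simplexKernel (Λ : Matrix (Fin d) (Fin d) ℝ) (h : Fin d → ℝ) (σ : ℝ) :
    Kernel (Fin d → ℝ) (Fin d → ℝ) :=
  Kernel.piecewise (measurableSet_stdSimplex (d := d)) (filterKernel Λ h σ) Kernel.id

theorem simplexKernel_apply (h : Fin d → ℝ) (σ : ℝ) {η : Fin d → ℝ}
    (hη : η ∈ stdSimplex ℝ (Fin d)) : simplexKernel Λ h σ η = filterLaw Λ h σ η := by
  classical
  rw [simplexKernel, Kernel.piecewise_apply, if_pos hη]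
  rfl

theorem isMarkovKernel_simplexKernel (hΛ : Λ ∈ Matrix.rowStochastic ℝ (Fin d)) (h : Fin d → ℝ)
    {σ : ℝ} (hσ : 0 < σ) : IsMarkovKernel (simplexKernel Λ h σ) := by
  refine ⟨fun η => ⟨?_⟩⟩
  by_cases hη : η ∈ stdSimplex ℝ (Fin d)
  · rw [simplexKernel_apply h σ hη, ← lintegral_one,
      lintegral_filterLaw hΛ h hσ hη.1 measurable_const]
    simp only [mul_one]
    rw [lintegral_l1_obsMat hΛ hη.1, l1_eq_one hη, ENNReal.ofReal_one]
  · classical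
    rw [simplexKernel, Kernel.piecewise_apply, if_neg hη]
    simp

theorem isMarkovKernel_pow {α : Type*} [MeasurableSpace α] (κ : Kernel α α) [IsMarkovKernel κ]
    (n : ℕ) : IsMarkovKernel (κ ^ n) := by
  induction n with
  | zero => exact inferInstanceAs (IsMarkovKernel Kernel.id)
  | succ n ih =>
    rw [pow_succ]
    exact inferInstanceAs (IsMarkovKernel ((κ ^ n) ∘ₖ κ))

theorem lintegral_simplexKernel_pow (hΛ : Λ ∈ Matrix.rowStochastic ℝ (Fin d)) (h : Fin d → ℝ)
    {σ : ℝ} (hσ : 0 < σ) (n : ℕ) {η : Fin d → ℝ} (hη : η ∈ stdSimplex ℝ (Fin d))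
    {F : (Fin d → ℝ) → ENNReal} (hF : Measurable F) :
    ∫⁻ x, F x ∂((simplexKernel Λ h σ ^ n) η) =
      ∫⁻ v, ENNReal.ofReal (l1 (obsProd (fun i => h i / σ) Λ n v *ᵥ η)) *
        F (normalize (obsProd (fun i => h i / σ) Λ n v *ᵥ η)) ∂(gaussPi n) := by
  induction n generalizing F with
  | zero =>
    have : (simplexKernel Λ h σ ^ 0) η = Measure.dirac η := rfl
    rw [this, lintegral_dirac' _ hF]
    simp [obsProd, l1_eq_one hη, normalize]
  | succ n ih =>
    have hm : Measurable fun v => obsProd (fun i => h i / σ) Λ (n + 1) v *ᵥ η :=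
      measurable_obsProd_mulVec _ Λ _ η
    have : (simplexKernel Λ h σ ^ (n + 1)) η =
        (simplexKernel Λ h σ ∘ₖ (simplexKernel Λ h σ ^ n)) η := by rw [pow_succ']; rfl
    rw [this, Kernel.lintegral_comp _ _ _ hF, ih hF.lintegral_kernel,
      lintegral_gaussPi_succ n (F := fun v =>
        ENNReal.ofReal (l1 (obsProd (fun i => h i / σ) Λ (n + 1) v *ᵥ η)) *
          F (normalize (obsProd (fun i => h i / σ) Λ (n + 1) v *ᵥ η))) (hm.ofReal_l1.mul (hF.comp_normalize hm))]
    refine lintegral_congr fun v => ?_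
    have h0 : ∀ i, 0 ≤ (obsProd (fun i => h i / σ) Λ n v *ᵥ η) i :=
      obsProd_mulVec_nonneg hΛ n v hη.1
    have hp : 0 < l1 (obsProd (fun i => h i / σ) Λ n v *ᵥ η) :=
      l1_obsProd_mulVec_pos hΛ n v hη.1 (by rw [l1_eq_one hη]; exact one_pos)
    have hN := normalize_mem h0 hp
    rw [simplexKernel_apply h σ hN, lintegral_filterLaw hΛ h hσ hN.1 hF,
      ← lintegral_const_mul' _ _ ENNReal.ofReal_ne_top]
    refine lintegral_congr fun t => ?_
    rw [obsProd_snoc, ← mulVec_mulVec, ← mul_assoc, ← ENNReal.ofReal_mul hp.le]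
    have hs : obsMat (fun i => h i / σ) Λ t *ᵥ normalize (obsProd (fun i => h i / σ) Λ n v *ᵥ η) =
        (l1 (obsProd (fun i => h i / σ) Λ n v *ᵥ η))⁻¹ •
          (obsMat (fun i => h i / σ) Λ t *ᵥ (obsProd (fun i => h i / σ) Λ n v *ᵥ η)) := by
      conv_lhs => rw [normalize, mulVec_smul]
    rw [hs, normalize_smul (inv_pos.2 hp), l1_smul, abs_of_pos (inv_pos.2 hp), ← mul_assoc,
      mul_inv_cancel₀ hp.ne', one_mul]

theorem simplexKernel_pow_eq_map (hΛ : Λ ∈ Matrix.rowStochastic ℝ (Fin d)) (h : Fin d → ℝ)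
    {σ : ℝ} (hσ : 0 < σ) (n : ℕ) {η : Fin d → ℝ} (hη : η ∈ stdSimplex ℝ (Fin d)) :
    (simplexKernel Λ h σ ^ n) η =
      ((gaussPi n).withDensity fun v =>
        ENNReal.ofReal (l1 (obsProd (fun i => h i / σ) Λ n v *ᵥ η))).map
          fun v => normalize (obsProd (fun i => h i / σ) Λ n v *ᵥ η) := by
  have hm : Measurable fun v => obsProd (fun i => h i / σ) Λ n v *ᵥ η :=
    measurable_obsProd_mulVec _ Λ _ η
  refine Measure.ext_of_lintegral _ fun F hF => ?_
  rw [lintegral_simplexKernel_pow hΛ h hσ n hη hF, lintegral_map hF hm.normalize,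
    lintegral_withDensity_eq_lintegral_mul _ hm.ofReal_l1 (hF.comp_normalize hm)]
  rfl

theorem integral_simplexKernel_pow (hΛ : Λ ∈ Matrix.rowStochastic ℝ (Fin d)) (h : Fin d → ℝ)
    {σ : ℝ} (hσ : 0 < σ) (n : ℕ) {η : Fin d → ℝ} (hη : η ∈ stdSimplex ℝ (Fin d))
    {f : (Fin d → ℝ) → ℝ} (hf : Measurable f) :
    ∫ x, f x ∂((simplexKernel Λ h σ ^ n) η) =
      ∫ v, l1 (obsProd (fun i => h i / σ) Λ n v *ᵥ η) *
        f (normalize (obsProd (fun i => h i / σ) Λ n v *ᵥ η)) ∂(gaussPi n) := by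
  have hm : Measurable fun v => obsProd (fun i => h i / σ) Λ n v *ᵥ η :=
    measurable_obsProd_mulVec _ Λ _ η
  rw [simplexKernel_pow_eq_map hΛ h hσ n hη,
    integral_map hm.normalize.aemeasurable hf.aestronglyMeasurable,
    integral_withDensity_eq_integral_toReal_smul hm.ofReal_l1
      (Eventually.of_forall fun _ => ENNReal.ofReal_lt_top)]
  simp [ENNReal.toReal_ofReal (l1_nonneg _)]

end Kernels

section Oscillation
variable {d : ℕ}

/-- The oscillation of the ratio of two vectors. -/
def ratioOsc (x z : Fin d → ℝ) : ENNReal := ⨆ i, ⨆ j, ENNReal.ofReal (x i / z i - x j / z j)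

theorem ratioOsc_le_iff {x z : Fin d → ℝ} {b : ENNReal} :
    ratioOsc x z ≤ b ↔ ∀ i j, ENNReal.ofReal (x i / z i - x j / z j) ≤ b := by
  simp [ratioOsc]

theorem ratioOsc_lt_top (x z : Fin d → ℝ) : ratioOsc x z < ⊤ := by
  refine lt_of_le_of_lt (b := ENNReal.ofReal (∑ i, |x i / z i| + ∑ i, |x i / z i|)) ?_
    ENNReal.ofReal_lt_top
  refine ratioOsc_le_iff.2 fun i j => ENNReal.ofReal_le_ofReal ?_
  have h := fun k => Finset.single_le_sum (f := fun i => |x i / z i|) (fun _ _ => abs_nonneg _)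
    (Finset.mem_univ k)
  have := abs_sub (x i / z i) (x j / z j)
  have := le_abs_self (x i / z i - x j / z j)
  linarith [h i, h j]

theorem div_sub_div_le_ratioOsc (x z : Fin d → ℝ) (i j : Fin d) :
    x i / z i - x j / z j ≤ (ratioOsc x z).toReal := by
  rw [← ENNReal.ofReal_le_iff_le_toReal (ratioOsc_lt_top x z).ne]
  exact ratioOsc_le_iff.1 le_rfl i j

theorem measurable_ratioOsc :
    Measurable fun p : (Fin d → ℝ) × (Fin d → ℝ) => ratioOsc p.1 p.2 := by
  refine Measurable.iSup fun i => Measurable.iSup fun j => ?_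
  refine Measurable.ennreal_ofReal ?_
  fun_prop

theorem sum_mul_sub_sum_mul_le {p q R : Fin d → ℝ} {δ D : ℝ} (hp : ∑ i, p i = 1)
    (hq : ∑ i, q i = 1) (hq0 : ∀ i, 0 ≤ q i) (hpq : ∀ i, δ * q i ≤ p i)
    (hR : ∀ i j, R i - R j ≤ D) :
    ∑ i, p i * R i - ∑ i, q i * R i ≤ (1 - δ) * D := by
  have h1 : ∑ i, ∑ j, (p i - δ * q i) * q j * (R i - R j) =
      ∑ i, p i * R i - ∑ i, q i * R i := by
    have : ∀ i, ∑ j, (p i - δ * q i) * q j * (R i - R j) =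
        (p i * R i - δ * (q i * R i)) - (p i - δ * q i) * ∑ j, q j * R j := by
      intro i
      have h2 : ∀ j, (p i - δ * q i) * q j * (R i - R j) =
          (p i * R i - δ * (q i * R i)) * q j - (p i - δ * q i) * (q j * R j) := fun j => by ring
      simp only [h2, Finset.sum_sub_distrib, ← Finset.mul_sum, hq, mul_one]
    simp only [this, Finset.sum_sub_distrib, ← Finset.mul_sum, ← Finset.sum_mul, hp, hq]
    ring
  have h3 : ∑ i, ∑ j, (p i - δ * q i) * q j * D = (1 - δ) * D := by
    simp only [← Finset.sum_mul, ← Finset.mul_sum, Finset.sum_sub_distrib, hp, hq, mul_one]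
  rw [← h1, ← h3]
  refine Finset.sum_le_sum fun i _ => Finset.sum_le_sum fun j _ => ?_
  exact mul_le_mul_of_nonneg_left (hR i j) (mul_nonneg (sub_nonneg.2 (hpq i)) (hq0 j))

theorem ratioOsc_mulVec_le {B : Matrix (Fin d) (Fin d) ℝ} {δ : ℝ} (hδ : δ ≤ 1) {x z : Fin d → ℝ}
    (hB : ∀ i j, 0 ≤ B i j) (hz : ∀ i, 0 < z i) (hBz : ∀ i, 0 < (B *ᵥ z) i)
    (h : ∀ i j k, δ * (B j k / (B *ᵥ z) j) ≤ B i k / (B *ᵥ z) i) :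
    ratioOsc (B *ᵥ x) (B *ᵥ z) ≤ ENNReal.ofReal (1 - δ) * ratioOsc x z := by
  refine ratioOsc_le_iff.2 fun i j => ?_
  have hw : ∀ i, (B *ᵥ x) i / (B *ᵥ z) i = ∑ k, (B i k * z k / (B *ᵥ z) i) * (x k / z k) := by
    intro i
    rw [mulVec, dotProduct, Finset.sum_div]
    refine Finset.sum_congr rfl fun k _ => ?_
    have := (hz k).ne'
    field_simp
  have hs : ∀ i, ∑ k, B i k * z k / (B *ᵥ z) i = 1 := by
    intro i
    rw [← Finset.sum_div]
    exact div_self (hBz i).ne'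
  have key := sum_mul_sub_sum_mul_le (δ := δ) (hs i) (hs j)
    (fun k => div_nonneg (mul_nonneg (hB j k) (hz k).le) (hBz j).le) (fun k => by
      have := mul_le_mul_of_nonneg_right (h i j k) (hz k).le
      calc _ = _ := ?_
        _ ≤ _ := this
        _ = _ := ?_ <;> ring) (div_sub_div_le_ratioOsc x z)
  rw [← hw, ← hw] at key
  calc _ ≤ ENNReal.ofReal ((1 - δ) * (ratioOsc x z).toReal) := ENNReal.ofReal_le_ofReal key
    _ = _ := by
      rw [ENNReal.ofReal_mul (by linarith), ENNReal.ofReal_toReal (ratioOsc_lt_top x z).ne]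

theorem ratioOsc_mulVec_le_self {B : Matrix (Fin d) (Fin d) ℝ} {x z : Fin d → ℝ}
    (hB : ∀ i j, 0 ≤ B i j) (hz : ∀ i, 0 < z i) (hBz : ∀ i, 0 < (B *ᵥ z) i) :
    ratioOsc (B *ᵥ x) (B *ᵥ z) ≤ ratioOsc x z := by
  have := ratioOsc_mulVec_le (x := x) zero_le_one hB hz hBz fun i j k => by
    rw [zero_mul]
    exact div_nonneg (hB i k) (hBz i).le
  simpa using this

theorem ratioOsc_mulVec_le_of_bounds {B : Matrix (Fin d) (Fin d) ℝ} {m K : ℝ} (hm : 0 < m)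
    {x z : Fin d → ℝ} (hB : ∀ i j, m ≤ B i j) (hB' : ∀ i j, B i j ≤ K) (hz : ∀ i, 0 < z i)
    (hd : 0 < d) :
    ratioOsc (B *ᵥ x) (B *ᵥ z) ≤ ENNReal.ofReal (1 - (m / K) ^ 2) * ratioOsc x z := by
  have hmK : m ≤ K := (hB ⟨0, hd⟩ ⟨0, hd⟩).trans (hB' _ _)
  have hK : 0 < K := hm.trans_le hmK
  have hsz : 0 < ∑ i, z i := Finset.sum_pos (fun i _ => hz i) ⟨⟨0, hd⟩, Finset.mem_univ _⟩
  have hlow : ∀ i, m * ∑ k, z k ≤ (B *ᵥ z) i := fun i => by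
    rw [mulVec, dotProduct, Finset.mul_sum]
    exact Finset.sum_le_sum fun k _ => mul_le_mul_of_nonneg_right (hB i k) (hz k).le
  have hup : ∀ i, (B *ᵥ z) i ≤ K * ∑ k, z k := fun i => by
    rw [mulVec, dotProduct, Finset.mul_sum]
    exact Finset.sum_le_sum fun k _ => mul_le_mul_of_nonneg_right (hB' i k) (hz k).le
  have hpos : ∀ i, 0 < (B *ᵥ z) i := fun i => (mul_pos hm hsz).trans_le (hlow i)
  refine ratioOsc_mulVec_le ?_ (fun i j => hm.le.trans (hB i j)) hz hpos fun i j k => ?_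
  · exact pow_le_one₀ (by positivity) ((div_le_one hK).2 hmK)
  · calc (m / K) ^ 2 * (B j k / (B *ᵥ z) j) ≤ (m / K) ^ 2 * (K / (m * ∑ k, z k)) := by
          refine mul_le_mul_of_nonneg_left ?_ (by positivity)
          exact div_le_div₀ hK.le (hB' j k) (by positivity) (hlow j)
      _ = m / (K * ∑ k, z k) := by field_simp
      _ ≤ _ := div_le_div₀ (hm.le.trans (hB i k)) (hB i k) (hpos i) (hup i)

theorem l1_sub_smul_le {x z : Fin d → ℝ} (hx : ∀ i, 0 ≤ x i) (hz : ∀ i, 0 < z i) (hd : 0 < d) :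
    ENNReal.ofReal (l1 (x - (l1 x / l1 z) • z)) ≤ ENNReal.ofReal (l1 z) * ratioOsc x z := by
  have hsz : 0 < l1 z := by
    rw [l1_eq_sum fun i => (hz i).le]
    exact Finset.sum_pos (fun i _ => hz i) ⟨⟨0, hd⟩, Finset.mem_univ _⟩
  set D := (ratioOsc x z).toReal with hD
  rw [← ENNReal.ofReal_toReal (ratioOsc_lt_top x z).ne, ← ENNReal.ofReal_mul hsz.le]
  refine ENNReal.ofReal_le_ofReal ?_
  have hterm : ∀ i, |x i - l1 x / l1 z * z i| ≤ z i * D := by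
    intro i
    have h1 : x i - l1 x / l1 z * z i = z i / l1 z * ∑ k, z k * (x i / z i - x k / z k) := by
      have h2 : ∀ k, z k * (x i / z i - x k / z k) = z k * (x i / z i) - x k := fun k => by
        have := (hz k).ne'
        field_simp
      simp only [h2, Finset.sum_sub_distrib, ← Finset.sum_mul]
      rw [← l1_eq_sum hx, ← l1_eq_sum fun i => (hz i).le]
      have := (hz i).ne'
      field_simp
    rw [h1, abs_mul, abs_of_pos (div_pos (hz i) hsz)]
    have h3 : |∑ k, z k * (x i / z i - x k / z k)| ≤ l1 z * D := by
      rw [l1_eq_sum fun i => (hz i).le, Finset.sum_mul]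
      refine (Finset.abs_sum_le_sum_abs _ _).trans (Finset.sum_le_sum fun k _ => ?_)
      rw [abs_mul, abs_of_pos (hz k)]
      refine mul_le_mul_of_nonneg_left ?_ (hz k).le
      rw [abs_le]
      have h4 := div_sub_div_le_ratioOsc x z i k
      have h5 := div_sub_div_le_ratioOsc x z k i
      constructor <;> linarith
    calc z i / l1 z * |∑ k, z k * (x i / z i - x k / z k)| ≤ z i / l1 z * (l1 z * D) :=
          mul_le_mul_of_nonneg_left h3 (div_pos (hz i) hsz).le
      _ = z i * D := by field_simp
  calc l1 (x - (l1 x / l1 z) • z) ≤ ∑ i, z i * D := Finset.sum_le_sum fun i _ => by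
        simpa using hterm i
    _ = l1 z * D := by rw [← Finset.sum_mul, l1_eq_sum fun i => (hz i).le]

end Oscillation

section Stability
variable {d : ℕ} {c : Fin d → ℝ} {Λ : Matrix (Fin d) (Fin d) ℝ} {μ : Fin d → ℝ}

/-- The transition operator of a pair of unnormalized filters driven by the same observations,
under the reference measure. -/
def pairOp (c : Fin d → ℝ) (Λ : Matrix (Fin d) (Fin d) ℝ)
    (Φ : (Fin d → ℝ) × (Fin d → ℝ) → ENNReal) (p : (Fin d → ℝ) × (Fin d → ℝ)) : ENNReal :=
  ∫⁻ v, Φ (obsMat c Λ v *ᵥ p.1, obsMat c Λ v *ᵥ p.2) ∂(gaussianReal 0 1)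

theorem measurable_pairOp {Φ : (Fin d → ℝ) × (Fin d → ℝ) → ENNReal} (hΦ : Measurable Φ) :
    Measurable (pairOp c Λ Φ) := by
  have hm := measurable_obsMat_mulVec c Λ
  unfold pairOp
  obtain ⟨T, hT⟩ : ∃ T : ℝ → (Fin d → ℝ) → Fin d → ℝ, ∀ v x, obsMat c Λ v *ᵥ x = T v x :=
    ⟨_, fun _ _ => rfl⟩
  simp only [hT] at hm ⊢
  have h1 : Measurable fun q : ((Fin d → ℝ) × (Fin d → ℝ)) × ℝ => T q.2 q.1.1 :=
    hm.comp (measurable_snd.prodMk (measurable_fst.comp measurable_fst))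
  have h2 : Measurable fun q : ((Fin d → ℝ) × (Fin d → ℝ)) × ℝ => T q.2 q.1.2 :=
    hm.comp (measurable_snd.prodMk (measurable_snd.comp measurable_fst))
  exact (hΦ.comp (h1.prodMk h2)).lintegral_prod_right'

theorem measurable_comp_obsProd (n : ℕ) {Φ : (Fin d → ℝ) × (Fin d → ℝ) → ENNReal}
    (hΦ : Measurable Φ) (x z : Fin d → ℝ) :
    Measurable fun v => Φ (obsProd c Λ n v *ᵥ x, obsProd c Λ n v *ᵥ z) :=
  hΦ.comp ((measurable_obsProd_mulVec c Λ n x).prodMk (measurable_obsProd_mulVec c Λ n z))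

theorem pairOp_iterate (n : ℕ) {Φ : (Fin d → ℝ) × (Fin d → ℝ) → ENNReal} (hΦ : Measurable Φ)
    (p : (Fin d → ℝ) × (Fin d → ℝ)) :
    (pairOp c Λ)^[n] Φ p =
      ∫⁻ v, Φ (obsProd c Λ n v *ᵥ p.1, obsProd c Λ n v *ᵥ p.2) ∂(gaussPi n) := by
  induction n generalizing Φ with
  | zero => simp [obsProd]
  | succ n ih =>
    rw [Function.iterate_succ_apply, ih (measurable_pairOp hΦ),
      lintegral_gaussPi_succ n (F := fun v => Φ (obsProd c Λ (n + 1) v *ᵥ p.1,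
        obsProd c Λ (n + 1) v *ᵥ p.2))
      (measurable_comp_obsProd (n + 1) hΦ p.1 p.2)]
    refine lintegral_congr fun v => lintegral_congr fun t => ?_
    simp only [obsProd_snoc, mulVec_mulVec]

theorem IsErgodic.mulVec_pos (hd : 0 < d) (hΛ : Λ ∈ Matrix.rowStochastic ℝ (Fin d))
    (hμ : IsErgodic Λ μ) {z : Fin d → ℝ} (hz : ∀ i, 0 < z i) (j : Fin d) : 0 < (Λᵀ *ᵥ z) j := by
  have h := hμ.2 j
  rw [← hμ.mulVec_eq hd] at h
  simp only [mulVec, dotProduct, transpose_apply] at h ⊢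
  obtain ⟨i, -, hi⟩ := Finset.exists_lt_of_sum_lt (s := Finset.univ) (f := fun _ : Fin d => (0 : ℝ))
    (g := fun i => Λ i j * μ i) (by simpa using h)
  refine Finset.sum_pos' (fun i _ => mul_nonneg (hΛ.1 i j) (hz i).le)
    ⟨i, Finset.mem_univ i, mul_pos ?_ (hz i)⟩
  exact pos_of_mul_pos_left hi (hμ.2 i).le

theorem obsMat_mulVec_pos (hd : 0 < d) (hΛ : Λ ∈ Matrix.rowStochastic ℝ (Fin d))
    (hμ : IsErgodic Λ μ) (v : ℝ) {z : Fin d → ℝ} (hz : ∀ i, 0 < z i) (j : Fin d) :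
    0 < (obsMat c Λ v *ᵥ z) j := by
  rw [obsMat_mulVec]
  exact mul_pos (shiftDensity_pos _ _) (hμ.mulVec_pos hd hΛ hz j)

theorem obsProd_mulVec_pos (hd : 0 < d) (hΛ : Λ ∈ Matrix.rowStochastic ℝ (Fin d))
    (hμ : IsErgodic Λ μ) (n : ℕ) (v : Fin n → ℝ) {z : Fin d → ℝ} (hz : ∀ i, 0 < z i) (j : Fin d) :
    0 < (obsProd c Λ n v *ᵥ z) j := by
  induction n generalizing j with
  | zero => simpa [obsProd] using hz j
  | succ n ih =>
    rw [obsProd, ← mulVec_mulVec]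
    exact obsMat_mulVec_pos hd hΛ hμ _ (ih _) j

theorem obsMat_nonneg (hΛ : Λ ∈ Matrix.rowStochastic ℝ (Fin d)) (v : ℝ) (i j : Fin d) :
    0 ≤ obsMat c Λ v i j := by
  rw [obsMat, diagonal_mul]
  exact mul_nonneg (shiftDensity_pos _ _).le (hΛ.1 j i)

theorem obsProd_bounds (hΛ : Λ ∈ Matrix.rowStochastic ℝ (Fin d)) {κ : ℝ}
    (hκ : ∀ i, |c i| + c i ^ 2 / 2 ≤ κ) (n : ℕ) (v : Fin n → ℝ) (hv : ∀ k, |v k| ≤ 1)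
    (i j : Fin d) :
    Real.exp (-κ) ^ n * (Λ ^ n) j i ≤ obsProd c Λ n v i j ∧
      obsProd c Λ n v i j ≤ Real.exp κ ^ n * (Λ ^ n) j i := by
  have hs : ∀ i t, |t| ≤ 1 → Real.exp (-κ) ≤ shiftDensity (c i) t ∧
      shiftDensity (c i) t ≤ Real.exp κ := by
    intro i t ht
    have h1 : |c i * t| ≤ |c i| := by
      rw [abs_mul]
      exact mul_le_of_le_one_right (abs_nonneg _) ht
    have h2 := abs_le.1 h1
    have h3 := hκ i
    have h4 := sq_nonneg (c i)
    constructor <;> refine Real.exp_le_exp.2 ?_ <;> linarith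
  induction n generalizing i j with
  | zero => simp [obsProd, one_apply, eq_comm]
  | succ n ih =>
    have hn : ∀ i j, 0 ≤ (Λ ^ n) i j := fun i j => (pow_mem hΛ n).1 i j
    have he : (Λ ^ (n + 1)) j i = ∑ k, Λ k i * (Λ ^ n) j k := by
      rw [pow_succ, mul_apply]
      exact Finset.sum_congr rfl fun k _ => mul_comm _ _
    have ho : obsProd c Λ (n + 1) v i j = shiftDensity (c i) (v (Fin.last n)) *
        ∑ k, Λ k i * obsProd c Λ n (Fin.init v) k j := by
      simp only [obsProd, obsMat, Matrix.mul_assoc, diagonal_mul]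
      simp [mul_apply]
    obtain ⟨hl, hu⟩ := hs i _ (hv (Fin.last n))
    have ih' := fun k => ih (Fin.init v) (fun k => hv _) k j
    rw [he, ho, pow_succ', pow_succ', mul_assoc, mul_assoc]
    constructor
    · refine mul_le_mul hl ?_ ?_ (shiftDensity_pos _ _).le
      · rw [Finset.mul_sum]
        refine Finset.sum_le_sum fun k _ => ?_
        rw [mul_left_comm]
        exact mul_le_mul_of_nonneg_left (ih' k).1 (hΛ.1 k i)
      · exact mul_nonneg (by positivity) (Finset.sum_nonneg fun k _ => mul_nonneg (hΛ.1 k i) (hn j k))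
    · refine mul_le_mul hu ?_ ?_ (Real.exp_pos _).le
      · rw [Finset.mul_sum]
        refine Finset.sum_le_sum fun k _ => ?_
        rw [mul_left_comm]
        exact mul_le_mul_of_nonneg_left (ih' k).2 (hΛ.1 k i)
      · refine Finset.sum_nonneg fun k _ => mul_nonneg (hΛ.1 k i) (le_trans ?_ (ih' k).1)
        exact mul_nonneg (by positivity) (hn j k)

/-- The oscillation of the ratio of two unnormalized filters, weighted by the likelihood. -/
def weightedOsc (p : (Fin d → ℝ) × (Fin d → ℝ)) : ENNReal :=
  ENNReal.ofReal (l1 p.2) * ratioOsc p.1 p.2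

theorem measurable_weightedOsc : Measurable (weightedOsc (d := d)) :=
  measurable_snd.ofReal_l1.mul measurable_ratioOsc

theorem weightedOsc_ne_top (p : (Fin d → ℝ) × (Fin d → ℝ)) : weightedOsc p ≠ ⊤ :=
  (ENNReal.mul_lt_top ENNReal.ofReal_lt_top (ratioOsc_lt_top _ _)).ne

theorem pairOp_weightedOsc_le (hd : 0 < d) (hΛ : Λ ∈ Matrix.rowStochastic ℝ (Fin d))
    (hμ : IsErgodic Λ μ) (p : (Fin d → ℝ) × (Fin d → ℝ)) (hp : ∀ i, 0 < p.2 i) :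
    pairOp c Λ weightedOsc p ≤ weightedOsc p := by
  unfold pairOp weightedOsc
  calc _ ≤ ∫⁻ v, ENNReal.ofReal (l1 (obsMat c Λ v *ᵥ p.2)) * ratioOsc p.1 p.2
          ∂(gaussianReal 0 1) := by
        refine lintegral_mono fun v => ?_
        dsimp only
        gcongr
        exact ratioOsc_mulVec_le_self (obsMat_nonneg hΛ v) hp (obsMat_mulVec_pos hd hΛ hμ v hp)
    _ = _ := by
        rw [lintegral_mul_const _ (measurable_obsMat_mulVec_const c Λ _).ofReal_l1,
          lintegral_l1_obsMat hΛ fun i => (hp i).le]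

theorem pairOp_mono_of_pos (hd : 0 < d) (hΛ : Λ ∈ Matrix.rowStochastic ℝ (Fin d))
    (hμ : IsErgodic Λ μ) {Φ Ψ : (Fin d → ℝ) × (Fin d → ℝ) → ENNReal}
    (h : ∀ p : (Fin d → ℝ) × (Fin d → ℝ), (∀ i, 0 < p.2 i) → Φ p ≤ Ψ p) (n : ℕ)
    (p : (Fin d → ℝ) × (Fin d → ℝ)) (hp : ∀ i, 0 < p.2 i) :
    (pairOp c Λ)^[n] Φ p ≤ (pairOp c Λ)^[n] Ψ p := by
  induction n generalizing p with
  | zero => exact h p hp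
  | succ n ih =>
    rw [Function.iterate_succ_apply', Function.iterate_succ_apply']
    exact lintegral_mono fun v => ih _ (obsMat_mulVec_pos hd hΛ hμ v hp)

theorem measure_gaussPi_box_pos (n : ℕ) : 0 < gaussPi n {v | ∀ k, |v k| ≤ 1} := by
  have h1 : {v : Fin n → ℝ | ∀ k, |v k| ≤ 1} = Set.univ.pi fun _ => Set.Icc (-1) 1 := by
    ext v
    simp [abs_le, Pi.le_def, forall_and]
  have h2 : (gaussianReal 0 1) (Set.Icc (-1) 1) ≠ 0 := by
    intro h0
    have := gaussianReal_absolutelyContinuous' 0 one_ne_zero h0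
    simp at this
    norm_num at this
  rw [h1, gaussPi, Measure.pi_pi, pos_iff_ne_zero]
  exact Finset.prod_ne_zero_iff.2 fun _ _ => h2

theorem exists_pairOp_iterate_le (hd : 0 < d) (hΛ : Λ ∈ Matrix.rowStochastic ℝ (Fin d))
    (hμ : IsErgodic Λ μ) (c : Fin d → ℝ) :
    ∃ N : ℕ, ∃ θ : ENNReal, 0 < N ∧ θ < 1 ∧ ∀ p : (Fin d → ℝ) × (Fin d → ℝ), (∀ i, 0 < p.2 i) →
      (pairOp c Λ)^[N] weightedOsc p ≤ θ * weightedOsc p := by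
  obtain ⟨N, hN, hpos⟩ := hμ.exists_pow_pos
  have : Nonempty (Fin d) := ⟨⟨0, hd⟩⟩
  obtain ⟨⟨i₀, j₀⟩, hmin⟩ := Finite.exists_min fun q : Fin d × Fin d => (Λ ^ N) q.1 q.2
  set κ : ℝ := ∑ i, (|c i| + c i ^ 2 / 2) with hκ
  have hκ' : ∀ i, |c i| + c i ^ 2 / 2 ≤ κ := fun i =>
    Finset.single_le_sum (f := fun i => |c i| + c i ^ 2 / 2) (fun _ _ => by positivity)
      (Finset.mem_univ i)
  have hκ0 : 0 ≤ κ := Finset.sum_nonneg fun _ _ => by positivity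
  set m : ℝ := Real.exp (-κ) ^ N * (Λ ^ N) i₀ j₀ with hm
  set K : ℝ := Real.exp κ ^ N with hK
  have hm0 : 0 < m := mul_pos (by positivity) (hpos _ _)
  have hK0 : 0 < K := by positivity
  set E : Set (Fin N → ℝ) := {v | ∀ k, |v k| ≤ 1} with hE
  have hEm : MeasurableSet E := by
    rw [hE]
    measurability
  have hb : ∀ v ∈ E, ∀ i j, m ≤ obsProd c Λ N v i j ∧ obsProd c Λ N v i j ≤ K := by
    intro v hv i j
    obtain ⟨h1, h2⟩ := obsProd_bounds hΛ hκ' N v hv i j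
    refine ⟨le_trans ?_ h1, h2.trans ?_⟩
    · exact mul_le_mul_of_nonneg_left (hmin (j, i)) (by positivity)
    · exact mul_le_of_le_one_right hK0.le (le_one_of_mem_rowStochastic (pow_mem hΛ N))
  set γ : ENNReal := gaussPi N E with hγ
  have hγ0 : 0 < γ := measure_gaussPi_box_pos N
  set δ : ENNReal := ENNReal.ofReal ((m / K) ^ 2) with hδ
  set θ' : ENNReal := δ * (ENNReal.ofReal m * γ) with hθ'
  have hθ0 : θ' ≠ 0 := by
    refine mul_ne_zero ?_ (mul_ne_zero ?_ hγ0.ne') <;> simp only [hδ, ne_eq, ENNReal.ofReal_eq_zero,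
      not_le] <;> positivity
  refine ⟨N, 1 - θ', hN, ENNReal.sub_lt_self ENNReal.one_ne_top one_ne_zero hθ0, fun p hp => ?_⟩
  have hmB : Measurable fun v => obsProd c Λ N v *ᵥ p.2 := measurable_obsProd_mulVec c Λ N _
  rw [pairOp_iterate N measurable_weightedOsc]
  have hnn : ∀ v i, 0 < (obsProd c Λ N v *ᵥ p.2) i := fun v => obsProd_mulVec_pos hd hΛ hμ N v hp
  have hBnn : ∀ v i j, 0 ≤ obsProd c Λ N v i j := fun v i j => by
    have := obsProd_mulVec_nonneg (c := c) hΛ N v (x := Pi.single j 1)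
      (single_mem_stdSimplex ℝ j).1 i
    simpa using this
  have hpt : ∀ v, weightedOsc (obsProd c Λ N v *ᵥ p.1, obsProd c Λ N v *ᵥ p.2) +
      E.indicator (fun v => δ * (ENNReal.ofReal (l1 (obsProd c Λ N v *ᵥ p.2)) * ratioOsc p.1 p.2))
        v ≤ ENNReal.ofReal (l1 (obsProd c Λ N v *ᵥ p.2)) * ratioOsc p.1 p.2 := by
    intro v
    unfold weightedOsc
    by_cases hv : v ∈ E
    · rw [Set.indicator_of_mem hv]
      have h1 := ratioOsc_mulVec_le_of_bounds (x := p.1) hm0 (fun i j => (hb v hv i j).1)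
        (fun i j => (hb v hv i j).2) hp hd
      have h2 : (m / K) ^ 2 ≤ 1 := by
        have : m ≤ K := ((hb v hv ⟨0, hd⟩ ⟨0, hd⟩).1).trans (hb v hv _ _).2
        exact pow_le_one₀ (by positivity) ((div_le_one hK0).2 this)
      have h3 : ENNReal.ofReal (1 - (m / K) ^ 2) + δ = 1 := by
        rw [hδ, ← ENNReal.ofReal_add (by linarith) (by positivity)]
        simp
      calc _ ≤ ENNReal.ofReal (l1 (obsProd c Λ N v *ᵥ p.2)) *
              (ENNReal.ofReal (1 - (m / K) ^ 2) * ratioOsc p.1 p.2) +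
            δ * (ENNReal.ofReal (l1 (obsProd c Λ N v *ᵥ p.2)) * ratioOsc p.1 p.2) := by
              dsimp only
              gcongr
        _ = (ENNReal.ofReal (1 - (m / K) ^ 2) + δ) *
            (ENNReal.ofReal (l1 (obsProd c Λ N v *ᵥ p.2)) * ratioOsc p.1 p.2) := by ring
        _ = _ := by rw [h3, one_mul]
    · rw [Set.indicator_of_notMem hv, add_zero]
      dsimp only
      gcongr
      exact ratioOsc_mulVec_le_self (hBnn v) hp (hnn v)
  have hint := lintegral_mono (μ := gaussPi N) hpt
  have hgm : Measurable fun v =>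
      δ * (ENNReal.ofReal (l1 (obsProd c Λ N v *ᵥ p.2)) * ratioOsc p.1 p.2) :=
    (hmB.ofReal_l1.mul_const _).const_mul _
  rw [lintegral_add_right _ (hgm.indicator hEm), lintegral_indicator hEm,
    lintegral_mul_const _ hmB.ofReal_l1, lintegral_l1_obsProd hΛ N fun i => (hp i).le] at hint
  have hlow : θ' * weightedOsc p ≤ ∫⁻ v in E,
      δ * (ENNReal.ofReal (l1 (obsProd c Λ N v *ᵥ p.2)) * ratioOsc p.1 p.2) ∂(gaussPi N) := by
    calc θ' * weightedOsc p = ∫⁻ v in E,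
          δ * (ENNReal.ofReal m * ENNReal.ofReal (l1 p.2) * ratioOsc p.1 p.2) ∂(gaussPi N) := by
          rw [lintegral_const, Measure.restrict_apply_univ, hθ', weightedOsc]
          ring
      _ ≤ _ := by
          refine setLIntegral_mono hgm fun v hv => ?_
          gcongr
          rw [← ENNReal.ofReal_mul hm0.le]
          refine ENNReal.ofReal_le_ofReal ?_
          calc m * l1 p.2 ≤ (obsProd c Λ N v *ᵥ p.2) ⟨0, hd⟩ := by
                rw [l1_eq_sum fun i => (hp i).le, Finset.mul_sum, mulVec, dotProduct]
                exact Finset.sum_le_sum fun k _ =>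
                  mul_le_mul_of_nonneg_right (hb v hv _ k).1 (hp k).le
            _ ≤ _ := (le_abs_self _).trans (abs_le_l1 _ _)
  have hfin : θ' * weightedOsc p ≠ ⊤ := by
    refine ENNReal.mul_ne_top ?_ (weightedOsc_ne_top p)
    exact ENNReal.mul_ne_top ENNReal.ofReal_ne_top
      (ENNReal.mul_ne_top ENNReal.ofReal_ne_top (measure_ne_top _ _))
  rw [ENNReal.sub_mul fun _ _ => weightedOsc_ne_top p, one_mul]
  refine ENNReal.le_sub_of_add_le_right hfin ?_
  exact (add_le_add_right hlow _).trans hint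

theorem pairOp_iterate_mul_le (hd : 0 < d) (hΛ : Λ ∈ Matrix.rowStochastic ℝ (Fin d))
    (hμ : IsErgodic Λ μ) {N : ℕ} {θ : ENNReal}
    (hstep : ∀ p : (Fin d → ℝ) × (Fin d → ℝ), (∀ i, 0 < p.2 i) →
      (pairOp c Λ)^[N] weightedOsc p ≤ θ * weightedOsc p) (k : ℕ)
    (p : (Fin d → ℝ) × (Fin d → ℝ)) (hp : ∀ i, 0 < p.2 i) :
    (pairOp c Λ)^[N * k] weightedOsc p ≤ θ ^ k * weightedOsc p := by
  induction k generalizing p with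
  | zero => simp
  | succ k ih =>
    rw [Nat.mul_succ, add_comm, Function.iterate_add_apply]
    calc _ ≤ (pairOp c Λ)^[N] (fun p => θ ^ k * weightedOsc p) p :=
          pairOp_mono_of_pos hd hΛ hμ ih N p hp
      _ = θ ^ k * (pairOp c Λ)^[N] weightedOsc p := by
          rw [pairOp_iterate N (measurable_weightedOsc.const_mul _),
            pairOp_iterate N measurable_weightedOsc,
            lintegral_const_mul _ (measurable_comp_obsProd N measurable_weightedOsc p.1 p.2)]
      _ ≤ θ ^ k * (θ * weightedOsc p) := by gcongr; exact hstep p hp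
      _ = _ := by ring

theorem pairOp_iterate_weightedOsc_le (hd : 0 < d) (hΛ : Λ ∈ Matrix.rowStochastic ℝ (Fin d))
    (hμ : IsErgodic Λ μ) (r : ℕ) (p : (Fin d → ℝ) × (Fin d → ℝ)) (hp : ∀ i, 0 < p.2 i) :
    (pairOp c Λ)^[r] weightedOsc p ≤ weightedOsc p := by
  induction r with
  | zero => exact le_rfl
  | succ r ih =>
    rw [Function.iterate_succ_apply]
    exact (pairOp_mono_of_pos hd hΛ hμ (pairOp_weightedOsc_le hd hΛ hμ) r p hp).trans ih

theorem lintegral_l1_sub_le_pairOp (hd : 0 < d) (hΛ : Λ ∈ Matrix.rowStochastic ℝ (Fin d))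
    (hμ : IsErgodic Λ μ) (n : ℕ) {η : Fin d → ℝ} (hη : η ∈ stdSimplex ℝ (Fin d)) :
    ∫⁻ v, ENNReal.ofReal (l1 (obsProd c Λ n v *ᵥ η -
      (l1 (obsProd c Λ n v *ᵥ η) / l1 (obsProd c Λ n v *ᵥ μ)) • (obsProd c Λ n v *ᵥ μ)))
        ∂(gaussPi n) ≤ (pairOp c Λ)^[n] weightedOsc (η, μ) := by
  rw [pairOp_iterate n measurable_weightedOsc]
  refine lintegral_mono fun v => ?_
  exact l1_sub_smul_le (obsProd_mulVec_nonneg hΛ n v hη.1) (obsProd_mulVec_pos hd hΛ hμ n v hμ.2) hd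

theorem exists_filter_stability (hd : 0 < d) (hΛ : Λ ∈ Matrix.rowStochastic ℝ (Fin d))
    (hμ : IsErgodic Λ μ) (c : Fin d → ℝ) :
    ∃ ε : ℕ → ENNReal, Tendsto ε atTop (𝓝 0) ∧ (∀ n, ε n ≠ ⊤) ∧
      ∀ n, ∀ η ∈ stdSimplex ℝ (Fin d),
        ∫⁻ v, ENNReal.ofReal (l1 (obsProd c Λ n v *ᵥ η -
          (l1 (obsProd c Λ n v *ᵥ η) / l1 (obsProd c Λ n v *ᵥ μ)) • (obsProd c Λ n v *ᵥ μ)))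
            ∂(gaussPi n) ≤ ε n := by
  obtain ⟨N, θ, hN, hθ, hstep⟩ := exists_pairOp_iterate_le hd hΛ hμ c
  set C : ENNReal := ENNReal.ofReal (l1 μ) * ENNReal.ofReal (∑ i, (μ i)⁻¹) with hC
  have hCtop : C ≠ ⊤ := ENNReal.mul_ne_top ENNReal.ofReal_ne_top ENNReal.ofReal_ne_top
  refine ⟨fun n => θ ^ (n / N) * C, ?_, fun n => ?_, fun n η hη => ?_⟩
  · have h1 : Tendsto (fun n : ℕ => θ ^ (n / N)) atTop (𝓝 0) :=
      (ENNReal.tendsto_pow_atTop_nhds_zero_of_lt_one hθ).comp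
        (Nat.tendsto_div_const_atTop hN.ne')
    simpa using ENNReal.Tendsto.mul_const h1 (Or.inr hCtop)
  · exact ENNReal.mul_ne_top (ENNReal.pow_ne_top (hθ.trans ENNReal.one_lt_top).ne) hCtop
  have h0 : weightedOsc (η, μ) ≤ C := by
    unfold weightedOsc
    rw [hC]
    refine mul_le_mul_right (ratioOsc_le_iff.2 fun i j => ENNReal.ofReal_le_ofReal ?_) _
    have h1 : η i ≤ 1 := by
      have := abs_le_l1 η i
      rw [l1_eq_one hη] at this
      exact (le_abs_self _).trans this
    have h2 : 0 ≤ η j / μ j := div_nonneg (hη.1 j) (hμ.2 j).le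
    have h3 : η i / μ i ≤ (μ i)⁻¹ := by
      rw [div_eq_mul_inv]
      exact mul_le_of_le_one_left (inv_nonneg.2 (hμ.2 i).le) h1
    have h4 := Finset.single_le_sum (f := fun i => (μ i)⁻¹)
      (fun i _ => inv_nonneg.2 (hμ.2 i).le) (Finset.mem_univ i)
    linarith
  refine (lintegral_l1_sub_le_pairOp hd hΛ hμ n hη).trans ?_
  rw [← Nat.div_add_mod n N, Function.iterate_add_apply, Nat.div_add_mod]
  refine (pairOp_mono_of_pos hd hΛ hμ (pairOp_iterate_weightedOsc_le hd hΛ hμ _) _ _ hμ.2).trans ?_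
  exact (pairOp_iterate_mul_le hd hΛ hμ hstep _ _ hμ.2).trans (mul_le_mul_right h0 _)

end Stability

/-- Measurable functions that are bounded by `C` and `L`-Lipschitz in the `ℓ¹`-norm on the simplex. -/
structure IsTestFun {d : ℕ} (f : (Fin d → ℝ) → ℝ) (C L : ℝ) : Prop where
  measurable : Measurable f
  bound : ∀ x ∈ stdSimplex ℝ (Fin d), |f x| ≤ C
  lipschitz : ∀ x ∈ stdSimplex ℝ (Fin d), ∀ y ∈ stdSimplex ℝ (Fin d), |f x - f y| ≤ L * l1 (x - y)

/-- The mean of a measure on `ℝ^d`. -/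
def barycenter {d : ℕ} (M : Measure (Fin d → ℝ)) : Fin d → ℝ := fun i => ∫ x, x i ∂M

theorem integral_measure_bind {α E : Type*} [MeasurableSpace α] [NormedAddCommGroup E]
    [NormedSpace ℝ E] {M : Measure α} {κ : Kernel α α} {f : α → E} (hf : Integrable f (M.bind κ)) :
    ∫ x, f x ∂(M.bind κ) = ∫ x, ∫ y, f y ∂κ x ∂M := by
  have h := Kernel.integral_comp (κ := Kernel.const Unit M) (η := κ) (a := ()) (f := f)
  rw [Kernel.comp_const, Kernel.const_apply, Kernel.const_apply] at h
  exact h hf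

section Integrability
variable {d : ℕ} {c : Fin d → ℝ} {Λ : Matrix (Fin d) (Fin d) ℝ}
  (hΛ : Λ ∈ Matrix.rowStochastic ℝ (Fin d))

theorem integrable_of_simplex {M : Measure (Fin d → ℝ)} [IsFiniteMeasure M]
    (hM : ∀ᵐ x ∂M, x ∈ stdSimplex ℝ (Fin d)) {f : (Fin d → ℝ) → ℝ} (hf : Measurable f) {C : ℝ}
    (hC : ∀ x ∈ stdSimplex ℝ (Fin d), |f x| ≤ C) : Integrable f M :=
  Integrable.of_bound hf.aestronglyMeasurable C (hM.mono fun x hx => hC x hx)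

theorem abs_apply_le_one {x : Fin d → ℝ} (hx : x ∈ stdSimplex ℝ (Fin d)) (i : Fin d) :
    |x i| ≤ 1 := by
  rw [← l1_eq_one hx]
  exact abs_le_l1 x i

theorem barycenter_mem {M : Measure (Fin d → ℝ)} [IsProbabilityMeasure M]
    (hM : ∀ᵐ x ∂M, x ∈ stdSimplex ℝ (Fin d)) : barycenter M ∈ stdSimplex ℝ (Fin d) := by
  have hi : ∀ i, Integrable (fun x : Fin d → ℝ => x i) M := fun i =>
    integrable_of_simplex hM (measurable_pi_apply i) fun x hx => abs_apply_le_one hx i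
  refine ⟨fun i => integral_nonneg_of_ae (hM.mono fun x hx => hx.1 i), ?_⟩
  unfold barycenter
  rw [← integral_finsetSum _ fun i _ => hi i]
  calc ∫ x, ∑ i, x i ∂M = ∫ _x, 1 ∂M := integral_congr_ae (hM.mono fun x hx => hx.2)
    _ = 1 := by simp

theorem integral_dotProduct {M : Measure (Fin d → ℝ)} [IsFiniteMeasure M]
    (hM : ∀ᵐ x ∂M, x ∈ stdSimplex ℝ (Fin d)) (a : Fin d → ℝ) :
    ∫ x, a ⬝ᵥ x ∂M = a ⬝ᵥ barycenter M := by
  have hi : ∀ i, Integrable (fun x : Fin d → ℝ => x i) M := fun i =>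
    integrable_of_simplex hM (measurable_pi_apply i) fun x hx => abs_apply_le_one hx i
  simp only [dotProduct, barycenter]
  rw [integral_finsetSum _ fun i _ => (hi i).const_mul _]
  simp only [integral_const_mul]

include hΛ

theorem integrable_l1_obsProd (n : ℕ) {x : Fin d → ℝ} (hx : ∀ i, 0 ≤ x i) :
    Integrable (fun v => l1 (obsProd c Λ n v *ᵥ x)) (gaussPi n) := by
  refine ⟨(measurable_l1.comp (measurable_obsProd_mulVec c Λ n x)).aestronglyMeasurable, ?_⟩
  rw [hasFiniteIntegral_iff_ofReal (Eventually.of_forall fun _ => l1_nonneg _),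
    lintegral_l1_obsProd hΛ n hx]
  exact ENNReal.ofReal_lt_top

theorem integral_l1_obsProd (n : ℕ) {x : Fin d → ℝ} (hx : ∀ i, 0 ≤ x i) :
    ∫ v, l1 (obsProd c Λ n v *ᵥ x) ∂(gaussPi n) = l1 x := by
  rw [integral_eq_lintegral_of_nonneg_ae (Eventually.of_forall fun _ => l1_nonneg _)
    (measurable_l1.comp (measurable_obsProd_mulVec c Λ n x)).aestronglyMeasurable,
    lintegral_l1_obsProd hΛ n hx, ENNReal.toReal_ofReal (l1_nonneg _)]

theorem integrable_l1_obsProd_mul (n : ℕ) {x : Fin d → ℝ} (hx : ∀ i, 0 ≤ x i)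
    {g : (Fin n → ℝ) → ℝ} (hg : Measurable g) {C : ℝ} (hC : ∀ v, |g v| ≤ C) :
    Integrable (fun v => l1 (obsProd c Λ n v *ᵥ x) * g v) (gaussPi n) :=
  (integrable_l1_obsProd hΛ n hx).mul_bdd (c := C) hg.aestronglyMeasurable (Eventually.of_forall hC)

theorem l1_obsProd_eq_sum (n : ℕ) (v : Fin n → ℝ) {x : Fin d → ℝ} (hx : ∀ i, 0 ≤ x i) :
    l1 (obsProd c Λ n v *ᵥ x) = ∑ i, x i * l1 (obsProd c Λ n v *ᵥ Pi.single i 1) := by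
  have h1 : ∀ i, l1 (obsProd c Λ n v *ᵥ Pi.single i 1) = ∑ j, obsProd c Λ n v j i := by
    intro i
    rw [l1_eq_sum (obsProd_mulVec_nonneg hΛ n v (single_mem_stdSimplex ℝ i).1)]
    simp
  simp only [h1, Finset.mul_sum]
  rw [l1_eq_sum (obsProd_mulVec_nonneg hΛ n v hx), Finset.sum_comm]
  simp only [mulVec, dotProduct, mul_comm]

end Integrability

section Kernel
variable {d : ℕ} {Λ : Matrix (Fin d) (Fin d) ℝ} {μ : Fin d → ℝ}
  (hΛ : Λ ∈ Matrix.rowStochastic ℝ (Fin d)) (h : Fin d → ℝ) {σ : ℝ} (hσ : 0 < σ)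
include hΛ hσ

theorem ae_simplexKernel_pow (n : ℕ) {η : Fin d → ℝ} (hη : η ∈ stdSimplex ℝ (Fin d)) :
    ∀ᵐ x ∂((simplexKernel Λ h σ ^ n) η), x ∈ stdSimplex ℝ (Fin d) := by
  have hm : MeasurableSet (stdSimplex ℝ (Fin d))ᶜ := measurableSet_stdSimplex.compl
  rw [ae_iff]
  change ((simplexKernel Λ h σ ^ n) η) (stdSimplex ℝ (Fin d))ᶜ = 0
  rw [← lintegral_indicator_one hm, lintegral_simplexKernel_pow hΛ h hσ n hη
    (measurable_one.indicator hm)]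
  rw [lintegral_eq_zero_iff' ?_]
  · refine Eventually.of_forall fun v => ?_
    have h1 := normalize_mem (obsProd_mulVec_nonneg (c := fun i => h i / σ) hΛ n v hη.1)
      (l1_obsProd_mulVec_pos hΛ n v hη.1 (by rw [l1_eq_one hη]; exact one_pos))
    simp [h1]
  · have h2 := measurable_obsProd_mulVec (fun i => h i / σ) Λ n η
    exact (h2.ofReal_l1.mul ((measurable_one.indicator hm).comp_normalize h2)).aemeasurable

theorem ae_bind_simplexKernel_pow (n : ℕ) {M : Measure (Fin d → ℝ)}
    (hM : ∀ᵐ x ∂M, x ∈ stdSimplex ℝ (Fin d)) :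
    ∀ᵐ x ∂(M.bind ⇑(simplexKernel Λ h σ ^ n)), x ∈ stdSimplex ℝ (Fin d) := by
  have hm : MeasurableSet (stdSimplex ℝ (Fin d))ᶜ := measurableSet_stdSimplex.compl
  rw [ae_iff]
  change (M.bind ⇑(simplexKernel Λ h σ ^ n)) (stdSimplex ℝ (Fin d))ᶜ = 0
  rw [Measure.bind_apply hm (Kernel.aemeasurable _), lintegral_eq_zero_iff (Kernel.measurable_coe _ hm)]
  filter_upwards [hM] with x hx
  exact ae_iff.1 (ae_simplexKernel_pow hΛ h hσ n hx)

theorem simplexKernel_eq_obsMat {η : Fin d → ℝ} (hη : η ∈ stdSimplex ℝ (Fin d))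
    {f : (Fin d → ℝ) → ℝ} (hf : Measurable f) :
    ∫ x, f x ∂(simplexKernel Λ h σ η) = ∫ v, l1 (obsProd (fun i => h i / σ) Λ 1 v *ᵥ η) *
        f (normalize (obsProd (fun i => h i / σ) Λ 1 v *ᵥ η)) ∂(gaussPi 1) := by
  rw [← integral_simplexKernel_pow hΛ h hσ 1 hη hf, pow_one]

omit hΛ hσ in
theorem perspective_sub_le {f : (Fin d → ℝ) → ℝ} {C L : ℝ} (hf : IsTestFun f C L) (hL : 0 ≤ L)
    {x z : Fin d → ℝ} (hx : ∀ i, 0 ≤ x i) (hx' : 0 < l1 x) (hz : ∀ i, 0 ≤ z i) (hz' : 0 < l1 z) :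
    |l1 x * f (normalize x) - l1 z * f (normalize z)| ≤ (2 * L + C) * l1 (x - z) := by
  have hxN := normalize_mem hx hx'
  have hzN := normalize_mem hz hz'
  have h1 : l1 x * l1 (normalize x - normalize z) ≤ 2 * l1 (x - z) := by
    have e1 : l1 x • (normalize x - normalize z) = (x - z) + ((l1 z - l1 x) / l1 z) • z := by
      ext i
      simp only [normalize, Pi.smul_apply, Pi.sub_apply, Pi.add_apply, smul_eq_mul]
      field_simp
      ring
    have e2 := l1_smul (l1 x) (normalize x - normalize z)
    rw [abs_of_pos hx', e1] at e2
    rw [← e2]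
    refine (l1_add_le _ _).trans ?_
    rw [l1_smul, abs_div, abs_of_pos hz', div_mul_cancel₀ _ hz'.ne']
    have := abs_l1_sub_l1_le z x
    rw [l1_sub_comm] at this
    linarith
  have h2 : l1 x * f (normalize x) - l1 z * f (normalize z) =
      l1 x * (f (normalize x) - f (normalize z)) + (l1 x - l1 z) * f (normalize z) := by ring
  rw [h2]
  refine (abs_add_le _ _).trans ?_
  rw [abs_mul, abs_mul, abs_of_pos hx']
  have h3 := mul_le_mul_of_nonneg_left (hf.lipschitz _ hxN _ hzN) hx'.le
  have h4 : |l1 x - l1 z| * |f (normalize z)| ≤ l1 (x - z) * C :=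
    mul_le_mul (abs_l1_sub_l1_le x z) (hf.bound _ hzN) (abs_nonneg _) (l1_nonneg _)
  have h5 := mul_le_mul_of_nonneg_left h1 hL
  linarith

omit hσ in
theorem l1_obsProd_mulVec_le (c : Fin d → ℝ) (n : ℕ) (v : Fin n → ℝ) (x : Fin d → ℝ) :
    l1 (obsProd c Λ n v *ᵥ x) ≤ l1 (obsProd c Λ n v *ᵥ fun i => |x i|) := by
  have hB : ∀ i j, 0 ≤ obsProd c Λ n v i j := fun i j => by
    have := obsProd_mulVec_nonneg (c := c) hΛ n v (x := Pi.single j 1)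
      (single_mem_stdSimplex ℝ j).1 i
    simpa using this
  refine Finset.sum_le_sum fun i _ => ?_
  refine le_trans ?_ (le_abs_self _)
  simp only [mulVec, dotProduct]
  refine (Finset.abs_sum_le_sum_abs _ _).trans (Finset.sum_le_sum fun j _ => ?_)
  rw [abs_mul, abs_of_nonneg (hB i j)]

theorem IsTestFun.kernel {f : (Fin d → ℝ) → ℝ} {C L : ℝ} (hf : IsTestFun f C L) (hL : 0 ≤ L)
    (hC : 0 ≤ C) : IsTestFun (fun η => ∫ x, f x ∂(simplexKernel Λ h σ η)) C (2 * L + C) := by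
  have hK := isMarkovKernel_simplexKernel hΛ h hσ
  have hpos : ∀ {η : Fin d → ℝ}, η ∈ stdSimplex ℝ (Fin d) → ∀ v : Fin 1 → ℝ,
      0 < l1 (obsProd (fun i => h i / σ) Λ 1 v *ᵥ η) := fun hη v =>
    l1_obsProd_mulVec_pos hΛ 1 v hη.1 (by rw [l1_eq_one hη]; exact one_pos)
  have hmem : ∀ {η : Fin d → ℝ}, η ∈ stdSimplex ℝ (Fin d) → ∀ v : Fin 1 → ℝ,
      normalize (obsProd (fun i => h i / σ) Λ 1 v *ᵥ η) ∈ stdSimplex ℝ (Fin d) := fun hη v =>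
    normalize_mem (obsProd_mulVec_nonneg hΛ 1 v hη.1) (hpos hη v)
  have hint : ∀ {η : Fin d → ℝ}, η ∈ stdSimplex ℝ (Fin d) →
      Integrable (fun v => l1 (obsProd (fun i => h i / σ) Λ 1 v *ᵥ η) *
        f (normalize (obsProd (fun i => h i / σ) Λ 1 v *ᵥ η))) (gaussPi 1) := fun {η} hη =>
    integrable_l1_obsProd_mul hΛ 1 hη.1 (hf.measurable.comp_normalize
      (measurable_obsProd_mulVec _ Λ 1 η)) fun v => hf.bound _ (hmem hη v)
  refine ⟨(hf.measurable.stronglyMeasurable.integral_kernel).measurable, fun η hη => ?_,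
    fun η hη η' hη' => ?_⟩
  · have := norm_integral_le_of_norm_le_const (μ := simplexKernel Λ h σ η) (f := f) (C := C) <| by
      have := ae_simplexKernel_pow hΛ h hσ 1 hη
      rw [pow_one] at this
      exact this.mono fun x hx => hf.bound x hx
    simpa using this
  · rw [simplexKernel_eq_obsMat hΛ h hσ hη hf.measurable,
      simplexKernel_eq_obsMat hΛ h hσ hη' hf.measurable, ← integral_sub (hint hη) (hint hη'),
      ← Real.norm_eq_abs]
    calc _ ≤ ∫ v, (2 * L + C) * l1 (obsProd (fun i => h i / σ) Λ 1 v *ᵥ fun i => |(η - η') i|)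
          ∂(gaussPi 1) := by
          refine norm_integral_le_of_norm_le
            ((integrable_l1_obsProd hΛ 1 fun i => abs_nonneg _).const_mul _)
            (Eventually.of_forall fun v => ?_)
          refine (perspective_sub_le hf hL (obsProd_mulVec_nonneg hΛ 1 v hη.1) (hpos hη v)
            (obsProd_mulVec_nonneg hΛ 1 v hη'.1) (hpos hη' v)).trans ?_
          rw [← mulVec_sub]
          exact mul_le_mul_of_nonneg_left (l1_obsProd_mulVec_le hΛ _ 1 v _) (by positivity)
      _ = _ := by
          rw [integral_const_mul, integral_l1_obsProd hΛ 1 fun i => abs_nonneg _]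
          simp [l1]

theorem barycenter_simplexKernel {η : Fin d → ℝ} (hη : η ∈ stdSimplex ℝ (Fin d)) :
    barycenter (simplexKernel Λ h σ η) = Λᵀ *ᵥ η := by
  ext j
  have hp := mulVec_transpose_mem hΛ hη
  have hK := isMarkovKernel_simplexKernel hΛ h hσ
  have hs := ae_simplexKernel_pow hΛ h hσ 1 hη
  rw [pow_one] at hs
  unfold barycenter
  rw [integral_eq_lintegral_of_nonneg_ae (hs.mono fun x hx => hx.1 j)
    (measurable_pi_apply j).aestronglyMeasurable, simplexKernel_apply h σ hη,
    lintegral_filterLaw hΛ h hσ hη.1 (measurable_pi_apply j).ennreal_ofReal]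
  have h1 : ∀ v, ENNReal.ofReal (l1 (obsMat (fun i => h i / σ) Λ v *ᵥ η)) *
      ENNReal.ofReal (normalize (obsMat (fun i => h i / σ) Λ v *ᵥ η) j) =
      ENNReal.ofReal (shiftDensity (h j / σ) v) * ENNReal.ofReal ((Λᵀ *ᵥ η) j) := by
    intro v
    have hp : 0 < l1 (obsMat (fun i => h i / σ) Λ v *ᵥ η) :=
      l1_obsMat_mulVec_pos hΛ v hη.1 (by rw [l1_eq_one hη]; exact one_pos)
    rw [← ENNReal.ofReal_mul (l1_nonneg _), ← ENNReal.ofReal_mul (shiftDensity_pos _ _).le,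
      normalize, Pi.smul_apply, smul_eq_mul, mul_inv_cancel_left₀ hp.ne', obsMat_mulVec]
  have h2 := lintegral_gaussian_shift (h j / σ) (F := fun _ => 1) measurable_const
  simp only [mul_one, lintegral_one, measure_univ] at h2
  simp only [h1]
  rw [lintegral_mul_const _ (measurable_shiftDensity _).ennreal_ofReal, ← h2, one_mul,
    ENNReal.toReal_ofReal (hp.1 j)]

theorem barycenter_bind {M : Measure (Fin d → ℝ)} [IsProbabilityMeasure M]
    (hM : ∀ᵐ x ∂M, x ∈ stdSimplex ℝ (Fin d)) :
    barycenter (M.bind (simplexKernel Λ h σ)) = Λᵀ *ᵥ barycenter M := by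
  have hK := isMarkovKernel_simplexKernel hΛ h hσ
  have hs := ae_bind_simplexKernel_pow hΛ h hσ 1 hM
  rw [pow_one] at hs
  ext j
  have hi : Integrable (fun x : Fin d → ℝ => x j) (M.bind (simplexKernel Λ h σ)) :=
    integrable_of_simplex hs (measurable_pi_apply j) fun x hx =>
      abs_apply_le_one hx j
  have h1 : barycenter (M.bind (simplexKernel Λ h σ)) j =
      ∫ x, barycenter (simplexKernel Λ h σ x) j ∂M := integral_measure_bind hi
  rw [h1, integral_congr_ae (g := fun x => Λᵀ j ⬝ᵥ x)
    (hM.mono fun x hx => congrFun (barycenter_simplexKernel hΛ h hσ hx) j),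
    integral_dotProduct hM]
  rfl

theorem exists_linear_approx (hd : 0 < d) (hμ : IsErgodic Λ μ) :
    ∃ ε : ℕ → ℝ, Tendsto ε atTop (𝓝 0) ∧ ∀ (f : (Fin d → ℝ) → ℝ) (C L : ℝ), IsTestFun f C L →
      0 ≤ L → ∀ n, ∃ a : Fin d → ℝ, (∀ i, |a i| ≤ C) ∧ ∀ η ∈ stdSimplex ℝ (Fin d),
        |∫ x, f x ∂((simplexKernel Λ h σ ^ n) η) - a ⬝ᵥ η| ≤ L * ε n := by
  obtain ⟨ε, hε, hεt, hst⟩ := exists_filter_stability hd hΛ hμ fun i => h i / σ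
  refine ⟨fun n => (ε n).toReal, by
    simpa [Function.comp_def] using (ENNReal.tendsto_toReal ENNReal.zero_ne_top).comp hε,
    fun f C L hf hL n => ?_⟩
  set A := obsProd (fun i => h i / σ) Λ n with hA
  have hμs := hμ.mem_stdSimplex hd hΛ
  have hmeas : ∀ x, Measurable fun v => A v *ᵥ x := measurable_obsProd_mulVec _ Λ n
  have hpos : ∀ {η : Fin d → ℝ}, η ∈ stdSimplex ℝ (Fin d) → ∀ v, 0 < l1 (A v *ᵥ η) := fun hη v =>
    l1_obsProd_mulVec_pos hΛ n v hη.1 (by rw [l1_eq_one hη]; exact one_pos)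
  have hmem : ∀ {η : Fin d → ℝ}, η ∈ stdSimplex ℝ (Fin d) → ∀ v,
      normalize (A v *ᵥ η) ∈ stdSimplex ℝ (Fin d) := fun hη v =>
    normalize_mem (obsProd_mulVec_nonneg hΛ n v hη.1) (hpos hη v)
  have hint : ∀ {η η' : Fin d → ℝ}, η ∈ stdSimplex ℝ (Fin d) → η' ∈ stdSimplex ℝ (Fin d) →
      Integrable (fun v => l1 (A v *ᵥ η) * f (normalize (A v *ᵥ η'))) (gaussPi n) :=
    fun {η η'} hη hη' => integrable_l1_obsProd_mul hΛ n hη.1 (hf.measurable.comp_normalize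
      (hmeas η')) fun v => hf.bound _ (hmem hη' v)
  have hse := fun i : Fin d => single_mem_stdSimplex ℝ i
  refine ⟨fun i => ∫ v, l1 (A v *ᵥ Pi.single i 1) * f (normalize (A v *ᵥ μ)) ∂(gaussPi n),
    fun i => ?_, fun η hη => ?_⟩
  · rw [← Real.norm_eq_abs]
    calc _ ≤ ∫ v, l1 (A v *ᵥ Pi.single i 1) * C ∂(gaussPi n) := by
          refine norm_integral_le_of_norm_le ((integrable_l1_obsProd hΛ n (hse i).1).mul_const _)
            (Eventually.of_forall fun v => ?_)
          rw [norm_mul, Real.norm_eq_abs, Real.norm_eq_abs, abs_of_nonneg (l1_nonneg _)]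
          exact mul_le_mul_of_nonneg_left (hf.bound _ (hmem hμs v)) (l1_nonneg _)
      _ = C := by
          rw [integral_mul_const, integral_l1_obsProd hΛ n (hse i).1, l1_eq_one (hse i), one_mul]
  · have hlin : (fun i => ∫ v, l1 (A v *ᵥ Pi.single i 1) * f (normalize (A v *ᵥ μ)) ∂(gaussPi n)) ⬝ᵥ
        η = ∫ v, l1 (A v *ᵥ η) * f (normalize (A v *ᵥ μ)) ∂(gaussPi n) := by
      simp only [dotProduct, ← integral_mul_const]
      rw [← integral_finsetSum _ fun i _ => (hint (hse i) hμs).mul_const _]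
      refine integral_congr_ae (Eventually.of_forall fun v => ?_)
      simp only [hA]
      rw [l1_obsProd_eq_sum hΛ n v hη.1, Finset.sum_mul]
      exact Finset.sum_congr rfl fun i _ => by ring
    rw [integral_simplexKernel_pow hΛ h hσ n hη hf.measurable, hlin,
      ← integral_sub (hint hη hη) (hint hη hμs), ← Real.norm_eq_abs]
    set R : (Fin n → ℝ) → ℝ := fun v =>
      l1 (A v *ᵥ η - (l1 (A v *ᵥ η) / l1 (A v *ᵥ μ)) • (A v *ᵥ μ)) with hR
    have hRm : Measurable R := by
      refine measurable_l1.comp ((hmeas η).sub (Measurable.fun_smul ?_ (hmeas μ)))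
      exact (measurable_l1.comp (hmeas η)).div (measurable_l1.comp (hmeas μ))
    have hRi : ∫⁻ v, ENNReal.ofReal (R v) ∂(gaussPi n) ≤ ε n := hst n η hη
    have hRint : Integrable R (gaussPi n) := by
      refine ⟨hRm.aestronglyMeasurable, ?_⟩
      rw [hasFiniteIntegral_iff_ofReal (Eventually.of_forall fun _ => l1_nonneg _)]
      exact hRi.trans_lt (hεt n).lt_top
    calc _ ≤ ∫ v, L * R v ∂(gaussPi n) := by
          refine norm_integral_le_of_norm_le (hRint.const_mul L) (Eventually.of_forall fun v => ?_)
          rw [← mul_sub, norm_mul, Real.norm_eq_abs, Real.norm_eq_abs, abs_of_nonneg (l1_nonneg _)]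
          have h1 := hf.lipschitz _ (hmem hη v) _ (hmem hμs v)
          have h2 : l1 (A v *ᵥ η) * l1 (normalize (A v *ᵥ η) - normalize (A v *ᵥ μ)) = R v := by
            have e2 := l1_smul (l1 (A v *ᵥ η)) (normalize (A v *ᵥ η) - normalize (A v *ᵥ μ))
            rw [abs_of_pos (hpos hη v)] at e2
            rw [← e2, hR]
            dsimp only
            congr 1
            have := (hpos hη v).ne'
            rw [smul_sub, normalize, normalize, smul_smul, smul_smul, mul_inv_cancel₀ this, one_smul,
              div_eq_mul_inv]
          calc _ ≤ l1 (A v *ᵥ η) * (L * l1 (normalize (A v *ᵥ η) - normalize (A v *ᵥ μ))) :=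
                mul_le_mul_of_nonneg_left h1 (l1_nonneg _)
            _ = L * R v := by rw [← h2]; ring
      _ = L * (∫⁻ v, ENNReal.ofReal (R v) ∂(gaussPi n)).toReal := by
          rw [integral_const_mul, integral_eq_lintegral_of_nonneg_ae
            (Eventually.of_forall fun _ => l1_nonneg _) hRm.aestronglyMeasurable]
      _ ≤ _ := mul_le_mul_of_nonneg_left (ENNReal.toReal_mono (hεt n) hRi) hL

theorem exists_linear_approx_bind (hd : 0 < d) (hμ : IsErgodic Λ μ) :
    ∃ ε : ℕ → ℝ, Tendsto ε atTop (𝓝 0) ∧ ∀ (f : (Fin d → ℝ) → ℝ) (C L : ℝ), IsTestFun f C L →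
      0 ≤ L → ∀ n, ∃ a : Fin d → ℝ, (∀ i, |a i| ≤ C) ∧ ∀ M : Measure (Fin d → ℝ),
        IsProbabilityMeasure M → (∀ᵐ x ∂M, x ∈ stdSimplex ℝ (Fin d)) →
        |∫ x, f x ∂(M.bind ⇑(simplexKernel Λ h σ ^ n)) - a ⬝ᵥ barycenter M| ≤ L * ε n := by
  obtain ⟨ε, hε, H⟩ := exists_linear_approx hΛ h hσ hd hμ
  refine ⟨ε, hε, fun f C L hf hL n => ?_⟩
  obtain ⟨a, ha, haη⟩ := H f C L hf hL n
  refine ⟨a, ha, fun M _ hM => ?_⟩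
  have hK := isMarkovKernel_simplexKernel hΛ h hσ
  have hKn := isMarkovKernel_pow (simplexKernel Λ h σ) n
  have hs := ae_bind_simplexKernel_pow hΛ h hσ n hM
  have hi : Integrable f (M.bind ⇑(simplexKernel Λ h σ ^ n)) :=
    integrable_of_simplex hs hf.measurable hf.bound
  have hi2 : Integrable (fun x => ∫ y, f y ∂((simplexKernel Λ h σ ^ n) x)) M := by
    refine integrable_of_simplex hM (hf.measurable.stronglyMeasurable.integral_kernel).measurable
      (C := C) fun x hx => ?_
    have := norm_integral_le_of_norm_le_const (μ := (simplexKernel Λ h σ ^ n) x) (f := f) (C := C)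
      ((ae_simplexKernel_pow hΛ h hσ n hx).mono fun x hx => hf.bound x hx)
    simpa using this
  have hi3 : Integrable (fun x => a ⬝ᵥ x) M :=
    integrable_of_simplex hM (by simp only [dotProduct]; fun_prop) (C := C) fun x hx => by
      simpa [l1_eq_one hx] using abs_dotProduct_le_l1 a x ha
  rw [integral_measure_bind hi, ← integral_dotProduct hM, ← integral_sub hi2 hi3]
  have := norm_integral_le_of_norm_le_const (μ := M) (C := L * ε n) (f := fun x =>
    ∫ y, f y ∂((simplexKernel Λ h σ ^ n) x) - a ⬝ᵥ x) (hM.mono fun x hx => haη x hx)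
  simpa using this

end Kernel

section TestFunctions
variable {d : ℕ}

theorem IsTestFun.continuousOn {f : (Fin d → ℝ) → ℝ} {C L : ℝ} (hf : IsTestFun f C L) :
    ContinuousOn f (stdSimplex ℝ (Fin d)) := by
  intro x hx
  rw [ContinuousWithinAt, tendsto_iff_dist_tendsto_zero]
  have h1 : Tendsto (fun y => L * l1 (y - x)) (𝓝[stdSimplex ℝ (Fin d)] x) (𝓝 0) := by
    have : Continuous fun y => L * l1 (y - x) :=
      continuous_const.mul (continuous_l1.comp (continuous_id.sub continuous_const))
    have h2 := (this.tendsto x).mono_left (nhdsWithin_le_nhds (s := stdSimplex ℝ (Fin d)))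
    simpa [l1_zero] using h2
  refine squeeze_zero' (Eventually.of_forall fun _ => dist_nonneg) ?_ h1
  filter_upwards [self_mem_nhdsWithin] with y hy
  exact hf.lipschitz y hy x hx

theorem isTestFun_cos (ℓ : StrongDual ℝ (Fin d → ℝ)) :
    IsTestFun (fun x => Real.cos (ℓ x)) 1 ‖ℓ‖ where
  measurable := by fun_prop
  bound x _ := Real.abs_cos_le_one _
  lipschitz x _ y _ := by
    have h1 : |Real.cos (ℓ x) - Real.cos (ℓ y)| ≤ |ℓ x - ℓ y| := by
      simpa [Real.dist_eq] using Real.lipschitzWith_cos.dist_le_mul (ℓ x) (ℓ y)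
    refine h1.trans ?_
    rw [← map_sub]
    exact (ℓ.le_opNorm _).trans (mul_le_mul_of_nonneg_left (norm_le_l1 _) (norm_nonneg _))

theorem isTestFun_sin (ℓ : StrongDual ℝ (Fin d → ℝ)) :
    IsTestFun (fun x => Real.sin (ℓ x)) 1 ‖ℓ‖ where
  measurable := by fun_prop
  bound x _ := Real.abs_sin_le_one _
  lipschitz x _ y _ := by
    have h1 : |Real.sin (ℓ x) - Real.sin (ℓ y)| ≤ |ℓ x - ℓ y| := by
      simpa [Real.dist_eq] using Real.lipschitzWith_sin.dist_le_mul (ℓ x) (ℓ y)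
    refine h1.trans ?_
    rw [← map_sub]
    exact (ℓ.le_opNorm _).trans (mul_le_mul_of_nonneg_left (norm_le_l1 _) (norm_nonneg _))

theorem measure_ext_of_testFun {M M' : Measure (Fin d → ℝ)} [IsProbabilityMeasure M]
    [IsProbabilityMeasure M'] (hMM' : ∀ (f : (Fin d → ℝ) → ℝ) (L : ℝ), IsTestFun f 1 L → 0 ≤ L →
      ∫ x, f x ∂M = ∫ x, f x ∂M') : M = M' := by
  refine Measure.ext_of_charFunDual ?_
  ext ℓ
  have key : ∀ N : Measure (Fin d → ℝ), IsProbabilityMeasure N → charFunDual N ℓ =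
      (∫ x, Real.cos (ℓ x) ∂N : ℝ) + (∫ x, Real.sin (ℓ x) ∂N : ℝ) * Complex.I := by
    intro N _
    rw [charFunDual_apply]
    have h1 : ∀ x, Complex.exp (ℓ x * Complex.I) =
        (Real.cos (ℓ x) : ℂ) + (Real.sin (ℓ x) : ℂ) * Complex.I := fun x => by
      rw [Complex.exp_mul_I, Complex.ofReal_cos, Complex.ofReal_sin]
    have h2 : Integrable (fun x => Real.cos (ℓ x)) N :=
      Integrable.of_bound (isTestFun_cos ℓ).measurable.aestronglyMeasurable 1
        (Eventually.of_forall fun x => Real.abs_cos_le_one _)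
    have h3 : Integrable (fun x => Real.sin (ℓ x)) N :=
      Integrable.of_bound (isTestFun_sin ℓ).measurable.aestronglyMeasurable 1
        (Eventually.of_forall fun x => Real.abs_sin_le_one _)
    simp only [h1]
    rw [integral_add h2.ofReal (h3.ofReal.mul_const _), integral_mul_const, integral_complex_ofReal,
      integral_complex_ofReal]
  rw [key M inferInstance, key M' inferInstance, hMM' _ _ (isTestFun_cos ℓ) (norm_nonneg _),
    hMM' _ _ (isTestFun_sin ℓ) (norm_nonneg _)]

theorem tendsto_integral_of_continuousOn {ι : Type*} {l : Filter ι}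
    {m : ι → ProbabilityMeasure (Fin d → ℝ)} {M : ProbabilityMeasure (Fin d → ℝ)}
    (hm : Tendsto m l (𝓝 M)) {K : Set (Fin d → ℝ)} (hK : IsCompact K)
    (hmK : ∀ i, ∀ᵐ x ∂(m i : Measure (Fin d → ℝ)), x ∈ K)
    (hMK : ∀ᵐ x ∂(M : Measure (Fin d → ℝ)), x ∈ K) {f : (Fin d → ℝ) → ℝ} (hf : ContinuousOn f K) :
    Tendsto (fun i => ∫ x, f x ∂(m i : Measure (Fin d → ℝ))) l
      (𝓝 (∫ x, f x ∂(M : Measure (Fin d → ℝ)))) := by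
  have := isCompact_iff_compactSpace.1 hK
  set f' : BoundedContinuousFunction K ℝ :=
    BoundedContinuousFunction.mkOfCompact ⟨K.domRestrict f, hf.domRestrict⟩ with hf'
  obtain ⟨g, -, hg⟩ := BoundedContinuousFunction.exists_extension_norm_eq_of_isClosedEmbedding f'
    hK.isClosed.isClosedEmbedding_subtypeVal
  have hgf : ∀ x ∈ K, g x = f x := fun x hx => congrFun hg ⟨x, hx⟩
  have h1 := ProbabilityMeasure.tendsto_iff_forall_integral_tendsto.1 hm g
  rw [integral_congr_ae (hMK.mono fun x hx => (hgf x hx).symm)]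
  refine h1.congr fun i => integral_congr_ae ((hmK i).mono fun x hx => hgf x hx)

end TestFunctions

section Invariant
variable {d : ℕ} {Λ : Matrix (Fin d) (Fin d) ℝ} {μ : Fin d → ℝ}
  (hΛ : Λ ∈ Matrix.rowStochastic ℝ (Fin d)) (h : Fin d → ℝ) {σ : ℝ} (hσ : 0 < σ)

theorem bind_simplexKernel {M : Measure (Fin d → ℝ)}
    (hM : ∀ᵐ x ∂M, x ∈ stdSimplex ℝ (Fin d)) :
    M.bind (simplexKernel Λ h σ) = M.bind (filterKernel Λ h σ) :=
  Measure.bind_congr_right (hM.mono fun _ hx => simplexKernel_apply h σ hx)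

theorem IsInvariantFilterMeasure.bind_eq {M : Measure (Fin d → ℝ)}
    (hM : IsInvariantFilterMeasure Λ h σ M) : M.bind (simplexKernel Λ h σ) = M := by
  rw [bind_simplexKernel h hM.simplex, hM.invariant]

theorem bind_pow_succ (κ : Kernel (Fin d → ℝ) (Fin d → ℝ)) (M : Measure (Fin d → ℝ)) (n : ℕ) :
    M.bind ⇑(κ ^ (n + 1)) = (M.bind κ).bind ⇑(κ ^ n) := by
  rw [pow_succ]
  exact (Measure.bind_bind κ.aemeasurable (Kernel.aemeasurable _)).symm

theorem IsInvariantFilterMeasure.bind_pow_eq {M : Measure (Fin d → ℝ)}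
    (hM : IsInvariantFilterMeasure Λ h σ M) (n : ℕ) :
    M.bind ⇑(simplexKernel Λ h σ ^ n) = M := by
  induction n with
  | zero => exact Measure.bind_dirac
  | succ n ih => rw [bind_pow_succ, hM.bind_eq, ih]

include hΛ hσ

theorem IsInvariantFilterMeasure.barycenter_eq (hμ : IsErgodic Λ μ) {M : Measure (Fin d → ℝ)}
    (hM : IsInvariantFilterMeasure Λ h σ M) : barycenter M = μ := by
  have := hM.isProbabilityMeasure
  have h1 := barycenter_bind hΛ h hσ hM.simplex
  rw [hM.bind_eq] at h1
  have h2 : ∀ n : ℕ, Λᵀ ^ n *ᵥ barycenter M = barycenter M := by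
    intro n
    induction n with
    | zero => simp
    | succ n ih => rw [pow_succ, ← mulVec_mulVec, ← h1, ih]
  have h3 := hμ.1 _ (barycenter_mem hM.simplex)
  simp only [h2] at h3
  exact tendsto_nhds_unique tendsto_const_nhds h3

theorem isInvariantFilterMeasure_unique (hd : 0 < d) (hμ : IsErgodic Λ μ)
    {M M' : Measure (Fin d → ℝ)} (hM : IsInvariantFilterMeasure Λ h σ M)
    (hM' : IsInvariantFilterMeasure Λ h σ M') : M' = M := by
  have := hM.isProbabilityMeasure
  have := hM'.isProbabilityMeasure
  obtain ⟨ε, hε, H⟩ := exists_linear_approx_bind hΛ h hσ hd hμ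
  refine measure_ext_of_testFun fun f L hf hL => ?_
  have h1 : ∀ n, |∫ x, f x ∂M' - ∫ x, f x ∂M| ≤ 2 * (L * ε n) := by
    intro n
    obtain ⟨a, -, ha⟩ := H f 1 L hf hL n
    have h1 := ha M hM.isProbabilityMeasure hM.simplex
    have h2 := ha M' hM'.isProbabilityMeasure hM'.simplex
    rw [hM.bind_pow_eq, hM.barycenter_eq hΛ h hσ hμ] at h1
    rw [hM'.bind_pow_eq, hM'.barycenter_eq hΛ h hσ hμ] at h2
    rw [abs_le] at *
    constructor <;> linarith [h1.1, h1.2, h2.1, h2.2]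
  have h2 : Tendsto (fun n => 2 * (L * ε n)) atTop (𝓝 0) := by
    simpa using (hε.const_mul L).const_mul 2
  have h3 := ge_of_tendsto' h2 h1
  exact sub_eq_zero.1 (abs_nonpos_iff.1 h3)

theorem exists_isInvariantFilterMeasure (hd : 0 < d) (hμ : IsErgodic Λ μ) :
    ∃ M, IsInvariantFilterMeasure Λ h σ M := by
  have hK := isMarkovKernel_simplexKernel hΛ h hσ
  have hKn := fun n => isMarkovKernel_pow (simplexKernel Λ h σ) n
  have hμs := hμ.mem_stdSimplex hd hΛ
  obtain ⟨ε, hε, H⟩ := exists_linear_approx_bind hΛ h hσ hd hμ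
  set m : ℕ → ProbabilityMeasure (Fin d → ℝ) := fun n =>
    ⟨(simplexKernel Λ h σ ^ n) μ, inferInstance⟩ with hm
  have hms : ∀ n, ∀ᵐ x ∂(m n : Measure (Fin d → ℝ)), x ∈ stdSimplex ℝ (Fin d) := fun n =>
    ae_simplexKernel_pow hΛ h hσ n hμs
  have hcomp : IsCompact {M : ProbabilityMeasure (Fin d → ℝ) |
      ∀ n : ℕ, M ((fun _ : ℕ => stdSimplex ℝ (Fin d)) n)ᶜ ≤ (fun _ : ℕ => (0 : NNReal)) n} :=
    isCompact_setOfPred_probabilityMeasure_mass_eq_compl_isCompact_le tendsto_const_nhds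
      (fun _ => isCompact_stdSimplex ℝ (Fin d)) (Or.inr monotone_const)
  have hmem : ∀ (N : ProbabilityMeasure (Fin d → ℝ)), N (stdSimplex ℝ (Fin d))ᶜ ≤ 0 ↔
      ∀ᵐ x ∂(N : Measure (Fin d → ℝ)), x ∈ stdSimplex ℝ (Fin d) := by
    intro N
    rw [nonpos_iff_eq_zero, ProbabilityMeasure.null_iff_toMeasure_null, ae_iff]
    rfl
  obtain ⟨M, hMK, hMlim⟩ := hcomp.ultrafilter_le_nhds' ((hyperfilter ℕ).map m) (by
    rw [Ultrafilter.mem_map]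
    exact Filter.univ_mem' fun n _ => (hmem _).2 (hms n))
  have hMs := (hmem M).1 (hMK 0)
  have hlim : Tendsto m (hyperfilter ℕ) (𝓝 M) := hMlim
  refine ⟨M, inferInstance, hMs, ?_⟩
  rw [Kernel.Invariant, ← bind_simplexKernel h hMs]
  refine measure_ext_of_testFun fun f L hf hL => ?_
  have hbs := ae_bind_simplexKernel_pow hΛ h hσ 1 hMs
  rw [pow_one] at hbs
  rw [integral_measure_bind (integrable_of_simplex hbs hf.measurable hf.bound)]
  have h1 := tendsto_integral_of_continuousOn hlim (isCompact_stdSimplex ℝ (Fin d)) hms hMs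
    hf.continuousOn
  have h2 := tendsto_integral_of_continuousOn hlim (isCompact_stdSimplex ℝ (Fin d)) hms hMs
    (hf.kernel hΛ h hσ hL zero_le_one).continuousOn
  have h3 : ∀ n, ∫ x, ∫ y, f y ∂(simplexKernel Λ h σ x) ∂(m n : Measure (Fin d → ℝ)) =
      ∫ x, f x ∂(m (n + 1) : Measure (Fin d → ℝ)) := by
    intro n
    have e : (m (n + 1) : Measure (Fin d → ℝ)) =
        (m n : Measure (Fin d → ℝ)).bind (simplexKernel Λ h σ) := by
      change (simplexKernel Λ h σ ^ (n + 1)) μ = _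
      rw [pow_succ']
      rfl
    rw [e, integral_measure_bind]
    rw [← e]
    exact integrable_of_simplex (hms (n + 1)) hf.measurable hf.bound
  have h4 : ∀ n, |∫ x, f x ∂(m (n + 1) : Measure (Fin d → ℝ)) -
      ∫ x, f x ∂(m n : Measure (Fin d → ℝ))| ≤ 2 * (L * ε n) := by
    intro n
    obtain ⟨a, -, ha⟩ := H f 1 L hf hL n
    have hd1 : ∀ᵐ x ∂(Measure.dirac μ), x ∈ stdSimplex ℝ (Fin d) :=
      ae_simplexKernel_pow hΛ h hσ 0 hμs
    have hb1 : barycenter (Measure.dirac μ) = μ := by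
      ext i
      rw [barycenter, integral_dirac]
    have e1 : (Measure.dirac μ).bind ⇑(simplexKernel Λ h σ ^ n) = m n :=
      Measure.dirac_bind (Kernel.measurable _) _
    have e2 : (Measure.dirac μ).bind (simplexKernel Λ h σ) = simplexKernel Λ h σ μ :=
      Measure.dirac_bind (Kernel.measurable _) _
    have e3 : (simplexKernel Λ h σ μ).bind ⇑(simplexKernel Λ h σ ^ n) = m (n + 1) := by
      rw [← e2, ← bind_pow_succ]
      exact Measure.dirac_bind (Kernel.measurable _) _
    have hs1 := ae_simplexKernel_pow hΛ h hσ 1 hμs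
    rw [pow_one] at hs1
    have h5 := ha _ inferInstance hd1
    have h6 := ha _ inferInstance hs1
    rw [e1, hb1] at h5
    rw [e3, barycenter_simplexKernel hΛ h hσ hμs, hμ.mulVec_eq hd] at h6
    rw [abs_le] at *
    constructor <;> linarith [h5.1, h5.2, h6.1, h6.2]
  simp only [h3] at h2
  have h5 : Tendsto (fun n => 2 * (L * ε n)) (hyperfilter ℕ : Filter ℕ) (𝓝 0) := by
    have : Tendsto (fun n => 2 * (L * ε n)) atTop (𝓝 0) := by
      simpa using (hε.const_mul L).const_mul 2
    exact this.mono_left Nat.hyperfilter_le_atTop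
  have h6 := le_of_tendsto_of_tendsto' (h2.sub h1).abs h5 h4
  exact sub_eq_zero.1 (abs_nonpos_iff.1 h6)

theorem tendsto_integral_simplexKernel_pow (hd : 0 < d) (hμ : IsErgodic Λ μ)
    {M : Measure (Fin d → ℝ)} (hM : IsInvariantFilterMeasure Λ h σ M) {ν : Fin d → ℝ}
    (hν : ν ∈ stdSimplex ℝ (Fin d)) {f : (Fin d → ℝ) → ℝ} {C L : ℝ} (hf : IsTestFun f C L)
    (hL : 0 ≤ L) :
    Tendsto (fun n => ∫ x, f x ∂((simplexKernel Λ h σ ^ n) ν)) atTop (𝓝 (∫ x, f x ∂M)) := by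
  have hK := isMarkovKernel_simplexKernel hΛ h hσ
  have hKn := fun n => isMarkovKernel_pow (simplexKernel Λ h σ) n
  have := hM.isProbabilityMeasure
  obtain ⟨ε, hε, H⟩ := exists_linear_approx_bind hΛ h hσ hd hμ
  have hbary : ∀ n, barycenter ((simplexKernel Λ h σ ^ n) ν) = Λᵀ ^ n *ᵥ ν := by
    intro n
    induction n with
    | zero =>
      have : (simplexKernel Λ h σ ^ 0) ν = Measure.dirac ν := rfl
      ext i
      rw [this, barycenter, integral_dirac]
      simp
    | succ n ih =>
      have e : (simplexKernel Λ h σ ^ (n + 1)) ν =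
          ((simplexKernel Λ h σ ^ n) ν).bind (simplexKernel Λ h σ) := by
        rw [pow_succ']
        rfl
      rw [e, barycenter_bind hΛ h hσ (ae_simplexKernel_pow hΛ h hσ n hν), ih, mulVec_mulVec,
        pow_succ']
  have hest : ∀ n k, |∫ x, f x ∂((simplexKernel Λ h σ ^ (k + n)) ν) - ∫ x, f x ∂M| ≤
      2 * (L * ε n) + C * l1 (Λᵀ ^ k *ᵥ ν - μ) := by
    intro n k
    obtain ⟨a, ha, haM⟩ := H f C L hf hL n
    have e : (simplexKernel Λ h σ ^ (k + n)) ν =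
        ((simplexKernel Λ h σ ^ k) ν).bind ⇑(simplexKernel Λ h σ ^ n) := by
      rw [add_comm, pow_add]
      rfl
    have h1 := haM M hM.isProbabilityMeasure hM.simplex
    have h2 := haM ((simplexKernel Λ h σ ^ k) ν) inferInstance (ae_simplexKernel_pow hΛ h hσ k hν)
    rw [hM.bind_pow_eq, hM.barycenter_eq hΛ h hσ hμ] at h1
    rw [← e, hbary] at h2
    have h3 := abs_dotProduct_le_l1 a (Λᵀ ^ k *ᵥ ν - μ) ha
    rw [dotProduct_sub] at h3
    rw [abs_le] at *
    constructor <;> linarith [h1.1, h1.2, h2.1, h2.2, h3.1, h3.2]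
  rw [Metric.tendsto_atTop]
  intro e he
  have h1 : Tendsto (fun n => 2 * (L * ε n)) atTop (𝓝 0) := by
    simpa using (hε.const_mul L).const_mul 2
  have h2 : Tendsto (fun k : ℕ => C * l1 (Λᵀ ^ k *ᵥ ν - μ)) atTop (𝓝 0) := by
    have h3 : Tendsto (fun k : ℕ => Λᵀ ^ k *ᵥ ν - μ) atTop (𝓝 0) := by
      simpa using (hμ.1 ν hν).sub_const μ
    have h4 := ((continuous_l1.tendsto 0).comp h3).const_mul C
    simpa [l1_zero] using h4
  obtain ⟨n, hn⟩ := (h1.eventually_lt_const (half_pos he)).exists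
  obtain ⟨k₀, hk₀⟩ := eventually_atTop.1 (h2.eventually_lt_const (half_pos he))
  refine ⟨k₀ + n, fun k hk => ?_⟩
  have h5 := hest n (k - n)
  rw [Nat.sub_add_cancel (by omega)] at h5
  rw [Real.dist_eq]
  linarith [hk₀ (k - n) (by omega)]

end Invariant

section Paths
variable {d : ℕ} {Λ : Matrix (Fin d) (Fin d) ℝ}

/-- The probability of a path of the chain. -/
def pathProb (Λ : Matrix (Fin d) (Fin d) ℝ) (ν : Fin d → ℝ) (n : ℕ) (x : Fin (n + 1) → Fin d) : ℝ :=
  ν (x 0) * ∏ k : Fin n, Λ (x k.castSucc) (x k.succ)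

theorem pathProb_nonneg (hΛ : Λ ∈ Matrix.rowStochastic ℝ (Fin d)) {ν : Fin d → ℝ}
    (hν : ∀ i, 0 ≤ ν i) (n : ℕ) (x : Fin (n + 1) → Fin d) : 0 ≤ pathProb Λ ν n x :=
  mul_nonneg (hν _) (Finset.prod_nonneg fun _ _ => hΛ.1 _ _)

theorem pathProb_snoc (Λ : Matrix (Fin d) (Fin d) ℝ) (ν : Fin d → ℝ) (n : ℕ)
    (x : Fin (n + 1) → Fin d) (j : Fin d) :
    pathProb Λ ν (n + 1) (Fin.snoc x j : Fin (n + 2) → Fin d) =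
      pathProb Λ ν n x * Λ (x (Fin.last n)) j := by
  have h0 : (Fin.snoc x j : Fin (n + 2) → Fin d) 0 = x 0 := by
    rw [← Fin.castSucc_zero, Fin.snoc_castSucc]
  have h1 : ∀ k : Fin n, (Fin.snoc x j : Fin (n + 2) → Fin d) k.castSucc.succ = x k.succ := by
    intro k
    rw [← Fin.castSucc_succ, Fin.snoc_castSucc]
  have h2 : (Fin.snoc x j : Fin (n + 2) → Fin d) (Fin.last n).succ = j := by
    rw [Fin.succ_last, Fin.snoc_last]
  simp only [pathProb, Fin.prod_univ_castSucc, h0, h1, h2, Fin.snoc_castSucc, mul_assoc]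

theorem sum_fin_snoc {n : ℕ} (f : (Fin (n + 1) → Fin d) → ENNReal) :
    ∑ x, f x = ∑ j, ∑ x : Fin n → Fin d, f (Fin.snoc x j : Fin (n + 1) → Fin d) := by
  rw [← (Fin.snocEquiv fun _ => Fin d).sum_comp, Fintype.sum_prod_type]
  rfl

theorem sum_pathProb_lintegral (hΛ : Λ ∈ Matrix.rowStochastic ℝ (Fin d)) (c : Fin d → ℝ)
    {ν : Fin d → ℝ} (hν : ∀ i, 0 ≤ ν i) (n : ℕ) {F : (Fin n → ℝ) → ENNReal} (hF : Measurable F)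
    (i : Fin d) :
    ∑ x : Fin (n + 1) → Fin d, (if x (Fin.last n) = i then ENNReal.ofReal (pathProb Λ ν n x) *
      ∫⁻ u, F (fun k => c (x k.succ) + u k) ∂(gaussPi n) else 0) =
      ∫⁻ v, F v * ENNReal.ofReal ((obsProd c Λ n v *ᵥ ν) i) ∂(gaussPi n) := by
  induction n generalizing i with
  | zero =>
    rw [← (Equiv.funUnique (Fin 1) (Fin d)).symm.sum_comp]
    simp [pathProb, obsProd, Finset.sum_ite_eq', gaussPi, mul_comm,
      Subsingleton.elim (fun _ => _ : Fin 0 → ℝ) isEmptyElim]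
  | succ n ih =>
    set G : (Fin n → ℝ) → ENNReal := fun v => ∫⁻ t, F (Fin.snoc v (c i + t)) ∂(gaussianReal 0 1)
      with hG
    have hsn : Measurable fun p : (Fin n → ℝ) × ℝ =>
        F (Fin.snoc p.1 p.2 : Fin (n + 1) → ℝ) := hF.comp (measurable_snoc n)
    have hGm : Measurable G := by
      have h1 : Measurable fun p : (Fin n → ℝ) × ℝ => (p.1, c i + p.2) := by fun_prop
      exact (hsn.comp h1).lintegral_prod_right'
    rw [sum_fin_snoc]
    have hx : ∀ (x : Fin (n + 1) → Fin d) (j : Fin d), ∫⁻ u, F (fun k =>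
        c ((Fin.snoc x j : Fin (n + 2) → Fin d) k.succ) + u k) ∂(gaussPi (n + 1)) =
        ∫⁻ u, ∫⁻ t, F (Fin.snoc (fun k => c (x k.succ) + u k) (c j + t)) ∂(gaussianReal 0 1)
          ∂(gaussPi n) := by
      intro x j
      have hm : Measurable fun u : Fin (n + 1) → ℝ =>
          F (fun k => c ((Fin.snoc x j : Fin (n + 2) → Fin d) k.succ) + u k) := by fun_prop
      rw [lintegral_gaussPi_succ n hm]
      refine lintegral_congr fun u => lintegral_congr fun t => congrArg F (funext fun k => ?_)
      refine Fin.lastCases ?_ (fun k => ?_) k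
      · simp only [Fin.succ_last, Fin.snoc_last]
      · simp only [Fin.snoc_castSucc, ← Fin.castSucc_succ]
    have hsum : ∀ x : Fin (n + 1) → Fin d, ∀ j : Fin d,
        (if (Fin.snoc x j : Fin (n + 2) → Fin d) (Fin.last (n + 1)) = i
          then ENNReal.ofReal (pathProb Λ ν (n + 1) (Fin.snoc x j)) *
            ∫⁻ u, F (fun k => c ((Fin.snoc x j : Fin (n + 2) → Fin d)
              k.succ) + u k) ∂(gaussPi (n + 1)) else 0) =
        if j = i then ∑ k, ENNReal.ofReal (Λ k i) * (if x (Fin.last n) = k then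
          ENNReal.ofReal (pathProb Λ ν n x) * ∫⁻ u, G (fun k => c (x k.succ) + u k) ∂(gaussPi n)
            else 0) else 0 := by
      intro x j
      rw [Fin.snoc_last]
      split_ifs with hj
      · subst hj
        rw [hx, pathProb_snoc, ENNReal.ofReal_mul (pathProb_nonneg hΛ hν n x)]
        simp only [mul_ite, mul_zero, Finset.sum_ite_eq, Finset.mem_univ, if_true]
        rw [mul_comm (ENNReal.ofReal (pathProb Λ ν n x)), mul_assoc]
      · rfl
    rw [Finset.sum_congr rfl fun j _ => Finset.sum_congr rfl fun x _ => hsum x j]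
    rw [Finset.sum_comm]
    simp only [Finset.sum_ite_eq', Finset.mem_univ, if_true]
    rw [Finset.sum_comm]
    simp only [← Finset.mul_sum, ih hGm]
    have hAm : ∀ k, Measurable fun v => ENNReal.ofReal ((obsProd c Λ n v *ᵥ ν) k) := fun k =>
      ((measurable_pi_apply k).comp (measurable_obsProd_mulVec c Λ n ν)).ennreal_ofReal
    have hAm' : ∀ k, Measurable fun v => ENNReal.ofReal ((obsProd c Λ (n + 1) v *ᵥ ν) k) := fun k =>
      ((measurable_pi_apply k).comp (measurable_obsProd_mulVec c Λ (n + 1) ν)).ennreal_ofReal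
    rw [lintegral_gaussPi_succ n
      (F := fun v => F v * ENNReal.ofReal ((obsProd c Λ (n + 1) v *ᵥ ν) i)) (hF.mul (hAm' i))]
    have hGA : ∀ k, Measurable fun v => G v * ENNReal.ofReal ((obsProd c Λ n v *ᵥ ν) k) := fun k =>
      hGm.mul (hAm k)
    rw [Finset.sum_congr rfl fun k _ => (lintegral_const_mul (ENNReal.ofReal (Λ k i))
      (hGA k)).symm, ← lintegral_finsetSum _ fun k _ => (hGA k).const_mul _]
    refine lintegral_congr fun v => ?_
    have hnn := obsProd_mulVec_nonneg (c := c) hΛ n v hν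
    have h1 : ∑ k, ENNReal.ofReal (Λ k i) * (G v * ENNReal.ofReal ((obsProd c Λ n v *ᵥ ν) k)) =
        G v * ENNReal.ofReal ((Λᵀ *ᵥ (obsProd c Λ n v *ᵥ ν)) i) := by
      have h2 : (Λᵀ *ᵥ (obsProd c Λ n v *ᵥ ν)) i = ∑ k, Λ k i * (obsProd c Λ n v *ᵥ ν) k := rfl
      rw [h2, ENNReal.ofReal_sum_of_nonneg fun k _ => mul_nonneg (hΛ.1 k i) (hnn k), Finset.mul_sum]
      refine Finset.sum_congr rfl fun k _ => ?_
      rw [ENNReal.ofReal_mul (hΛ.1 k i)]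
      ring
    have hsv : Measurable fun t : ℝ => F (Fin.snoc v t : Fin (n + 1) → ℝ) :=
      hsn.comp measurable_prodMk_left
    have hsv' : Measurable fun t : ℝ => ENNReal.ofReal (shiftDensity (c i) t) *
        F (Fin.snoc v t : Fin (n + 1) → ℝ) := (measurable_shiftDensity _).ennreal_ofReal.mul hsv
    rw [h1, hG]
    dsimp only
    rw [lintegral_gaussian_shift (c i) (F := fun t => F (Fin.snoc v t : Fin (n + 1) → ℝ)) hsv,
      ← lintegral_mul_const _ hsv']
    refine lintegral_congr fun t => ?_
    rw [obsProd_snoc, ← mulVec_mulVec, obsMat_mulVec, ENNReal.ofReal_mul (shiftDensity_pos _ _).le]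
    ring

end Paths

section Model
variable {d : ℕ} {Λ : Matrix (Fin d) (Fin d) ℝ} {ν : Fin d → ℝ} {Ω : Type*} [MeasurableSpace Ω]
  {prob : Measure Ω} [IsProbabilityMeasure prob] {X : ℕ → Ω → Fin d} {ξ : ℕ → Ω → ℝ}

theorem IsModel.map_noise (hX : IsModel Λ ν prob X ξ) (n : ℕ) :
    prob.map (fun ω (k : Fin n) => ξ (k + 1) ω) = gaussPi n := by
  have h1 : iIndepFun (fun k : Fin n => ξ (k + 1)) prob :=
    hX.indep_noise.precomp (g := fun k : Fin n => (k : ℕ)) Fin.val_injective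
  have h2 := (iIndepFun_iff_map_fun_eq_pi_map fun k : Fin n =>
    (hX.measurable_noise (k + 1)).aemeasurable).1 h1
  rw [h2]
  simp only [hX.law_noise]

omit [IsProbabilityMeasure prob] in
theorem IsModel.measure_path (hX : IsModel Λ ν prob X ξ) (n : ℕ) (x : Fin (n + 1) → Fin d) :
    prob.map (fun ω (k : Fin (n + 1)) => X k ω) {x} = ENNReal.ofReal (pathProb Λ ν n x) := by
  have hm : Measurable fun ω (k : Fin (n + 1)) => X k ω :=
    measurable_pi_lambda _ fun k => hX.measurable_signal k
  rw [Measure.map_apply hm (measurableSet_singleton x)]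
  set x' : ℕ → Fin d := fun k => x (Fin.ofNat (n + 1) k) with hx'
  have hcast : ∀ k : Fin (n + 1), x' k = x k := fun k => by simp [hx']
  have h1 : (fun ω (k : Fin (n + 1)) => X k ω) ⁻¹' {x} = {ω | ∀ k ≤ n, X k ω = x' k} := by
    ext ω
    simp only [Set.mem_preimage, Set.mem_singleton_iff, funext_iff]
    constructor
    · intro h k hk
      have := h ⟨k, by omega⟩
      rw [← hcast] at this
      exact this
    · intro h k
      rw [h k (by omega), hcast]
  rw [h1, hX.law_signal, pathProb, ← Fin.prod_univ_eq_prod_range (fun k => Λ (x' k) (x' (k + 1))) n]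
  congr 2
  refine Finset.prod_congr rfl fun k _ => ?_
  rw [← hcast, ← hcast]
  simp

theorem IsModel.lintegral_eq (hX : IsModel Λ ν prob X ξ) (n : ℕ)
    {Φ : (Fin (n + 1) → Fin d) → (Fin n → ℝ) → ENNReal} (hΦ : ∀ x, Measurable (Φ x)) :
    ∫⁻ ω, Φ (fun k => X k ω) (fun k => ξ (k + 1) ω) ∂prob =
      ∑ x, ENNReal.ofReal (pathProb Λ ν n x) * ∫⁻ u, Φ x u ∂(gaussPi n) := by
  have hX1 : Measurable fun ω (k : Fin (n + 1)) => X k ω :=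
    measurable_pi_lambda _ fun k => hX.measurable_signal k
  have hξ1 : Measurable fun ω (k : Fin n) => ξ (k + 1) ω :=
    measurable_pi_lambda _ fun k => hX.measurable_noise (k + 1)
  have hi : IndepFun (fun ω (k : Fin (n + 1)) => X k ω) (fun ω (k : Fin n) => ξ (k + 1) ω) prob :=
    hX.indep_signal_noise.comp (φ := fun (x : ℕ → Fin d) (k : Fin (n + 1)) => x k)
      (ψ := fun (u : ℕ → ℝ) (k : Fin n) => u k) (by fun_prop) (by fun_prop)
  have hmap := (indepFun_iff_map_prod_eq_prod_map_map hX1.aemeasurable hξ1.aemeasurable).1 hi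
  have hm : Measurable fun p : (Fin (n + 1) → Fin d) × (Fin n → ℝ) => Φ p.1 p.2 :=
    measurable_from_prod_countable_right hΦ
  have h1 : ∫⁻ ω, Φ (fun k => X k ω) (fun k => ξ (k + 1) ω) ∂prob =
      ∫⁻ p, Φ p.1 p.2 ∂(prob.map fun ω => ((fun k : Fin (n + 1) => X k ω),
        (fun k : Fin n => ξ (k + 1) ω))) := by
    rw [lintegral_map hm (hX1.prodMk hξ1)]
  rw [h1, hmap, hX.map_noise, lintegral_prod _ hm.aemeasurable, lintegral_fintype]
  refine Finset.sum_congr rfl fun x _ => ?_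
  rw [hX.measure_path, mul_comm]

/-- The observations `Y_1, …, Y_n`, in units of the noise. -/
def obsVec (h : Fin d → ℝ) (σ : ℝ) (X : ℕ → Ω → Fin d) (ξ : ℕ → Ω → ℝ) (n : ℕ) (ω : Ω) :
    Fin n → ℝ :=
  fun k => h (X (k + 1) ω) / σ + ξ (k + 1) ω

omit [IsProbabilityMeasure prob] in
theorem IsModel.measurable_obsVec (hX : IsModel Λ ν prob X ξ) (h : Fin d → ℝ) (σ : ℝ) (n : ℕ) :
    Measurable (obsVec h σ X ξ n) :=
  measurable_pi_lambda _ fun k =>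
    (((measurable_of_finite h).comp (hX.measurable_signal (k + 1))).div_const σ).add
      (hX.measurable_noise (k + 1))

theorem IsModel.lintegral_obsVec (hΛ : Λ ∈ Matrix.rowStochastic ℝ (Fin d))
    (hν : ∀ i, 0 ≤ ν i) (hX : IsModel Λ ν prob X ξ) (h : Fin d → ℝ) (σ : ℝ) (n : ℕ)
    {F : (Fin n → ℝ) → ENNReal} (hF : Measurable F) (i : Fin d) :
    ∫⁻ ω, (if X n ω = i then F (obsVec h σ X ξ n ω) else 0) ∂prob =
      ∫⁻ v, F v * ENNReal.ofReal ((obsProd (fun i => h i / σ) Λ n v *ᵥ ν) i) ∂(gaussPi n) := by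
  rw [← sum_pathProb_lintegral hΛ _ hν n hF i]
  have h1 := hX.lintegral_eq n (Φ := fun x u => if x (Fin.last n) = i then
    F (fun k => h (x k.succ) / σ + u k) else 0) fun x => by
      split_ifs
      · fun_prop
      · exact measurable_const
  refine Eq.trans ?_ (h1.trans (Finset.sum_congr rfl fun x _ => ?_))
  · refine lintegral_congr fun ω => ?_
    simp only [Fin.val_last]
    rfl
  · split_ifs <;> simp

omit [MeasurableSpace Ω] in
theorem obsSigma_eq_comap (h : Fin d → ℝ) {σ : ℝ} (hσ : 0 < σ) (X : ℕ → Ω → Fin d)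
    (ξ : ℕ → Ω → ℝ) (n : ℕ) :
    obsSigma h σ X ξ n = MeasurableSpace.comap (obsVec h σ X ξ n) inferInstance := by
  apply le_antisymm
  · refine iSup₂_le fun m hm => ?_
    rw [Finset.mem_Icc] at hm
    have h1 : obs h σ X ξ m =
        (fun v : Fin n → ℝ => σ * v ⟨m - 1, by omega⟩) ∘ obsVec h σ X ξ n := by
      ext ω
      simp only [obs, obsVec, Function.comp_apply, Nat.sub_add_cancel hm.1]
      field_simp
    rw [h1, ← MeasurableSpace.comap_comp]
    refine MeasurableSpace.comap_mono ?_
    refine Measurable.comap_le ?_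
    fun_prop
  · refine Measurable.comap_le ?_
    refine @measurable_pi_lambda _ _ _ (obsSigma h σ X ξ n) _ _ fun k => ?_
    have h1 : (fun ω => obsVec h σ X ξ n ω k) = (fun y => y / σ) ∘ obs h σ X ξ (k + 1) := by
      ext ω
      simp only [obs, obsVec, Function.comp_apply]
      field_simp
    rw [h1]
    have h2 : Measurable[obsSigma h σ X ξ n] (obs h σ X ξ (k + 1)) := by
      refine Measurable.mono (comap_measurable _) ?_ le_rfl
      exact le_iSup₂_of_le (f := fun m (_ : m ∈ Finset.Icc 1 n) =>
        MeasurableSpace.comap (obs h σ X ξ m) inferInstance) (k + 1 : ℕ)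
        (Finset.mem_Icc.2 ⟨by omega, by omega⟩) le_rfl
    exact (measurable_id.div_const σ).comp h2

theorem exists_measurable_argmax (hd : 0 < d) :
    ∃ g : (Fin d → ℝ) → Fin d, Measurable g ∧ ∀ (x : Fin d → ℝ) (j : Fin d), x j ≤ x (g x) := by
  have hex : ∀ x : Fin d → ℝ, ∃ i, (∀ j, x j ≤ x i) ∧ ∀ k < i, ¬ ∀ j, x j ≤ x k := by
    intro x
    have : Nonempty (Fin d) := ⟨⟨0, hd⟩⟩
    obtain ⟨i, hi⟩ := Finite.exists_max x
    obtain ⟨m, hm, hmin⟩ := WellFounded.has_min (wellFounded_lt (α := Fin d))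
      {i | ∀ j, x j ≤ x i} ⟨i, hi⟩
    exact ⟨m, hm, fun k hk hk' => hmin k hk' hk⟩
  choose g hg using hex
  refine ⟨g, measurable_to_countable' fun i => ?_, fun x => (hg x).1⟩
  have : g ⁻¹' {i} = {x | (∀ j, x j ≤ x i) ∧ ∀ k < i, ¬ ∀ j, x j ≤ x k} := by
    ext x
    simp only [Set.mem_preimage, Set.mem_singleton_iff, Set.mem_ofPred_eq]
    constructor
    · rintro rfl
      exact hg x
    · rintro ⟨h1, h2⟩
      rcases lt_trichotomy (g x) i with h | h | h
      · exact absurd (hg x).1 (h2 _ h)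
      · exact h
      · exact absurd h1 ((hg x).2 _ h)
  rw [this]
  have hle : ∀ i j : Fin d, MeasurableSet {x : Fin d → ℝ | x j ≤ x i} := fun i j =>
    measurableSet_le (measurable_pi_apply j) (measurable_pi_apply i)
  have hall : ∀ i : Fin d, MeasurableSet {x : Fin d → ℝ | ∀ j, x j ≤ x i} := fun i => by
    rw [Set.ofPred_forall]
    exact MeasurableSet.iInter fun j => hle i j
  have h2 : MeasurableSet {x : Fin d → ℝ | ∀ k < i, ¬ ∀ j, x j ≤ x k} := by
    simp only [Set.ofPred_forall]
    exact MeasurableSet.iInter fun k => MeasurableSet.iInter fun _ => (hall k).compl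
  exact (hall i).inter h2

/-- The largest coordinate of a vector. -/
def maxCoord (x : Fin d → ℝ) : ℝ := ⨆ i, x i

theorem le_maxCoord (x : Fin d → ℝ) (i : Fin d) : x i ≤ maxCoord x :=
  le_ciSup (Set.finite_range x).bddAbove i

theorem maxCoord_le (hd : 0 < d) {x : Fin d → ℝ} {b : ℝ} (hb : ∀ i, x i ≤ b) : maxCoord x ≤ b := by
  have : Nonempty (Fin d) := ⟨⟨0, hd⟩⟩
  exact ciSup_le hb

theorem abs_maxCoord_sub_le (hd : 0 < d) (x y : Fin d → ℝ) :
    |maxCoord x - maxCoord y| ≤ l1 (x - y) := by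
  have key : ∀ x y : Fin d → ℝ, maxCoord x ≤ maxCoord y + l1 (x - y) := fun x y =>
    maxCoord_le hd fun i => by
      have h1 := abs_le_l1 (x - y) i
      have h2 := le_maxCoord y i
      have h3 := le_abs_self ((x - y) i)
      simp only [Pi.sub_apply] at h1 h3
      linarith
  have h1 := key x y
  have h2 := key y x
  rw [l1_sub_comm] at h2
  rw [abs_le]
  constructor <;> linarith

theorem measurable_maxCoord : Measurable (maxCoord : (Fin d → ℝ) → ℝ) :=
  Measurable.iSup fun i => measurable_pi_apply i

theorem isTestFun_maxCoord (hd : 0 < d) : IsTestFun (maxCoord : (Fin d → ℝ) → ℝ) 1 1 where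
  measurable := measurable_maxCoord
  bound x hx := by
    rw [abs_le]
    constructor
    · exact (by linarith [hx.1 ⟨0, hd⟩] : (-1 : ℝ) ≤ x ⟨0, hd⟩).trans (le_maxCoord x _)
    · exact maxCoord_le hd fun i => (le_abs_self _).trans (abs_apply_le_one hx i)
  lipschitz x _ y _ := by
    rw [one_mul]
    exact abs_maxCoord_sub_le hd x y

theorem maxCoord_nonneg (hd : 0 < d) {x : Fin d → ℝ} (hx : ∀ i, 0 ≤ x i) : 0 ≤ maxCoord x :=
  (hx ⟨0, hd⟩).trans (le_maxCoord x _)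

theorem l1_mul_maxCoord_normalize (hd : 0 < d) {x : Fin d → ℝ} (hx : 0 < l1 x) :
    l1 x * maxCoord (normalize x) = maxCoord x := by
  apply le_antisymm
  · rw [← le_div_iff₀' hx]
    refine maxCoord_le hd fun i => ?_
    rw [normalize, Pi.smul_apply, smul_eq_mul, inv_mul_eq_div]
    exact div_le_div_of_nonneg_right (le_maxCoord x i) hx.le
  · refine maxCoord_le hd fun i => ?_
    have h1 := mul_le_mul_of_nonneg_left (le_maxCoord (normalize x) i) hx.le
    rwa [normalize, Pi.smul_apply, smul_eq_mul, mul_inv_cancel_left₀ hx.ne'] at h1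

theorem IsModel.measure_eq (hΛ : Λ ∈ Matrix.rowStochastic ℝ (Fin d))
    (hν : ∀ i, 0 ≤ ν i) (hX : IsModel Λ ν prob X ξ) (a h : Fin d → ℝ) (σ : ℝ) (n : ℕ)
    {φ : (Fin n → ℝ) → ℝ} (hφ : Measurable φ) :
    prob {ω | a (X n ω) = φ (obsVec h σ X ξ n ω)} = ∫⁻ v, ∑ i, (if a i = φ v then
      ENNReal.ofReal ((obsProd (fun i => h i / σ) Λ n v *ᵥ ν) i) else 0) ∂(gaussPi n) := by
  have hVm := hX.measurable_obsVec h σ n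
  have hXm := hX.measurable_signal n
  have hset : ∀ i, MeasurableSet {v | a i = φ v} := fun i =>
    measurableSet_eq_fun measurable_const hφ
  have hind : ∀ i, Measurable fun v => if a i = φ v then (1 : ENNReal) else 0 := fun i =>
    Measurable.ite (hset i) measurable_const measurable_const
  have hm : MeasurableSet {ω | a (X n ω) = φ (obsVec h σ X ξ n ω)} :=
    measurableSet_eq_fun ((measurable_of_finite a).comp hXm) (hφ.comp hVm)
  have hA : ∀ i, Measurable fun v =>
      ENNReal.ofReal ((obsProd (fun i => h i / σ) Λ n v *ᵥ ν) i) := fun i =>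
    ((measurable_pi_apply i).comp (measurable_obsProd_mulVec _ Λ n ν)).ennreal_ofReal
  rw [← lintegral_indicator_one hm, lintegral_finsetSum _ fun i _ =>
    Measurable.ite (hset i) (hA i) measurable_const]
  have h1 : ∀ ω, ({ω | a (X n ω) = φ (obsVec h σ X ξ n ω)}.indicator 1 ω : ENNReal) =
      ∑ i, (if X n ω = i then (if a i = φ (obsVec h σ X ξ n ω) then (1 : ENNReal) else 0)
        else 0) := by
    intro ω
    rw [Finset.sum_ite_eq]
    simp [Set.indicator_apply]
  simp only [h1]
  rw [lintegral_finsetSum]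
  · refine Finset.sum_congr rfl fun i _ => ?_
    rw [hX.lintegral_obsVec hΛ hν h σ n (hind i) i]
    refine lintegral_congr fun v => ?_
    split_ifs <;> simp
  · intro i _
    refine Measurable.ite (hXm (measurableSet_singleton i)) ?_ measurable_const
    exact (hind i).comp hVm

theorem IsModel.minError_eq (hd : 0 < d) (hΛ : Λ ∈ Matrix.rowStochastic ℝ (Fin d))
    (hν : ν ∈ stdSimplex ℝ (Fin d)) (hX : IsModel Λ ν prob X ξ) {a : Fin d → ℝ}
    (ha : Function.Injective a) (h : Fin d → ℝ) {σ : ℝ} (hσ : 0 < σ) (n : ℕ) :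
    minError a h σ prob X ξ n = 1 - ∫ x, maxCoord x ∂((simplexKernel Λ h σ ^ n) ν) := by
  set A := obsProd (fun i => h i / σ) Λ n with hA
  have hpos : ∀ v, 0 < l1 (A v *ᵥ ν) := fun v =>
    l1_obsProd_mulVec_pos hΛ n v hν.1 (by rw [l1_eq_one hν]; exact one_pos)
  have hnn : ∀ v i, 0 ≤ (A v *ᵥ ν) i := fun v => obsProd_mulVec_nonneg hΛ n v hν.1
  have hAm : Measurable fun v => A v *ᵥ ν := measurable_obsProd_mulVec _ Λ n ν
  have hval : ∫ x, maxCoord x ∂((simplexKernel Λ h σ ^ n) ν) =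
      (∫⁻ v, ENNReal.ofReal (maxCoord (A v *ᵥ ν)) ∂(gaussPi n)).toReal := by
    rw [integral_simplexKernel_pow hΛ h hσ n hν measurable_maxCoord,
      ← integral_eq_lintegral_of_nonneg_ae
        (Eventually.of_forall fun v => maxCoord_nonneg hd (hnn v))
        (measurable_maxCoord.comp hAm).aestronglyMeasurable]
    exact integral_congr_ae (Eventually.of_forall fun v => l1_mul_maxCoord_normalize hd (hpos v))
  set p := ∫⁻ v, ENNReal.ofReal (maxCoord (A v *ᵥ ν)) ∂(gaussPi n) with hp
  have hVm := hX.measurable_obsVec h σ n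
  have hcompl : ∀ φ : (Fin n → ℝ) → ℝ, Measurable φ →
      prob.real {ω | a (X n ω) ≠ φ (obsVec h σ X ξ n ω)} =
        1 - (prob {ω | a (X n ω) = φ (obsVec h σ X ξ n ω)}).toReal := by
    intro φ hφ
    have hm : MeasurableSet {ω | a (X n ω) = φ (obsVec h σ X ξ n ω)} :=
      measurableSet_eq_fun ((measurable_of_finite a).comp (hX.measurable_signal n)) (hφ.comp hVm)
    exact probReal_compl_eq_one_sub hm
  have hple : p ≠ ⊤ := by
    refine ((lintegral_mono fun v => ENNReal.ofReal_le_ofReal (maxCoord_le hd fun i => ?_)).trans_lt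
      ((lintegral_l1_obsProd (c := fun i => h i / σ) hΛ n hν.1).trans_lt ENNReal.ofReal_lt_top)).ne
    exact (le_abs_self _).trans (abs_le_l1 _ i)
  rw [hval, minError]
  refine IsLeast.csInf_eq ⟨?_, ?_⟩
  · obtain ⟨g, hg, hmax⟩ := exists_measurable_argmax hd
    have hφ : Measurable fun v => a (g (A v *ᵥ ν)) := (measurable_of_finite a).comp (hg.comp hAm)
    refine ⟨fun ω => a (g (A (obsVec h σ X ξ n ω) *ᵥ ν)), ?_, ⟨∑ i, |a i|, fun ω => ?_⟩, ?_⟩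
    · rw [obsSigma_eq_comap h hσ]
      exact hφ.comp (comap_measurable _)
    · exact Finset.single_le_sum (f := fun i => |a i|) (fun _ _ => abs_nonneg _) (Finset.mem_univ _)
    · rw [hcompl _ hφ, hX.measure_eq hΛ hν.1 a h σ n hφ, hp]
      congr 2
      refine lintegral_congr fun v => ?_
      simp only [ha.eq_iff, Finset.sum_ite_eq', Finset.mem_univ, if_true]
      congr 1
      exact le_antisymm (maxCoord_le hd (hmax _)) (le_maxCoord _ _)
  · rintro r ⟨θ, hθ, -, rfl⟩
    rw [obsSigma_eq_comap h hσ] at hθ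
    obtain ⟨φ, hφ, rfl⟩ := hθ.exists_eq_measurable_comp
    have h1 := hcompl φ hφ
    simp only [Function.comp_apply]
    rw [h1]
    refine sub_le_sub_left (ENNReal.toReal_mono hple ?_) _
    rw [hX.measure_eq hΛ hν.1 a h σ n hφ]
    refine lintegral_mono fun v => ?_
    by_cases hex : ∃ i, a i = φ v
    · obtain ⟨i, hi⟩ := hex
      simp only [← hi, ha.eq_iff, Finset.sum_ite_eq', Finset.mem_univ, if_true]
      exact ENNReal.ofReal_le_ofReal (le_maxCoord _ i)
    · push Not at hex
      simp [hex]

end Model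

section OneStep
variable {d : ℕ} {Λ : Matrix (Fin d) (Fin d) ℝ}

theorem simplexKernel_eq_map (hΛ : Λ ∈ Matrix.rowStochastic ℝ (Fin d)) (h : Fin d → ℝ)
    {σ : ℝ} (hσ : 0 < σ) {η : Fin d → ℝ} (hη : η ∈ stdSimplex ℝ (Fin d)) :
    simplexKernel Λ h σ η = ((gaussianReal 0 1).withDensity fun v =>
      ENNReal.ofReal (l1 (obsMat (fun i => h i / σ) Λ v *ᵥ η))).map
        fun v => normalize (obsMat (fun i => h i / σ) Λ v *ᵥ η) := by
  have hm := measurable_obsMat_mulVec_const (fun i => h i / σ) Λ η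
  have hm2 : Measurable fun v => normalize (obsMat (fun i => h i / σ) Λ v *ᵥ η) :=
    measurable_normalize.comp hm
  have hL : Measurable fun v => ENNReal.ofReal (l1 (obsMat (fun i => h i / σ) Λ v *ᵥ η)) :=
    (measurable_l1.comp hm).ennreal_ofReal
  refine Measure.ext_of_lintegral _ fun F hF => ?_
  rw [simplexKernel_apply h σ hη, lintegral_filterLaw hΛ h hσ hη.1 hF, lintegral_map hF hm2,
    lintegral_withDensity_eq_lintegral_mul _ hL
      (g := fun v => F (normalize (obsMat (fun i => h i / σ) Λ v *ᵥ η))) (hF.comp hm2)]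
  rfl

theorem integral_simplexKernel {E : Type*} [NormedAddCommGroup E] [NormedSpace ℝ E]
    (hΛ : Λ ∈ Matrix.rowStochastic ℝ (Fin d)) (h : Fin d → ℝ)
    {σ : ℝ} (hσ : 0 < σ) {η : Fin d → ℝ} (hη : η ∈ stdSimplex ℝ (Fin d))
    {f : (Fin d → ℝ) → E} (hf : StronglyMeasurable f) :
    ∫ x, f x ∂(simplexKernel Λ h σ η) =
      ∫ v, l1 (obsMat (fun i => h i / σ) Λ v *ᵥ η) •
        f (normalize (obsMat (fun i => h i / σ) Λ v *ᵥ η)) ∂(gaussianReal 0 1) := by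
  have hm := measurable_obsMat_mulVec_const (fun i => h i / σ) Λ η
  have hm2 : Measurable fun v => normalize (obsMat (fun i => h i / σ) Λ v *ᵥ η) :=
    measurable_normalize.comp hm
  have hL : Measurable fun v => ENNReal.ofReal (l1 (obsMat (fun i => h i / σ) Λ v *ᵥ η)) :=
    (measurable_l1.comp hm).ennreal_ofReal
  rw [simplexKernel_eq_map hΛ h hσ hη, integral_map hm2.aemeasurable hf.aestronglyMeasurable,
    integral_withDensity_eq_integral_toReal_smul hL (by simp)]
  refine integral_congr_ae (Eventually.of_forall fun v => ?_)
  simp only [ENNReal.toReal_ofReal (l1_nonneg _)]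

end OneStep

section Envelope

theorem abs_exp_sub_one_le_mul_exp (s : ℝ) : |Real.exp s - 1| ≤ |s| * Real.exp |s| := by
  have h := Complex.norm_exp_sub_sum_le_norm_mul_exp s 1
  simp only [Finset.sum_range_one, pow_zero, Nat.factorial_zero, Nat.cast_one, div_one, pow_one,
    Complex.norm_real, Real.norm_eq_abs] at h
  rw [← Complex.ofReal_exp, ← Complex.ofReal_one, ← Complex.ofReal_sub, Complex.norm_real] at h
  exact h

theorem abs_exp_sub_one_sub_le_sq_mul_exp (s : ℝ) :
    |Real.exp s - 1 - s| ≤ |s| ^ 2 * Real.exp |s| := by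
  have h := Complex.norm_exp_sub_sum_le_norm_mul_exp s 2
  simp only [Finset.sum_range_succ, Finset.sum_range_zero, zero_add, pow_zero, Nat.factorial_zero,
    Nat.cast_one, div_one, pow_one, Nat.factorial_one, Complex.norm_real, Real.norm_eq_abs,
    ← sub_sub] at h
  rw [← Complex.ofReal_exp, ← Complex.ofReal_one, ← Complex.ofReal_sub, ← Complex.ofReal_sub,
    Complex.norm_real] at h
  exact h

/-- The exponent of the bounds on the likelihood ratios. -/
def envExp (H v : ℝ) : ℝ := (1 + H) ^ 2 * (1 + |v|)

theorem measurable_envExp (H : ℝ) : Measurable (envExp H) := by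
  unfold envExp
  fun_prop

variable {H : ℝ} (hH : 0 ≤ H)
include hH

theorem envExp_nonneg (v : ℝ) : 0 ≤ envExp H v := by
  unfold envExp
  positivity

theorem mul_abs_le_envExp (v : ℝ) : H * |v| ≤ envExp H v := by
  unfold envExp
  nlinarith [mul_nonneg hH (abs_nonneg v), mul_nonneg (mul_nonneg hH hH) (abs_nonneg v),
    abs_nonneg v]

theorem abs_le_envExp (v : ℝ) : |v| ≤ envExp H v := by
  unfold envExp
  nlinarith [mul_nonneg hH (abs_nonneg v), mul_nonneg (mul_nonneg hH hH) (abs_nonneg v),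
    abs_nonneg v]

theorem sq_le_exp_envExp (v : ℝ) : H ^ 2 ≤ Real.exp (envExp H v) := by
  refine le_trans ?_ (Real.add_one_le_exp _)
  unfold envExp
  nlinarith [mul_nonneg hH (abs_nonneg v), mul_nonneg (mul_nonneg hH hH) (abs_nonneg v),
    abs_nonneg v]

variable {σ : ℝ} (hσ : 1 ≤ σ) {c : ℝ} (hc : |c| ≤ H / σ)
include hσ hc

theorem abs_shiftExp_le (v : ℝ) : |c * v - c ^ 2 / 2| ≤ envExp H v / σ := by
  have hσ0 : 0 < σ := by linarith
  have h1 : |c * v| ≤ H * |v| / σ := by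
    rw [abs_mul, mul_div_right_comm]
    exact mul_le_mul_of_nonneg_right hc (abs_nonneg v)
  have h2 : c ^ 2 / 2 ≤ H ^ 2 / σ := by
    have h3 : c ^ 2 ≤ (H / σ) ^ 2 := by
      rw [← sq_abs]
      exact pow_le_pow_left₀ (abs_nonneg c) hc 2
    have h4 : (H / σ) ^ 2 ≤ H ^ 2 / σ := by
      rw [div_pow]
      exact div_le_div_of_nonneg_left (sq_nonneg H) hσ0 (by nlinarith)
    nlinarith [sq_nonneg c]
  calc |c * v - c ^ 2 / 2| ≤ |c * v| + |c ^ 2 / 2| := abs_sub _ _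
    _ ≤ H * |v| / σ + H ^ 2 / σ := by
        rw [abs_of_nonneg (by positivity : 0 ≤ c ^ 2 / 2)]
        exact add_le_add h1 h2
    _ = (H * |v| + H ^ 2) / σ := by ring
    _ ≤ envExp H v / σ := by
        refine div_le_div_of_nonneg_right ?_ hσ0.le
        unfold envExp
        nlinarith [mul_nonneg hH (abs_nonneg v), mul_nonneg (mul_nonneg hH hH) (abs_nonneg v),
          abs_nonneg v]

theorem abs_shiftExp_le' (v : ℝ) : |c * v - c ^ 2 / 2| ≤ envExp H v :=
  (abs_shiftExp_le hH hσ hc v).trans (div_le_self (envExp_nonneg hH v) hσ)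

theorem shiftDensity_le (v : ℝ) : shiftDensity c v ≤ Real.exp (envExp H v) :=
  Real.exp_le_exp.2 ((le_abs_self _).trans (abs_shiftExp_le' hH hσ hc v))

theorem le_shiftDensity (v : ℝ) : Real.exp (-envExp H v) ≤ shiftDensity c v :=
  Real.exp_le_exp.2 (neg_le.1 ((neg_le_abs _).trans (abs_shiftExp_le' hH hσ hc v)))

theorem abs_shiftDensity_sub_one_le (v : ℝ) :
    |shiftDensity c v - 1| ≤ Real.exp (2 * envExp H v) / σ := by
  set s := c * v - c ^ 2 / 2 with hs
  set x := envExp H v with hx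
  have hx0 : 0 ≤ x := envExp_nonneg hH v
  have h1 := abs_exp_sub_one_le_mul_exp s
  calc |shiftDensity c v - 1| ≤ |s| * Real.exp |s| := h1
    _ ≤ x / σ * Real.exp x := mul_le_mul (abs_shiftExp_le hH hσ hc v)
        (Real.exp_le_exp.2 (abs_shiftExp_le' hH hσ hc v)) (Real.exp_nonneg _) (by positivity)
    _ ≤ Real.exp x / σ * Real.exp x := by
        have : x ≤ Real.exp x := by linarith [Real.add_one_le_exp x]
        gcongr
    _ = Real.exp (2 * x) / σ := by
        rw [div_mul_eq_mul_div, ← Real.exp_add, two_mul]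

theorem abs_shiftDensity_sub_one_sub_le (v : ℝ) :
    |shiftDensity c v - 1 - c * v| ≤ 2 * Real.exp (3 * envExp H v) / σ ^ 2 := by
  set s := c * v - c ^ 2 / 2 with hs
  set x := envExp H v with hx
  have hx0 : 0 ≤ x := envExp_nonneg hH v
  have hσ0 : 0 < σ := by linarith
  have h1 := abs_exp_sub_one_sub_le_sq_mul_exp s
  have h2 : |s| ^ 2 * Real.exp |s| ≤ Real.exp (3 * x) / σ ^ 2 := by
    calc |s| ^ 2 * Real.exp |s| ≤ (x / σ) ^ 2 * Real.exp x :=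
          mul_le_mul (pow_le_pow_left₀ (abs_nonneg _) (abs_shiftExp_le hH hσ hc v) 2)
          (Real.exp_le_exp.2 (abs_shiftExp_le' hH hσ hc v)) (Real.exp_nonneg _) (by positivity)
      _ ≤ (Real.exp x / σ) ^ 2 * Real.exp x := by
        have : x ≤ Real.exp x := by linarith [Real.add_one_le_exp x]
        gcongr
      _ = Real.exp (3 * x) / σ ^ 2 := by
        rw [div_pow, div_mul_eq_mul_div, ← Real.exp_nat_mul, ← Real.exp_add]
        congr 2
        push_cast
        ring
  have h3 : c ^ 2 / 2 ≤ Real.exp (3 * x) / σ ^ 2 := by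
    have h4 : c ^ 2 ≤ H ^ 2 / σ ^ 2 := by
      rw [← sq_abs, ← div_pow]
      exact pow_le_pow_left₀ (abs_nonneg c) hc 2
    have h5 : H ^ 2 ≤ Real.exp (3 * x) :=
      (sq_le_exp_envExp hH v).trans (Real.exp_le_exp.2 (by linarith))
    have h6 : H ^ 2 / σ ^ 2 ≤ Real.exp (3 * x) / σ ^ 2 := by gcongr
    nlinarith [sq_nonneg c]
  have h4 : shiftDensity c v - 1 - c * v = (Real.exp s - 1 - s) - c ^ 2 / 2 := by
    rw [hs]
    unfold shiftDensity
    ring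
  rw [h4]
  refine (abs_sub _ _).trans ?_
  rw [abs_of_nonneg (by positivity : 0 ≤ c ^ 2 / 2)]
  calc _ ≤ Real.exp (3 * x) / σ ^ 2 + Real.exp (3 * x) / σ ^ 2 := add_le_add (h1.trans h2) h3
    _ = _ := by ring

end Envelope

theorem integrable_exp_envExp (H K : ℝ) :
    Integrable (fun v => Real.exp (K * envExp H v)) (gaussianReal 0 1) := by
  set A := K * (1 + H) ^ 2 with hA
  have h1 := (integrable_exp_mul_gaussianReal (μ := 0) (v := 1) A).add
    (integrable_exp_mul_gaussianReal (μ := 0) (v := 1) (-A))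
  refine Integrable.mono' (h1.const_mul (Real.exp A))
    ((measurable_envExp H).const_mul K).exp.aestronglyMeasurable
    (Eventually.of_forall fun v => ?_)
  rw [Real.norm_eq_abs, abs_of_nonneg (Real.exp_nonneg _)]
  have h2 : K * envExp H v = A + A * |v| := by
    rw [hA]
    unfold envExp
    ring
  rw [h2, Real.exp_add]
  refine mul_le_mul_of_nonneg_left ?_ (Real.exp_nonneg _)
  simp only [Pi.add_apply]
  rcases abs_cases v with ⟨hv, -⟩ | ⟨hv, -⟩ <;> rw [hv]
  · linarith [Real.exp_nonneg (-A * v)]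
  · rw [mul_neg, ← neg_mul]
    linarith [Real.exp_nonneg (A * v)]


section Update
variable {d : ℕ} {p e : Fin d → ℝ} (hp : p ∈ stdSimplex ℝ (Fin d))
include hp

theorem abs_sum_mul_sub_one_le {δ : ℝ} (he : ∀ k, |e k - 1| ≤ δ) : |∑ k, e k * p k - 1| ≤ δ := by
  have h1 : ∑ k, e k * p k - 1 = (fun k => e k - 1) ⬝ᵥ p := by
    simp only [dotProduct, sub_mul, one_mul, Finset.sum_sub_distrib, hp.2]
  rw [h1]
  simpa [l1_eq_one hp] using abs_dotProduct_le_l1 (fun k => e k - 1) p he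

theorem l1_reweight_sub_le {δ : ℝ} (he : ∀ k, |e k - 1| ≤ δ) :
    l1 ((fun k => e k * p k) - (∑ k, e k * p k) • p) ≤ 2 * δ := by
  have hL := abs_sum_mul_sub_one_le hp he
  set L := ∑ k, e k * p k
  calc _ ≤ ∑ k, 2 * δ * p k := by
        refine Finset.sum_le_sum fun k _ => ?_
        have h1 : ((fun k => e k * p k) - L • p) k = ((e k - 1) - (L - 1)) * p k := by
          simp only [Pi.sub_apply, Pi.smul_apply, smul_eq_mul]
          ring
        rw [h1, abs_mul, abs_of_nonneg (hp.1 k)]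
        refine mul_le_mul_of_nonneg_right ?_ (hp.1 k)
        linarith [abs_sub (e k - 1) (L - 1), he k]
    _ = _ := by rw [← Finset.mul_sum, hp.2, mul_one]

theorem l1_reweight_sub_linear_le {δ δ₂ T v : ℝ} {c : Fin d → ℝ} (he : ∀ k, |e k - 1| ≤ δ)
    (he₂ : ∀ k, |e k - 1 - c k * v| ≤ δ₂) (hcv : ∀ k, |c k * v| ≤ T) :
    l1 ((fun k => e k * p k) - (∑ k, e k * p k) • (p + v • noiseVec p c)) ≤
      2 * δ₂ + δ * (2 * T) := by
  have hL := abs_sum_mul_sub_one_le hp he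
  have hL₂ : |∑ k, e k * p k - 1 - (p ⬝ᵥ c) * v| ≤ δ₂ := by
    have h1 : ∑ k, e k * p k - 1 - (p ⬝ᵥ c) * v = (fun k => e k - 1 - c k * v) ⬝ᵥ p := by
      simp only [dotProduct, sub_mul, one_mul, Finset.sum_sub_distrib, hp.2, Finset.sum_mul]
      congr 1
      exact Finset.sum_congr rfl fun k _ => by ring
    rw [h1]
    simpa [l1_eq_one hp] using abs_dotProduct_le_l1 _ p he₂
  have hm : |(p ⬝ᵥ c) * v| ≤ T := by
    have h1 : (p ⬝ᵥ c) * v = (fun k => c k * v) ⬝ᵥ p := by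
      simp only [dotProduct, Finset.sum_mul]
      exact Finset.sum_congr rfl fun k _ => by ring
    rw [h1]
    simpa [l1_eq_one hp] using abs_dotProduct_le_l1 _ p hcv
  set L := ∑ k, e k * p k
  set m := p ⬝ᵥ c
  calc _ ≤ ∑ k, (2 * δ₂ + δ * (2 * T)) * p k := by
        refine Finset.sum_le_sum fun k _ => ?_
        have h1 : ((fun k => e k * p k) - L • (p + v • noiseVec p c)) k =
            (((e k - 1 - c k * v) - (L - 1 - m * v)) - (L - 1) * (c k * v - m * v)) * p k := by
          simp only [Pi.sub_apply, Pi.smul_apply, smul_eq_mul, Pi.add_apply, noiseVec_apply]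
          ring
        rw [h1, abs_mul, abs_of_nonneg (hp.1 k)]
        refine mul_le_mul_of_nonneg_right ?_ (hp.1 k)
        have h2 : |(L - 1) * (c k * v - m * v)| ≤ δ * (2 * T) := by
          rw [abs_mul]
          refine mul_le_mul hL ?_ (abs_nonneg _) ((abs_nonneg _).trans hL)
          linarith [abs_sub (c k * v) (m * v), hcv k]
        linarith [abs_sub ((e k - 1 - c k * v) - (L - 1 - m * v)) ((L - 1) * (c k * v - m * v)),
          abs_sub (e k - 1 - c k * v) (L - 1 - m * v), he₂ k]
    _ = _ := by rw [← Finset.mul_sum, hp.2, mul_one]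

end Update

section Step
variable {d : ℕ} {Λ : Matrix (Fin d) (Fin d) ℝ} {H σ : ℝ} {c : Fin d → ℝ}
  (hΛ : Λ ∈ Matrix.rowStochastic ℝ (Fin d)) (hH : 0 ≤ H) (hσ : 1 ≤ σ) (hc : ∀ i, |c i| ≤ H / σ)
  {η : Fin d → ℝ} (hη : η ∈ stdSimplex ℝ (Fin d)) (v : ℝ)

theorem obsMat_mulVec_eq (c : Fin d → ℝ) (Λ : Matrix (Fin d) (Fin d) ℝ) (v : ℝ) (η : Fin d → ℝ) :
    obsMat c Λ v *ᵥ η = fun k => shiftDensity (c k) v * (Λᵀ *ᵥ η) k :=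
  funext fun k => obsMat_mulVec v η k

include hΛ hη

theorem l1_obsMat_mulVec_eq :
    l1 (obsMat c Λ v *ᵥ η) = ∑ k, shiftDensity (c k) v * (Λᵀ *ᵥ η) k := by
  rw [l1_eq_sum (obsMat_mulVec_nonneg hΛ v hη.1), obsMat_mulVec_eq]

theorem l1_obsMat_smul_normalize :
    l1 (obsMat c Λ v *ᵥ η) • normalize (obsMat c Λ v *ᵥ η) = obsMat c Λ v *ᵥ η := by
  have h := l1_obsMat_mulVec_pos (c := c) hΛ v hη.1 (by rw [l1_eq_one hη]; exact one_pos)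
  rw [normalize, smul_smul, mul_inv_cancel₀ h.ne', one_smul]

theorem l1_obsMat_mul_l1 (y : Fin d → ℝ) :
    l1 (obsMat c Λ v *ᵥ η) * l1 (normalize (obsMat c Λ v *ᵥ η) - y) =
      l1 (obsMat c Λ v *ᵥ η - l1 (obsMat c Λ v *ᵥ η) • y) := by
  have h := l1_smul (l1 (obsMat c Λ v *ᵥ η)) (normalize (obsMat c Λ v *ᵥ η) - y)
  rw [smul_sub, l1_obsMat_smul_normalize hΛ hη v, abs_of_nonneg (l1_nonneg _)] at h
  exact h.symm

include hH hσ hc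

theorem abs_l1_obsMat_sub_one_le :
    |l1 (obsMat c Λ v *ᵥ η) - 1| ≤ Real.exp (2 * envExp H v) / σ := by
  rw [l1_obsMat_mulVec_eq hΛ hη]
  exact abs_sum_mul_sub_one_le (mulVec_transpose_mem hΛ hη)
    fun k => abs_shiftDensity_sub_one_le hH hσ (hc k) v

theorem l1_obsMat_le : l1 (obsMat c Λ v *ᵥ η) ≤ Real.exp (envExp H v) := by
  have hp := mulVec_transpose_mem hΛ hη
  rw [l1_obsMat_mulVec_eq hΛ hη]
  calc _ ≤ ∑ k, Real.exp (envExp H v) * (Λᵀ *ᵥ η) k := Finset.sum_le_sum fun k _ =>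
        mul_le_mul_of_nonneg_right (shiftDensity_le hH hσ (hc k) v) (hp.1 k)
    _ = _ := by rw [← Finset.mul_sum, hp.2, mul_one]

theorem le_l1_obsMat : Real.exp (-envExp H v) ≤ l1 (obsMat c Λ v *ᵥ η) := by
  have hp := mulVec_transpose_mem hΛ hη
  rw [l1_obsMat_mulVec_eq hΛ hη]
  calc Real.exp (-envExp H v) = ∑ k, Real.exp (-envExp H v) * (Λᵀ *ᵥ η) k := by
        rw [← Finset.mul_sum, hp.2, mul_one]
    _ ≤ _ := Finset.sum_le_sum fun k _ =>
        mul_le_mul_of_nonneg_right (le_shiftDensity hH hσ (hc k) v) (hp.1 k)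

theorem l1_normalize_sub_le :
    l1 (normalize (obsMat c Λ v *ᵥ η) - Λᵀ *ᵥ η) ≤ 2 * Real.exp (3 * envExp H v) / σ := by
  have h1 : l1 (obsMat c Λ v *ᵥ η) * l1 (normalize (obsMat c Λ v *ᵥ η) - Λᵀ *ᵥ η) ≤
      2 * (Real.exp (2 * envExp H v) / σ) := by
    rw [l1_obsMat_mul_l1 hΛ hη, l1_obsMat_mulVec_eq hΛ hη, obsMat_mulVec_eq]
    exact l1_reweight_sub_le (mulVec_transpose_mem hΛ hη)
      fun k => abs_shiftDensity_sub_one_le hH hσ (hc k) v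
  have h2 := mul_le_mul_of_nonneg_right (le_l1_obsMat hΛ hH hσ hc hη v)
    (l1_nonneg (normalize (obsMat c Λ v *ᵥ η) - Λᵀ *ᵥ η))
  have h3 := mul_le_mul_of_nonneg_left (h2.trans h1) (Real.exp_nonneg (envExp H v))
  rw [← mul_assoc, ← Real.exp_add, add_neg_cancel, Real.exp_zero, one_mul] at h3
  refine h3.trans (le_of_eq ?_)
  have h4 : Real.exp (3 * envExp H v) = Real.exp (envExp H v) * Real.exp (2 * envExp H v) := by
    rw [← Real.exp_add]
    ring_nf
  rw [h4]
  ring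

theorem l1_mul_l1_normalize_sub_linear_le :
    l1 (obsMat c Λ v *ᵥ η) * l1 (normalize (obsMat c Λ v *ᵥ η) -
      (Λᵀ *ᵥ η + v • noiseVec (Λᵀ *ᵥ η) c)) ≤ 6 * Real.exp (3 * envExp H v) / σ ^ 2 := by
  have hσ0 : 0 < σ := by linarith
  rw [l1_obsMat_mul_l1 hΛ hη, l1_obsMat_mulVec_eq hΛ hη, obsMat_mulVec_eq]
  refine (l1_reweight_sub_linear_le (mulVec_transpose_mem hΛ hη)
    (fun k => abs_shiftDensity_sub_one_le hH hσ (hc k) v)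
    (fun k => abs_shiftDensity_sub_one_sub_le hH hσ (hc k) v) (T := Real.exp (envExp H v) / σ)
    fun k => ?_).trans (le_of_eq ?_)
  · rw [abs_mul]
    calc |c k| * |v| ≤ H / σ * |v| := mul_le_mul_of_nonneg_right (hc k) (abs_nonneg v)
      _ = H * |v| / σ := by ring
      _ ≤ Real.exp (envExp H v) / σ := by
        refine div_le_div_of_nonneg_right ((mul_abs_le_envExp hH v).trans ?_) hσ0.le
        linarith [Real.add_one_le_exp (envExp H v)]
  · have h4 : Real.exp (3 * envExp H v) = Real.exp (2 * envExp H v) * Real.exp (envExp H v) := by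
      rw [← Real.exp_add]
      ring_nf
    rw [h4]
    field_simp
    ring

end Step

section Moments
variable {d : ℕ} {Λ : Matrix (Fin d) (Fin d) ℝ}

theorem integrable_l1_obsMat (hΛ : Λ ∈ Matrix.rowStochastic ℝ (Fin d)) {H σ : ℝ} (hH : 0 ≤ H)
    (hσ : 1 ≤ σ) {c : Fin d → ℝ} (hc : ∀ i, |c i| ≤ H / σ) {η : Fin d → ℝ}
    (hη : η ∈ stdSimplex ℝ (Fin d)) :
    Integrable (fun v => l1 (obsMat c Λ v *ᵥ η)) (gaussianReal 0 1) := by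
  refine Integrable.mono' (by simpa using integrable_exp_envExp H 1)
    (measurable_l1.comp (measurable_obsMat_mulVec_const c Λ η)).aestronglyMeasurable
    (Eventually.of_forall fun v => ?_)
  rw [Real.norm_eq_abs, abs_of_nonneg (l1_nonneg _)]
  exact l1_obsMat_le hΛ hH hσ hc hη v

theorem integral_l1_obsMat (hΛ : Λ ∈ Matrix.rowStochastic ℝ (Fin d)) (c : Fin d → ℝ)
    {η : Fin d → ℝ} (hη : η ∈ stdSimplex ℝ (Fin d)) :
    ∫ v, l1 (obsMat c Λ v *ᵥ η) ∂(gaussianReal 0 1) = 1 := by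
  rw [integral_eq_lintegral_of_nonneg_ae (Eventually.of_forall fun v => l1_nonneg _)
    (measurable_l1.comp (measurable_obsMat_mulVec_const c Λ η)).aestronglyMeasurable,
    lintegral_l1_obsMat hΛ hη.1, l1_eq_one hη]
  simp

theorem abs_div_le_of_le {h : Fin d → ℝ} {H σ : ℝ} (hh : ∀ i, |h i| ≤ H) (hσ : 1 ≤ σ) (i : Fin d) :
    |h i / σ| ≤ H / σ := by
  rw [abs_div, abs_of_nonneg (by linarith : 0 ≤ σ)]
  exact div_le_div_of_nonneg_right (hh i) (by linarith)

theorem exists_moment_bound (hd : 0 < d) (hΛ : Λ ∈ Matrix.rowStochastic ℝ (Fin d))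
    {μ : Fin d → ℝ} (hμ : IsErgodic Λ μ) (h : Fin d → ℝ) (q : ℕ) :
    ∃ B : ℝ, 0 ≤ B ∧ ∀ σ : ℝ, 1 ≤ σ → ∀ M, IsInvariantFilterMeasure Λ h σ M →
      ∫ η, l1 (σ • (η - μ)) ^ q ∂M ≤ B := by
  obtain ⟨N, hN, hcon⟩ := hμ.exists_contraction
  have hN' : (1 : ℝ) ≤ N := by exact_mod_cast hN
  set r : ℝ := 1 - 1 / (2 * N) with hr
  have hr1 : 0 < 1 - r := by
    rw [hr]
    ring_nf
    positivity
  have hr0 : 0 ≤ r := by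
    have : 1 / (2 * (N : ℝ)) ≤ 1 := by
      rw [div_le_one (by positivity)]
      linarith
    linarith
  set H := l1 h
  have hH : 0 ≤ H := l1_nonneg h
  set A := 2 * N / (1 - r) with hA
  set B := ∫ v, A ^ q * Real.exp ((3 * q + 1 : ℝ) * envExp H v) ∂(gaussianReal 0 1) with hB
  have hA0 : 0 ≤ A := by positivity
  have hBint : Integrable (fun v => A ^ q * Real.exp ((3 * q + 1 : ℝ) * envExp H v))
      (gaussianReal 0 1) := (integrable_exp_envExp H _).const_mul _
  refine ⟨B, integral_nonneg fun v => by positivity, fun σ hσ M hM => ?_⟩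
  have hσ0 : 0 < σ := by linarith
  have hMp := hM.isProbabilityMeasure
  have hc := abs_div_le_of_le (abs_le_l1 h) hσ
  have hμΔ := hμ.mem_stdSimplex hd hΛ
  set W : (Fin d → ℝ) → ℝ := fun η => adaptedNorm Λ N (σ • (η - μ)) with hW
  have hWc : Continuous W := (continuous_adaptedNorm N).comp (by fun_prop)
  have hW0 : ∀ η, 0 ≤ W η := fun η => adaptedNorm_nonneg N _
  have hWq : Continuous fun η => W η ^ q := hWc.pow q
  obtain ⟨C, hC⟩ := (isCompact_stdSimplex ℝ (Fin d)).exists_bound_of_continuousOn hWq.continuousOn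
  have hWint : Integrable (fun η => W η ^ q) M :=
    integrable_of_simplex hM.simplex hWq.measurable hC
  have hstep : ∀ η ∈ stdSimplex ℝ (Fin d),
      ∫ x, W x ^ q ∂(simplexKernel Λ h σ η) ≤ r * W η ^ q + (1 - r) * B := by
    intro η hη
    rw [integral_simplexKernel hΛ h hσ0 hη hWq.stronglyMeasurable]
    set L : ℝ → ℝ := fun v => l1 (obsMat (fun i => h i / σ) Λ v *ᵥ η) with hL
    set X : ℝ → Fin d → ℝ := fun v => normalize (obsMat (fun i => h i / σ) Λ v *ᵥ η) with hX
    have hLint : Integrable L (gaussianReal 0 1) := integrable_l1_obsMat hΛ hH hσ hc hη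
    have hL1 : ∫ v, L v ∂(gaussianReal 0 1) = 1 := integral_l1_obsMat hΛ _ hη
    have hWX : ∀ v, W (X v) ≤ r * W η + (1 - r) * (A * Real.exp (3 * envExp H v)) := by
      intro v
      have h1 : σ • (X v - μ) = Λᵀ *ᵥ (σ • (η - μ)) + σ • (X v - Λᵀ *ᵥ η) := by
        rw [mulVec_smul, mulVec_sub, hμ.mulVec_eq hd, ← smul_add]
        congr 1
        abel
      have h2 : ∑ i, (σ • (η - μ)) i = 0 := by
        simp [← Finset.mul_sum, hη.2, hμΔ.2]
      have h3 := adaptedNorm_mulVec_le hΛ hN hcon h2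
      have h4 := adaptedNorm_le hΛ N (σ • (X v - Λᵀ *ᵥ η))
      have h5 : l1 (σ • (X v - Λᵀ *ᵥ η)) ≤ 2 * Real.exp (3 * envExp H v) := by
        rw [l1_smul, abs_of_pos hσ0]
        have := mul_le_mul_of_nonneg_left (l1_normalize_sub_le hΛ hH hσ hc hη v) hσ0.le
        rwa [mul_div_cancel₀ _ hσ0.ne'] at this
      have h6 : (1 - r) * (A * Real.exp (3 * envExp H v)) =
          N * (2 * Real.exp (3 * envExp H v)) := by
        rw [hA]
        field_simp
      have h7 := mul_le_mul_of_nonneg_left h5 (by positivity : (0 : ℝ) ≤ N)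
      calc W (X v) = adaptedNorm Λ N (Λᵀ *ᵥ (σ • (η - μ)) + σ • (X v - Λᵀ *ᵥ η)) := by
            rw [← h1]
        _ ≤ _ := adaptedNorm_add_le N _ _
        _ ≤ _ := by
          rw [h6]
          exact add_le_add h3 (h4.trans h7)
    have hWXq : ∀ v, W (X v) ^ q ≤ r * W η ^ q + (1 - r) * (A * Real.exp (3 * envExp H v)) ^ q := by
      intro v
      refine (pow_le_pow_left₀ (hW0 _) (hWX v) q).trans ?_
      exact (convexOn_pow q).2 (hW0 η) (Set.mem_Ici.2 (by positivity)) hr0 hr1.le (by ring)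
    have hmain : ∀ v, L v • W (X v) ^ q ≤ (r * W η ^ q) * L v + (1 - r) *
        (A ^ q * Real.exp ((3 * q + 1 : ℝ) * envExp H v)) := by
      intro v
      rw [smul_eq_mul]
      have h1 := mul_le_mul_of_nonneg_left (hWXq v) (l1_nonneg (obsMat (fun i => h i / σ) Λ v *ᵥ η))
      have h2 : L v * ((1 - r) * (A * Real.exp (3 * envExp H v)) ^ q) ≤ Real.exp (envExp H v) *
          ((1 - r) * (A * Real.exp (3 * envExp H v)) ^ q) :=
        mul_le_mul_of_nonneg_right (l1_obsMat_le hΛ hH hσ hc hη v) (by positivity)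
      have h3 : Real.exp ((3 * q + 1 : ℝ) * envExp H v) =
          Real.exp (envExp H v) * Real.exp (3 * envExp H v) ^ q := by
        rw [← Real.exp_nat_mul, ← Real.exp_add]
        ring_nf
      rw [h3]
      rw [mul_pow] at h2 h1
      calc L v * W (X v) ^ q ≤ _ := h1
        _ = (r * W η ^ q) * L v + L v * ((1 - r) * (A ^ q * Real.exp (3 * envExp H v) ^ q)) := by
          simp only [hL]
          ring
        _ ≤ _ := by
          refine (add_le_add_right h2 _).trans (le_of_eq ?_)
          ring
    have hi1 : Integrable (fun v => (r * W η ^ q) * L v) (gaussianReal 0 1) := hLint.const_mul _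
    have hi2 : Integrable (fun v => (1 - r) * (A ^ q * Real.exp ((3 * q + 1 : ℝ) * envExp H v)))
      (gaussianReal 0 1) := hBint.const_mul _
    calc ∫ v, L v • W (X v) ^ q ∂(gaussianReal 0 1) ≤
        ∫ v, ((r * W η ^ q) * L v + (1 - r) *
          (A ^ q * Real.exp ((3 * q + 1 : ℝ) * envExp H v))) ∂(gaussianReal 0 1) := by
          refine integral_mono_of_nonneg (Eventually.of_forall fun v => ?_) (hi1.add hi2)
            (Eventually.of_forall hmain)
          exact smul_nonneg (l1_nonneg _) (pow_nonneg (hW0 _) q)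
      _ = _ := by
        rw [integral_add hi1 hi2, integral_const_mul, integral_const_mul, hL1, mul_one]
  have hinv : ∫ η, W η ^ q ∂M = ∫ η, ∫ x, W x ^ q ∂(simplexKernel Λ h σ η) ∂M := by
    have h1 := hM.bind_eq
    conv_lhs => rw [← h1]
    exact integral_measure_bind (by rwa [h1])
  have hle : ∫ η, W η ^ q ∂M ≤ r * ∫ η, W η ^ q ∂M + (1 - r) * B := by
    calc _ = _ := hinv
      _ ≤ ∫ η, (r * W η ^ q + (1 - r) * B) ∂M := by
        refine integral_mono_of_nonneg (Eventually.of_forall fun η => integral_nonneg fun x =>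
          pow_nonneg (hW0 x) q) ((hWint.const_mul r).add (integrable_const _)) ?_
        exact hM.simplex.mono fun η hη => hstep η hη
      _ = _ := by
        rw [integral_add (hWint.const_mul r) (integrable_const _), integral_const_mul]
        simp
  have hfin : ∫ η, W η ^ q ∂M ≤ B := by nlinarith
  refine le_trans (integral_mono_of_nonneg (Eventually.of_forall fun η => pow_nonneg (l1_nonneg _) q)
    hWint (Eventually.of_forall fun η => ?_)) hfin
  exact pow_le_pow_left₀ (l1_nonneg _) (l1_le_adaptedNorm hN _) q

end Moments

section CharFun
variable {d : ℕ} {Λ : Matrix (Fin d) (Fin d) ℝ}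

/-- The unit complex number with argument `x`. -/
def cis (x : ℝ) : ℂ := Complex.exp (x * Complex.I)

theorem norm_cis (x : ℝ) : ‖cis x‖ = 1 := Complex.norm_exp_ofReal_mul_I x

theorem continuous_cis : Continuous cis := by
  unfold cis
  fun_prop

theorem norm_cis_sub_le (x y : ℝ) : ‖cis x - cis y‖ ≤ |x - y| := by
  have h1 : cis x - cis y = cis y * (Complex.exp (Complex.I * ((x - y : ℝ) : ℂ)) - 1) := by
    unfold cis
    rw [mul_sub, ← Complex.exp_add, mul_one]
    congr 2
    push_cast
    ring
  rw [h1, norm_mul, norm_cis, one_mul]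
  exact Real.norm_exp_I_mul_ofReal_sub_one_le

theorem integral_cis_gaussian (a b : ℝ) :
    ∫ v, cis (a + v * b) ∂(gaussianReal 0 1) = cis a * (Real.exp (-b ^ 2 / 2) : ℝ) := by
  have h1 : ∀ v : ℝ, cis (a + v * b) = cis a * Complex.exp (b * v * Complex.I) := by
    intro v
    unfold cis
    rw [← Complex.exp_add]
    congr 1
    push_cast
    ring
  simp only [h1]
  rw [integral_const_mul]
  have h2 := charFun_gaussianReal (μ := 0) (v := 1) b
  rw [charFun_apply_real] at h2
  rw [h2]
  congr 1
  push_cast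
  congr 1
  simp
  ring

theorem noiseVec_smul_right (p : Fin d → ℝ) (a : ℝ) (h : Fin d → ℝ) :
    noiseVec p (a • h) = a • noiseVec p h := by
  rw [noiseVec, mulVec_smul, noiseVec]

theorem l1_noiseVec_sub_le {p μ h : Fin d → ℝ} {H : ℝ} (hp : p ∈ stdSimplex ℝ (Fin d))
    (hμ : μ ∈ stdSimplex ℝ (Fin d)) (hh : ∀ i, |h i| ≤ H) :
    l1 (noiseVec p h - noiseVec μ h) ≤ 3 * H * l1 (p - μ) := by
  have hph : |p ⬝ᵥ h| ≤ H := by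
    rw [dotProduct_comm]
    simpa [l1_eq_one hp] using abs_dotProduct_le_l1 h p hh
  have hdh : |(p - μ) ⬝ᵥ h| ≤ H * l1 (p - μ) := by
    rw [dotProduct_comm]
    exact abs_dotProduct_le_l1 h _ hh
  calc _ ≤ ∑ i, (2 * H * |(p - μ) i| + H * l1 (p - μ) * μ i) := by
        refine Finset.sum_le_sum fun i _ => ?_
        have h1 : (noiseVec p h - noiseVec μ h) i =
            (h i - p ⬝ᵥ h) * (p - μ) i - μ i * ((p - μ) ⬝ᵥ h) := by
          simp only [Pi.sub_apply, noiseVec_apply, sub_dotProduct]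
          ring
        rw [h1]
        refine (abs_sub _ _).trans (add_le_add ?_ ?_)
        · rw [abs_mul]
          refine mul_le_mul_of_nonneg_right ?_ (abs_nonneg _)
          linarith [abs_sub (h i) (p ⬝ᵥ h), hh i]
        · rw [abs_mul, abs_of_nonneg (hμ.1 i), mul_comm]
          exact mul_le_mul_of_nonneg_right hdh (hμ.1 i)
    _ = _ := by
        rw [Finset.sum_add_distrib, ← Finset.mul_sum, ← Finset.mul_sum, hμ.2, l1]
        ring

theorem norm_kernel_charFun_sub_le (hd : 0 < d) (hΛ : Λ ∈ Matrix.rowStochastic ℝ (Fin d))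
    {μ : Fin d → ℝ} (hμ : IsErgodic Λ μ) {h : Fin d → ℝ} {H : ℝ} (hH : 0 ≤ H)
    (hh : ∀ i, |h i| ≤ H) {T : ℝ} (hT : 0 ≤ T) {σ : ℝ} (hσ : 1 ≤ σ) {t : Fin d → ℝ}
    (ht : ∀ i, |t i| ≤ T) {η : Fin d → ℝ} (hη : η ∈ stdSimplex ℝ (Fin d)) :
    ‖∫ x, cis (t ⬝ᵥ (σ • (x - μ))) ∂(simplexKernel Λ h σ η) -
      cis ((Λ *ᵥ t) ⬝ᵥ (σ • (η - μ))) * (Real.exp (-(t ⬝ᵥ noiseVec μ h) ^ 2 / 2) : ℝ)‖ ≤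
      (6 * T + 1 + 3 * H * T * l1 (σ • (η - μ))) / σ *
        ∫ v, Real.exp (3 * envExp H v) ∂(gaussianReal 0 1) := by
  have hσ0 : 0 < σ := by linarith
  have hc := abs_div_le_of_le hh hσ
  have hμΔ := hμ.mem_stdSimplex hd hΛ
  have hp := mulVec_transpose_mem hΛ hη
  have hf : Continuous fun x : Fin d → ℝ => cis (t ⬝ᵥ (σ • (x - μ))) :=
    continuous_cis.comp (continuous_const.dotProduct (by fun_prop))
  rw [integral_simplexKernel hΛ h hσ0 hη hf.stronglyMeasurable, ← integral_cis_gaussian]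
  have hLint := integrable_l1_obsMat hΛ hH hσ hc hη
  have hm : Measurable fun v => normalize (obsMat (fun i => h i / σ) Λ v *ᵥ η) :=
    measurable_normalize.comp (measurable_obsMat_mulVec_const _ Λ η)
  have hpt : ∀ v, ‖l1 (obsMat (fun i => h i / σ) Λ v *ᵥ η) •
      cis (t ⬝ᵥ (σ • (normalize (obsMat (fun i => h i / σ) Λ v *ᵥ η) - μ))) -
      cis ((Λ *ᵥ t) ⬝ᵥ (σ • (η - μ)) + v * (t ⬝ᵥ noiseVec μ h))‖ ≤
      (6 * T + 1 + 3 * H * T * l1 (σ • (η - μ))) / σ * Real.exp (3 * envExp H v) := by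
    intro v
    have e1 := l1_mul_l1_normalize_sub_linear_le hΛ hH hσ hc hη v
    have e2 := abs_l1_obsMat_sub_one_le hΛ hH hσ hc hη v
    set L := l1 (obsMat (fun i => h i / σ) Λ v *ᵥ η) with hL
    set X := normalize (obsMat (fun i => h i / σ) Λ v *ᵥ η) with hX
    set p := Λᵀ *ᵥ η with hp'
    have hL0 : 0 ≤ L := l1_nonneg _
    set α := t ⬝ᵥ (σ • (X - μ)) with hα
    set a := (Λ *ᵥ t) ⬝ᵥ (σ • (η - μ)) with ha
    set α₂ := a + v * (t ⬝ᵥ noiseVec p h) with hα₂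
    have hx0 := envExp_nonneg hH v
    have ha' : a = t ⬝ᵥ (σ • (p - μ)) := by
      rw [ha, hp', ← vecMul_transpose, ← dotProduct_mulVec, mulVec_smul, mulVec_sub,
        hμ.mulVec_eq hd]
    have hnc : noiseVec p (fun i => h i / σ) = σ⁻¹ • noiseVec p h := by
      rw [← noiseVec_smul_right]
      congr 1
      ext i
      simp [div_eq_inv_mul]
    have h1 : α - α₂ = t ⬝ᵥ (σ • (X - (p + v • noiseVec p fun i => h i / σ))) := by
      rw [hα, hα₂, ha', hnc]
      simp only [dotProduct_smul, dotProduct_sub, dotProduct_add, smul_eq_mul]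
      field_simp
      ring
    have b1 : L * |α - α₂| ≤ 6 * T * Real.exp (3 * envExp H v) / σ := by
      have h2 := abs_dotProduct_le_l1 t (σ • (X - (p + v • noiseVec p fun i => h i / σ))) ht
      rw [← h1, l1_smul, abs_of_pos hσ0] at h2
      have h3 := mul_le_mul_of_nonneg_left h2 hL0
      have h4 := mul_le_mul_of_nonneg_left e1 (by positivity : 0 ≤ T * σ)
      calc L * |α - α₂| ≤ _ := h3
        _ = T * σ * (L * l1 (X - (p + v • noiseVec p fun i => h i / σ))) := by ring
        _ ≤ _ := h4
        _ = _ := by field_simp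
    have b2 : |L - 1| ≤ Real.exp (3 * envExp H v) / σ :=
      e2.trans (div_le_div_of_nonneg_right (Real.exp_le_exp.2 (by linarith)) hσ0.le)
    have b3 : |v * (t ⬝ᵥ noiseVec p h) - v * (t ⬝ᵥ noiseVec μ h)| ≤
        3 * H * T * l1 (σ • (η - μ)) * Real.exp (3 * envExp H v) / σ := by
      rw [← mul_sub, ← dotProduct_sub, abs_mul]
      have h2 := abs_dotProduct_le_l1 t (noiseVec p h - noiseVec μ h) ht
      have h3 := l1_noiseVec_sub_le hp hμΔ hh
      have h4 : l1 (p - μ) ≤ l1 (σ • (η - μ)) / σ := by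
        rw [l1_smul, abs_of_pos hσ0, mul_div_cancel_left₀ _ hσ0.ne']
        have := l1_mulVec_transpose_le hΛ (η - μ)
        rwa [mulVec_sub, hμ.mulVec_eq hd] at this
      have h5 : |v| ≤ Real.exp (3 * envExp H v) := by
        refine (abs_le_envExp hH v).trans ?_
        linarith [Real.add_one_le_exp (3 * envExp H v)]
      have h6 : |t ⬝ᵥ (noiseVec p h - noiseVec μ h)| ≤
          T * (3 * H * (l1 (σ • (η - μ)) / σ)) :=
        h2.trans (mul_le_mul_of_nonneg_left (h3.trans
          (mul_le_mul_of_nonneg_left h4 (by positivity))) hT)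
      calc _ ≤ Real.exp (3 * envExp H v) * (T * (3 * H * (l1 (σ • (η - μ)) / σ))) :=
            mul_le_mul h5 h6 (abs_nonneg _) (Real.exp_nonneg _)
        _ = _ := by ring
    have hsplit : L • cis α - cis (a + v * (t ⬝ᵥ noiseVec μ h)) = L • (cis α - cis α₂) +
        (L - 1) • cis α₂ + (cis α₂ - cis (a + v * (t ⬝ᵥ noiseVec μ h))) := by
      rw [smul_sub, sub_smul, one_smul]
      abel
    rw [hsplit]
    have n1 : ‖L • (cis α - cis α₂)‖ ≤ L * |α - α₂| := by
      rw [norm_smul, Real.norm_eq_abs, abs_of_nonneg hL0]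
      exact mul_le_mul_of_nonneg_left (norm_cis_sub_le _ _) hL0
    have n2 : ‖(L - 1) • cis α₂‖ = |L - 1| := by
      rw [norm_smul, norm_cis, mul_one, Real.norm_eq_abs]
    have n3 : ‖cis α₂ - cis (a + v * (t ⬝ᵥ noiseVec μ h))‖ ≤
        |v * (t ⬝ᵥ noiseVec p h) - v * (t ⬝ᵥ noiseVec μ h)| := by
      refine (norm_cis_sub_le _ _).trans (le_of_eq ?_)
      rw [hα₂, add_sub_add_left_eq_sub]
    calc _ ≤ L * |α - α₂| + |L - 1| + |v * (t ⬝ᵥ noiseVec p h) - v * (t ⬝ᵥ noiseVec μ h)| := by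
          refine (norm_add_le _ _).trans (add_le_add ?_ n3)
          refine (norm_add_le _ _).trans (add_le_add n1 n2.le)
      _ ≤ _ := add_le_add (add_le_add b1 b2) b3
      _ = _ := by ring
  have hi1 : Integrable (fun v => l1 (obsMat (fun i => h i / σ) Λ v *ᵥ η) •
      cis (t ⬝ᵥ (σ • (normalize (obsMat (fun i => h i / σ) Λ v *ᵥ η) - μ)))) (gaussianReal 0 1) := by
    refine hLint.mono (hLint.aestronglyMeasurable.smul
      (hf.measurable.comp hm).aestronglyMeasurable) (Eventually.of_forall fun v => ?_)
    rw [norm_smul, norm_cis, mul_one]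
  have hi2 : Integrable (fun v : ℝ => cis ((Λ *ᵥ t) ⬝ᵥ (σ • (η - μ)) + v * (t ⬝ᵥ noiseVec μ h)))
      (gaussianReal 0 1) := by
    have hcont : Continuous fun v : ℝ =>
        cis ((Λ *ᵥ t) ⬝ᵥ (σ • (η - μ)) + v * (t ⬝ᵥ noiseVec μ h)) :=
      continuous_cis.comp (by fun_prop)
    exact Integrable.of_bound hcont.aestronglyMeasurable 1
      (Eventually.of_forall fun v => (norm_cis _).le)
  rw [← integral_sub hi1 hi2, ← integral_const_mul]
  exact norm_integral_le_of_norm_le ((integrable_exp_envExp H 3).const_mul _)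
    (Eventually.of_forall hpt)

theorem exists_charFun_step (hd : 0 < d) (hΛ : Λ ∈ Matrix.rowStochastic ℝ (Fin d))
    {μ : Fin d → ℝ} (hμ : IsErgodic Λ μ) (h : Fin d → ℝ) {T : ℝ} (hT : 0 ≤ T) :
    ∃ C : ℝ, 0 ≤ C ∧ ∀ σ : ℝ, 1 ≤ σ → ∀ M, IsInvariantFilterMeasure Λ h σ M →
      ∀ t : Fin d → ℝ, (∀ i, |t i| ≤ T) →
      ‖∫ η, cis (t ⬝ᵥ (σ • (η - μ))) ∂M - (∫ η, cis ((Λ *ᵥ t) ⬝ᵥ (σ • (η - μ))) ∂M) *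
        (Real.exp (-(t ⬝ᵥ noiseVec μ h) ^ 2 / 2) : ℝ)‖ ≤ C / σ := by
  obtain ⟨m, hm0, hm⟩ := exists_moment_bound hd hΛ hμ h 1
  have hH := l1_nonneg h
  set E := ∫ v, Real.exp (3 * envExp (l1 h) v) ∂(gaussianReal 0 1) with hE
  have hE0 : 0 ≤ E := integral_nonneg fun v => Real.exp_nonneg _
  refine ⟨(6 * T + 1 + 3 * l1 h * T * m) * E, by positivity, fun σ hσ M hM t ht => ?_⟩
  have hσ0 : 0 < σ := by linarith
  have hMp := hM.isProbabilityMeasure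
  have hcis : ∀ s : Fin d → ℝ, Continuous fun η : Fin d → ℝ => cis (s ⬝ᵥ (σ • (η - μ))) :=
    fun s => continuous_cis.comp (continuous_const.dotProduct (by fun_prop))
  have hint : ∀ s : Fin d → ℝ, Integrable (fun η : Fin d → ℝ => cis (s ⬝ᵥ (σ • (η - μ)))) M :=
    fun s => Integrable.of_bound (hcis s).aestronglyMeasurable 1
      (Eventually.of_forall fun η => (norm_cis _).le)
  have hinv : ∫ η, cis (t ⬝ᵥ (σ • (η - μ))) ∂M =
      ∫ η, ∫ x, cis (t ⬝ᵥ (σ • (x - μ))) ∂(simplexKernel Λ h σ η) ∂M := by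
    have h1 := hM.bind_eq
    conv_lhs => rw [← h1]
    exact integral_measure_bind (by rw [h1]; exact hint t)
  have hker : Integrable (fun η => ∫ x, cis (t ⬝ᵥ (σ • (x - μ))) ∂(simplexKernel Λ h σ η)) M := by
    have hκ := isMarkovKernel_simplexKernel hΛ h hσ0
    refine Integrable.of_bound
      (hcis t).stronglyMeasurable.integral_kernel.aestronglyMeasurable 1
      (Eventually.of_forall fun η => ?_)
    refine (norm_integral_le_of_norm_le (integrable_const 1)
      (Eventually.of_forall fun x => (norm_cis _).le)).trans ?_
    simp
  have hc1 : Continuous fun η : Fin d → ℝ => l1 (σ • (η - μ)) :=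
    continuous_l1.comp (by fun_prop)
  obtain ⟨K, hK⟩ := (isCompact_stdSimplex ℝ (Fin d)).exists_bound_of_continuousOn hc1.continuousOn
  have hl1 : Integrable (fun η => l1 (σ • (η - μ))) M :=
    integrable_of_simplex hM.simplex hc1.measurable hK
  rw [hinv, ← integral_mul_const, ← integral_sub hker ((hint _).mul_const _)]
  have hbint : Integrable (fun η => (6 * T + 1 + 3 * l1 h * T * l1 (σ • (η - μ))) / σ * E) M :=
    (((integrable_const _).add (hl1.const_mul _)).div_const σ).mul_const E
  refine (norm_integral_le_of_norm_le hbint (hM.simplex.mono fun η hη =>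
    norm_kernel_charFun_sub_le hd hΛ hμ hH (abs_le_l1 h) hT hσ ht hη)).trans ?_
  rw [integral_mul_const, integral_div, integral_add (integrable_const _) (hl1.const_mul _),
    integral_const_mul, integral_const, div_mul_eq_mul_div]
  have hm1 := hm σ hσ M hM
  simp only [pow_one] at hm1
  simp only [probReal_univ, one_smul]
  have h0 : 0 ≤ 3 * l1 h * T := by positivity
  gcongr

end CharFun

section CharFunLimit
variable {d : ℕ} {Λ : Matrix (Fin d) (Fin d) ℝ}

theorem abs_mulVec_le (hΛ : Λ ∈ Matrix.rowStochastic ℝ (Fin d)) {t : Fin d → ℝ} {T : ℝ}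
    (ht : ∀ i, |t i| ≤ T) (i : Fin d) : |(Λ *ᵥ t) i| ≤ T := by
  have h1 : (Λ *ᵥ t) i = t ⬝ᵥ fun j => Λ i j := by
    rw [dotProduct_comm]
    rfl
  have h2 : l1 (fun j => Λ i j) = 1 :=
    l1_eq_one ⟨fun j => hΛ.1 i j, sum_row_of_mem_rowStochastic hΛ i⟩
  rw [h1]
  simpa [h2] using abs_dotProduct_le_l1 t (fun j => Λ i j) ht

/-- The characteristic function of the Gaussian law with covariance matrix `P`. -/
def gaussChar (P : Matrix (Fin d) (Fin d) ℝ) (t : Fin d → ℝ) : ℝ :=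
  Real.exp (-(t ⬝ᵥ P *ᵥ t) / 2)

theorem IsLyapunovSolution.gaussChar_eq {P : Matrix (Fin d) (Fin d) ℝ} {μ h : Fin d → ℝ}
    (hP : IsLyapunovSolution Λ μ h 1 P) (t : Fin d → ℝ) :
    gaussChar P t = gaussChar P (Λ *ᵥ t) * Real.exp (-(t ⬝ᵥ noiseVec μ h) ^ 2 / 2) := by
  unfold gaussChar
  rw [← Real.exp_add, hP.quadratic_form t]
  congr 1
  ring

theorem tendsto_gaussChar_pow {μ : Fin d → ℝ} (hμ : IsErgodic Λ μ)
    {P : Matrix (Fin d) (Fin d) ℝ} (hP : P *ᵥ 1 = 0) (t : Fin d → ℝ) :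
    Tendsto (fun n : ℕ => gaussChar P (Λ ^ n *ᵥ t)) atTop (𝓝 1) := by
  have h1 : Tendsto (fun n : ℕ => Λ ^ n *ᵥ t) atTop (𝓝 ((μ ⬝ᵥ t) • (1 : Fin d → ℝ))) := by
    refine tendsto_pi_nhds.2 fun i => ?_
    have h2 : Tendsto (fun n : ℕ => ∑ j, (Λ ^ n) i j * t j) atTop (𝓝 (∑ j, μ j * t j)) :=
      tendsto_finsetSum _ fun j _ => (hμ.tendsto_pow i j).mul_const _
    simpa [mulVec, dotProduct] using h2
  have hc : Continuous (gaussChar P) := by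
    unfold gaussChar
    exact Real.continuous_exp.comp (by fun_prop)
  have h3 := (hc.tendsto ((μ ⬝ᵥ t) • (1 : Fin d → ℝ))).comp h1
  have h4 : gaussChar P ((μ ⬝ᵥ t) • (1 : Fin d → ℝ)) = 1 := by
    simp [gaussChar, mulVec_smul, hP]
  rwa [h4] at h3

theorem tendsto_integral_cis (hd : 0 < d) (hΛ : Λ ∈ Matrix.rowStochastic ℝ (Fin d))
    {μ : Fin d → ℝ} (hμ : IsErgodic Λ μ) (h : Fin d → ℝ) {P : Matrix (Fin d) (Fin d) ℝ}
    (hP : IsLyapunovSolution Λ μ h 1 P) (hP1 : P *ᵥ 1 = 0) {M : ℝ → Measure (Fin d → ℝ)}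
    (hM : ∀ σ : ℝ, 0 < σ → IsInvariantFilterMeasure Λ h σ (M σ)) (t : Fin d → ℝ) :
    Tendsto (fun σ : ℝ => ∫ η, cis (t ⬝ᵥ (σ • (η - μ))) ∂(M σ)) atTop (𝓝 (gaussChar P t : ℂ)) := by
  obtain ⟨C, hC0, hC⟩ := exists_charFun_step hd hΛ hμ h (norm_nonneg t)
  obtain ⟨m, hm0, hm⟩ := exists_moment_bound hd hΛ hμ h 1
  obtain ⟨K, ρ, hρ0, hρ1, hK⟩ := hμ.exists_geometric hΛ
  have hμΔ := hμ.mem_stdSimplex hd hΛ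
  have hiter : ∀ σ : ℝ, 1 ≤ σ → ∀ (n : ℕ) (s : Fin d → ℝ), (∀ i, |s i| ≤ ‖t‖) →
      ‖∫ η, cis (s ⬝ᵥ (σ • (η - μ))) ∂(M σ) - gaussChar P s‖ ≤
      ‖∫ η, cis ((Λ ^ n *ᵥ s) ⬝ᵥ (σ • (η - μ))) ∂(M σ) - gaussChar P (Λ ^ n *ᵥ s)‖ +
        n * (C / σ) := by
    intro σ hσ n
    induction n with
    | zero =>
      intro s _
      simp
    | succ n ih =>
      intro s hs
      have h1 := ih (Λ *ᵥ s) (abs_mulVec_le hΛ hs)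
      have h2 := hC σ hσ (M σ) (hM σ (by linarith)) s hs
      rw [mulVec_mulVec, ← pow_succ] at h1
      set a := ∫ η, cis (s ⬝ᵥ (σ • (η - μ))) ∂(M σ)
      set b := ∫ η, cis ((Λ *ᵥ s) ⬝ᵥ (σ • (η - μ))) ∂(M σ)
      set g := Real.exp (-(s ⬝ᵥ noiseVec μ h) ^ 2 / 2)
      have hg : |g| ≤ 1 := by
        rw [abs_of_nonneg (Real.exp_nonneg _)]
        exact Real.exp_le_one_iff.2 (by nlinarith [sq_nonneg (s ⬝ᵥ noiseVec μ h)])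
      have h3 : a - (gaussChar P s : ℂ) = (a - b * g) + (b - gaussChar P (Λ *ᵥ s)) * g := by
        rw [hP.gaussChar_eq s, Complex.ofReal_mul]
        ring
      have h4 : ‖(b - gaussChar P (Λ *ᵥ s)) * (g : ℂ)‖ ≤ ‖b - gaussChar P (Λ *ᵥ s)‖ := by
        rw [norm_mul, Complex.norm_real]
        exact mul_le_of_le_one_right (norm_nonneg _) hg
      rw [h3]
      refine (norm_add_le _ _).trans ?_
      push_cast
      linarith
  have hone : ∀ σ : ℝ, 1 ≤ σ → ∀ n : ℕ,
      ‖∫ η, cis ((Λ ^ n *ᵥ t) ⬝ᵥ (σ • (η - μ))) ∂(M σ) - 1‖ ≤ ‖t‖ * (|K| * ρ ^ n) * m := by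
    intro σ hσ n
    have hMσ := hM σ (by linarith)
    have hMp := hMσ.isProbabilityMeasure
    have hcis : Continuous fun η : Fin d → ℝ => cis ((Λ ^ n *ᵥ t) ⬝ᵥ (σ • (η - μ))) :=
      continuous_cis.comp (continuous_const.dotProduct (by fun_prop))
    have hint : Integrable (fun η : Fin d → ℝ => cis ((Λ ^ n *ᵥ t) ⬝ᵥ (σ • (η - μ)))) (M σ) :=
      Integrable.of_bound hcis.aestronglyMeasurable 1
        (Eventually.of_forall fun η => (norm_cis _).le)
    have hc1 : Continuous fun η : Fin d → ℝ => l1 (σ • (η - μ)) :=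
      continuous_l1.comp (by fun_prop)
    obtain ⟨K', hK'⟩ :=
      (isCompact_stdSimplex ℝ (Fin d)).exists_bound_of_continuousOn hc1.continuousOn
    have hl1 : Integrable (fun η => l1 (σ • (η - μ))) (M σ) :=
      integrable_of_simplex hMσ.simplex hc1.measurable hK'
    have h1 : (∫ η, cis ((Λ ^ n *ᵥ t) ⬝ᵥ (σ • (η - μ))) ∂(M σ)) - 1 =
        ∫ η, (cis ((Λ ^ n *ᵥ t) ⬝ᵥ (σ • (η - μ))) - 1) ∂(M σ) := by
      rw [integral_sub hint (integrable_const _)]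
      simp
    rw [h1]
    have hbound : ∀ᵐ η ∂(M σ), ‖cis ((Λ ^ n *ᵥ t) ⬝ᵥ (σ • (η - μ))) - 1‖ ≤
        ‖t‖ * (|K| * ρ ^ n) * l1 (σ • (η - μ)) := by
      filter_upwards [hMσ.simplex] with η hη
      have h2 : cis 0 = 1 := by simp [cis]
      have h3 : (Λ ^ n *ᵥ t) ⬝ᵥ (σ • (η - μ)) = t ⬝ᵥ (Λᵀ ^ n *ᵥ (σ • (η - μ))) := by
        rw [← transpose_pow, dotProduct_mulVec, vecMul_transpose]
      have h4 : l1 (Λᵀ ^ n *ᵥ (σ • (η - μ))) ≤ |K| * ρ ^ n * l1 (σ • (η - μ)) := by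
        refine (hK (σ • (η - μ)) (by simp [← Finset.mul_sum, hη.2, hμΔ.2]) n).trans ?_
        exact mul_le_mul_of_nonneg_right (mul_le_mul_of_nonneg_right (le_abs_self K)
          (pow_nonneg hρ0 n)) (l1_nonneg _)
      have h5 := norm_cis_sub_le ((Λ ^ n *ᵥ t) ⬝ᵥ (σ • (η - μ))) 0
      rw [h2, sub_zero, h3] at h5
      rw [h3]
      refine h5.trans ((abs_dotProduct_le_l1 t _ fun i => norm_le_pi_norm t i).trans ?_)
      rw [mul_assoc]
      exact mul_le_mul_of_nonneg_left h4 (norm_nonneg t)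
    refine (norm_integral_le_of_norm_le (hl1.const_mul _) hbound).trans ?_
    rw [integral_const_mul]
    have := hm σ hσ (M σ) hMσ
    simp only [pow_one] at this
    exact mul_le_mul_of_nonneg_left this (by positivity)
  rw [Metric.tendsto_atTop]
  intro ε hε
  have hlim1 : Tendsto (fun n : ℕ => ‖t‖ * (|K| * ρ ^ n) * m) atTop (𝓝 0) := by
    have := ((tendsto_pow_atTop_nhds_zero_of_lt_one hρ0 hρ1).const_mul (‖t‖ * |K| * m))
    rw [mul_zero] at this
    exact this.congr fun n => by ring
  have hlim2 := tendsto_gaussChar_pow hμ hP1 t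
  obtain ⟨n, hn1, hn2⟩ := ((hlim1.eventually_lt_const (by positivity : (0 : ℝ) < ε / 3)).and
    (Metric.tendsto_nhds.1 hlim2 (ε / 3) (by positivity))).exists
  refine ⟨max 1 (3 * (n * C + 1) / ε), fun σ hσ => ?_⟩
  have hσ1 : 1 ≤ σ := (le_max_left _ _).trans hσ
  have hσ2 : 3 * (n * C + 1) / ε ≤ σ := (le_max_right _ _).trans hσ
  have hσ0 : 0 < σ := by linarith
  have hnC : n * (C / σ) < ε / 3 := by
    rw [← mul_div_assoc, div_lt_iff₀ hσ0]
    rw [div_le_iff₀ hε] at hσ2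
    linarith
  have h1 := hiter σ hσ1 n t fun i => norm_le_pi_norm t i
  have h2 := hone σ hσ1 n
  rw [dist_eq_norm]
  rw [Real.dist_eq] at hn2
  have h3 : ‖(∫ η, cis ((Λ ^ n *ᵥ t) ⬝ᵥ (σ • (η - μ))) ∂(M σ)) - gaussChar P (Λ ^ n *ᵥ t)‖ ≤
      ‖(∫ η, cis ((Λ ^ n *ᵥ t) ⬝ᵥ (σ • (η - μ))) ∂(M σ)) - 1‖ +
        |gaussChar P (Λ ^ n *ᵥ t) - 1| := by
    have h4 : ‖((gaussChar P (Λ ^ n *ᵥ t) - 1 : ℝ) : ℂ)‖ = |gaussChar P (Λ ^ n *ᵥ t) - 1| := by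
      rw [Complex.norm_real, Real.norm_eq_abs]
    rw [← h4]
    refine le_trans (le_of_eq ?_) (norm_sub_le _ _)
    push_cast
    congr 1
    ring
  linarith

end CharFunLimit

section WeakConvergence

theorem abs_sub_clip_le {R : ℝ} (hR : 0 < R) (x : ℝ) : |x - max (-R) (min R x)| ≤ x ^ 2 / R := by
  rw [le_div_iff₀ hR]
  rcases le_total x R with h1 | h1
  · rw [min_eq_right h1]
    rcases le_total (-R) x with h2 | h2
    · rw [max_eq_right h2]
      simpa using sq_nonneg x
    · rw [max_eq_left h2, abs_of_nonpos (by linarith)]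
      nlinarith
  · rw [min_eq_left h1, max_eq_right (by linarith), abs_of_nonneg (by linarith)]
    nlinarith

theorem tendsto_integral_of_sq_bounded {E : Type*} [TopologicalSpace E] [MeasurableSpace E]
    [OpensMeasurableSpace E] {Q : ℝ → Measure E} {Q₀ : Measure E}
    [IsProbabilityMeasure Q₀] (hQ : ∀ σ, 1 ≤ σ → IsProbabilityMeasure (Q σ))
    (hw : ∀ f : BoundedContinuousFunction E ℝ,
      Tendsto (fun σ => ∫ x, f x ∂(Q σ)) atTop (𝓝 (∫ x, f x ∂Q₀)))
    {G : E → ℝ} (hG : Continuous G) {B : ℝ}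
    (hB : ∀ σ, 1 ≤ σ → Integrable (fun x => G x ^ 2) (Q σ) ∧ ∫ x, G x ^ 2 ∂(Q σ) ≤ B)
    (h₀ : Integrable (fun x => G x ^ 2) Q₀) :
    Tendsto (fun σ => ∫ x, G x ∂(Q σ)) atTop (𝓝 (∫ x, G x ∂Q₀)) := by
  set B' := max B (∫ x, G x ^ 2 ∂Q₀) with hB'
  have hB'0 : 0 ≤ B' := (integral_nonneg fun x => sq_nonneg _).trans (le_max_right _ _)
  have key : ∀ (R : ℝ), 0 < R → ∀ (M : Measure E), IsProbabilityMeasure M →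
      Integrable (fun x => G x ^ 2) M → ∫ x, G x ^ 2 ∂M ≤ B' →
      |∫ x, G x ∂M - ∫ x, max (-R) (min R (G x)) ∂M| ≤ B' / R := by
    intro R hR M _ hM2 hMB
    have hGi : Integrable G M := by
      refine ((integrable_const (1 : ℝ)).add hM2).mono' hG.measurable.aestronglyMeasurable
        (Eventually.of_forall fun x => ?_)
      rw [Real.norm_eq_abs, Pi.add_apply, abs_le]
      constructor <;> nlinarith [sq_nonneg (G x - 1), sq_nonneg (G x + 1)]
    have hcl : Integrable (fun x => max (-R) (min R (G x))) M := by
      refine Integrable.of_bound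
        (continuous_const.max (continuous_const.min hG)).measurable.aestronglyMeasurable R
        (Eventually.of_forall fun x => ?_)
      rw [Real.norm_eq_abs, abs_le]
      exact ⟨le_max_left _ _, max_le (by linarith) (min_le_left _ _)⟩
    rw [← integral_sub hGi hcl, ← Real.norm_eq_abs]
    refine (norm_integral_le_of_norm_le (hM2.div_const R)
      (Eventually.of_forall fun x => abs_sub_clip_le hR (G x))).trans ?_
    rw [integral_div]
    gcongr
  rw [Metric.tendsto_nhds]
  intro ε hε
  set R := 3 * (B' + 1) / ε with hR
  have hR0 : 0 < R := by positivity
  have hBR : B' / R < ε / 3 := by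
    rw [div_lt_iff₀ hR0, hR]
    field_simp
    linarith
  have hbd : ∀ x, ‖max (-R) (min R (G x))‖ ≤ R := fun x => by
    rw [Real.norm_eq_abs, abs_le]
    exact ⟨le_max_left _ _, max_le (by linarith) (min_le_left _ _)⟩
  have hlim := hw (BoundedContinuousFunction.ofNormedAddCommGroup
    (fun x => max (-R) (min R (G x))) (continuous_const.max (continuous_const.min hG)) R hbd)
  filter_upwards [Metric.tendsto_nhds.1 hlim (ε / 3) (by positivity), eventually_ge_atTop 1]
    with σ h1 hσ
  have h2 := key R hR0 (Q σ) (hQ σ hσ) (hB σ hσ).1 ((hB σ hσ).2.trans (le_max_left _ _))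
  have h3 := key R hR0 Q₀ inferInstance h₀ (le_max_right _ _)
  rw [Real.dist_eq] at h1 ⊢
  simp only [BoundedContinuousFunction.coe_ofNormedAddCommGroup] at h1
  rw [abs_lt] at h1
  rw [abs_le] at h2 h3
  rw [abs_lt]
  constructor <;> linarith

end WeakConvergence

section Rescaled
variable {d : ℕ} {Λ : Matrix (Fin d) (Fin d) ℝ}

/-- The law of `σ (η - μ)` when `η` has law `M`, on Euclidean space. -/
def rescaledLaw (μ : Fin d → ℝ) (σ : ℝ) (M : Measure (Fin d → ℝ)) :
    Measure (EuclideanSpace ℝ (Fin d)) :=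
  M.map fun η => WithLp.toLp 2 (σ • (η - μ))

theorem continuous_rescale (μ : Fin d → ℝ) (σ : ℝ) :
    Continuous fun η : Fin d → ℝ => (WithLp.toLp 2 (σ • (η - μ)) : EuclideanSpace ℝ (Fin d)) := by
  fun_prop

theorem isProbabilityMeasure_rescaledLaw (μ : Fin d → ℝ) (σ : ℝ) (M : Measure (Fin d → ℝ))
    [IsProbabilityMeasure M] : IsProbabilityMeasure (rescaledLaw μ σ M) :=
  Measure.isProbabilityMeasure_map (continuous_rescale μ σ).measurable.aemeasurable

theorem integral_rescaledLaw {E : Type*} [NormedAddCommGroup E] [NormedSpace ℝ E]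
    (μ : Fin d → ℝ) (σ : ℝ) (M : Measure (Fin d → ℝ)) {f : EuclideanSpace ℝ (Fin d) → E}
    (hf : StronglyMeasurable f) :
    ∫ z, f z ∂(rescaledLaw μ σ M) = ∫ η, f (WithLp.toLp 2 (σ • (η - μ))) ∂M :=
  integral_map (continuous_rescale μ σ).measurable.aemeasurable hf.aestronglyMeasurable

theorem charFun_rescaledLaw (μ : Fin d → ℝ) (σ : ℝ) (M : Measure (Fin d → ℝ))
    (t : EuclideanSpace ℝ (Fin d)) :
    charFun (rescaledLaw μ σ M) t = ∫ η, cis (t.ofLp ⬝ᵥ (σ • (η - μ))) ∂M := by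
  have hc : Continuous fun z : EuclideanSpace ℝ (Fin d) =>
      Complex.exp (inner ℝ z t * Complex.I) := by fun_prop
  rw [charFun_apply, integral_rescaledLaw μ σ M hc.stronglyMeasurable]
  refine integral_congr_ae (Eventually.of_forall fun η => ?_)
  simp only [cis, EuclideanSpace.inner_eq_star_dotProduct, star_trivial]

theorem tendsto_rescaledLaw (hd : 0 < d) (hΛ : Λ ∈ Matrix.rowStochastic ℝ (Fin d))
    {μ : Fin d → ℝ} (hμ : IsErgodic Λ μ) (h : Fin d → ℝ) {P : Matrix (Fin d) (Fin d) ℝ}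
    (hP : IsLyapunovSolution Λ μ h 1 P) {M : ℝ → Measure (Fin d → ℝ)}
    (hM : ∀ σ : ℝ, 0 < σ → IsInvariantFilterMeasure Λ h σ (M σ))
    (f : BoundedContinuousFunction (EuclideanSpace ℝ (Fin d)) ℝ) :
    Tendsto (fun σ => ∫ z, f z ∂(rescaledLaw μ σ (M σ))) atTop
      (𝓝 (∫ z, f z ∂(multivariateGaussian 0 P))) := by
  rw [tendsto_iff_seq_tendsto]
  intro u hu
  have hQ : ∀ n, IsProbabilityMeasure (rescaledLaw μ (max 1 (u n)) (M (max 1 (u n)))) := fun n => by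
    have := (hM (max 1 (u n)) (lt_of_lt_of_le one_pos (le_max_left _ _))).isProbabilityMeasure
    exact isProbabilityMeasure_rescaledLaw _ _ _
  have hmax : Tendsto (fun n => max 1 (u n)) atTop atTop :=
    tendsto_atTop_mono (fun n => le_max_right _ _) hu
  let Q : ℕ → ProbabilityMeasure (EuclideanSpace ℝ (Fin d)) := fun n => ⟨_, hQ n⟩
  let Q₀ : ProbabilityMeasure (EuclideanSpace ℝ (Fin d)) :=
    ⟨multivariateGaussian 0 P, inferInstance⟩
  have hlim : Tendsto Q atTop (𝓝 Q₀) := by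
    rw [ProbabilityMeasure.tendsto_iff_tendsto_charFun]
    intro t
    have h1 := (tendsto_integral_cis hd hΛ hμ h hP hP.mulVec_one hM t.ofLp).comp hmax
    have h2 : charFun (Q₀ : Measure (EuclideanSpace ℝ (Fin d))) t = (gaussChar P t.ofLp : ℂ) := by
      change charFun (multivariateGaussian 0 P) t = _
      rw [charFun_multivariateGaussian hP.posSemidef, gaussChar, Complex.ofReal_exp]
      congr 1
      simp
      ring
    rw [h2]
    refine h1.congr fun n => ?_
    exact (charFun_rescaledLaw μ _ _ t).symm
  have h3 := (ProbabilityMeasure.tendsto_iff_forall_integral_tendsto.1 hlim) f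
  refine h3.congr' ?_
  filter_upwards [hu.eventually_ge_atTop 1] with n hn
  change ∫ z, f z ∂(rescaledLaw μ (max 1 (u n)) (M (max 1 (u n)))) = _
  rw [max_eq_right hn]
  rfl

theorem PolynomialGrowth.sq {F : (Fin d → ℝ) → ℝ} (hF : PolynomialGrowth F) :
    ∃ (C : ℝ) (k : ℕ), 0 ≤ C ∧ ∀ x, F x ^ 2 ≤ C * (1 + l1 x ^ k) := by
  obtain ⟨C, k, hC⟩ := hF
  refine ⟨2 * C ^ 2, 2 * k, by positivity, fun x => ?_⟩
  have h1 : F x ^ 2 ≤ (C * (1 + ‖x‖ ^ k)) ^ 2 := by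
    rw [← sq_abs]
    exact pow_le_pow_left₀ (abs_nonneg _) (hC x) 2
  have h2 : ‖x‖ ^ k ≤ l1 x ^ k := pow_le_pow_left₀ (norm_nonneg x) (norm_le_l1 x) k
  have h3 : 0 ≤ ‖x‖ ^ k := by positivity
  have h4 : (1 + ‖x‖ ^ k) ^ 2 ≤ 2 * (1 + l1 x ^ (2 * k)) := by
    rw [pow_mul', pow_two (l1 x ^ k)]
    nlinarith [sq_nonneg (‖x‖ ^ k - 1)]
  calc F x ^ 2 ≤ C ^ 2 * (1 + ‖x‖ ^ k) ^ 2 := by rwa [← mul_pow]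
    _ ≤ C ^ 2 * (2 * (1 + l1 x ^ (2 * k))) := mul_le_mul_of_nonneg_left h4 (sq_nonneg C)
    _ = _ := by ring

theorem integrable_l1_pow_gaussian (P : Matrix (Fin d) (Fin d) ℝ) (k : ℕ) :
    Integrable (fun z : EuclideanSpace ℝ (Fin d) => l1 z.ofLp ^ k) (multivariateGaussian 0 P) := by
  have h1 : Integrable (fun z : EuclideanSpace ℝ (Fin d) => ‖z‖ ^ k) (multivariateGaussian 0 P) :=
    (IsGaussian.memLp_id (multivariateGaussian 0 P) k (by simp)).integrable_norm_pow'
  have hc : Continuous fun z : EuclideanSpace ℝ (Fin d) => l1 z.ofLp ^ k :=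
    (continuous_l1.comp (PiLp.continuous_ofLp 2 _)).pow k
  refine (h1.const_mul ((d : ℝ) ^ k)).mono' hc.aestronglyMeasurable
    (Eventually.of_forall fun z => ?_)
  rw [Real.norm_eq_abs, abs_of_nonneg (pow_nonneg (l1_nonneg _) k), ← mul_pow]
  refine pow_le_pow_left₀ (l1_nonneg _) ?_ k
  calc l1 z.ofLp ≤ ∑ _i : Fin d, ‖z‖ := Finset.sum_le_sum fun i _ => by
        simpa using PiLp.norm_apply_le z i
    _ = d * ‖z‖ := by simp

theorem integrable_sq_gaussian (P : Matrix (Fin d) (Fin d) ℝ) {F : (Fin d → ℝ) → ℝ}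
    (hFc : Continuous F) (hF : PolynomialGrowth F) :
    Integrable (fun z : EuclideanSpace ℝ (Fin d) => F z.ofLp ^ 2) (multivariateGaussian 0 P) := by
  obtain ⟨C, k, -, hC⟩ := hF.sq
  have hc : Continuous fun z : EuclideanSpace ℝ (Fin d) => F z.ofLp ^ 2 :=
    (hFc.comp (PiLp.continuous_ofLp 2 _)).pow 2
  refine (((integrable_const (1 : ℝ)).add (integrable_l1_pow_gaussian P k)).const_mul C).mono'
    hc.aestronglyMeasurable (Eventually.of_forall fun z => ?_)
  rw [Real.norm_eq_abs, abs_of_nonneg (sq_nonneg _)]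
  exact hC _

theorem integrable_gaussian_of_polynomialGrowth (P : Matrix (Fin d) (Fin d) ℝ)
    {F : (Fin d → ℝ) → ℝ} (hFc : Continuous F) (hF : PolynomialGrowth F) :
    Integrable (fun z : EuclideanSpace ℝ (Fin d) => F z.ofLp) (multivariateGaussian 0 P) :=
  ((memLp_two_iff_integrable_sq
    (hFc.comp (PiLp.continuous_ofLp 2 _)).aestronglyMeasurable).2
      (integrable_sq_gaussian P hFc hF)).integrable one_le_two

theorem integrable_rescaled {h μ : Fin d → ℝ} {σ : ℝ} {M : Measure (Fin d → ℝ)}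
    (hM : IsInvariantFilterMeasure Λ h σ M) {F : (Fin d → ℝ) → ℝ} (hF : Continuous F) :
    Integrable (fun η => F (σ • (η - μ))) M := by
  have := hM.isProbabilityMeasure
  have hc : Continuous fun η : Fin d → ℝ => F (σ • (η - μ)) := hF.comp (by fun_prop)
  obtain ⟨K, hK⟩ := (isCompact_stdSimplex ℝ (Fin d)).exists_bound_of_continuousOn hc.continuousOn
  exact integrable_of_simplex hM.simplex hc.measurable hK

theorem tendsto_integral_rescaled (hd : 0 < d) (hΛ : Λ ∈ Matrix.rowStochastic ℝ (Fin d))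
    {μ : Fin d → ℝ} (hμ : IsErgodic Λ μ) (h : Fin d → ℝ) {P : Matrix (Fin d) (Fin d) ℝ}
    (hP : IsLyapunovSolution Λ μ h 1 P) {M : ℝ → Measure (Fin d → ℝ)}
    (hM : ∀ σ : ℝ, 0 < σ → IsInvariantFilterMeasure Λ h σ (M σ)) {F : (Fin d → ℝ) → ℝ}
    (hFc : Continuous F) (hF : PolynomialGrowth F) :
    Tendsto (fun σ : ℝ => ∫ η, F (σ • (η - μ)) ∂(M σ)) atTop
      (𝓝 (∫ z, F z.ofLp ∂(multivariateGaussian 0 P))) := by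
  obtain ⟨C, k, hC0, hC⟩ := hF.sq
  obtain ⟨B, -, hB⟩ := exists_moment_bound hd hΛ hμ h k
  have hGc : Continuous fun z : EuclideanSpace ℝ (Fin d) => F z.ofLp :=
    hFc.comp (PiLp.continuous_ofLp 2 _)
  have hM1 : ∀ σ, 1 ≤ σ → IsInvariantFilterMeasure Λ h σ (M σ) := fun σ hσ => hM σ (by linarith)
  have hmain := tendsto_integral_of_sq_bounded (Q := fun σ => rescaledLaw μ σ (M σ))
    (B := C * (1 + B)) (fun σ hσ => by
      have := (hM1 σ hσ).isProbabilityMeasure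
      exact isProbabilityMeasure_rescaledLaw _ _ _)
    (tendsto_rescaledLaw hd hΛ hμ h hP hM) hGc (fun σ hσ => ?_) (integrable_sq_gaussian P hFc hF)
  · refine hmain.congr fun σ => ?_
    rw [integral_rescaledLaw μ σ (M σ) hGc.stronglyMeasurable]
  · have hMσ := hM1 σ hσ
    have := hMσ.isProbabilityMeasure
    have hi1 : Integrable (fun η => F (σ • (η - μ)) ^ 2) (M σ) :=
      integrable_rescaled (F := fun x => F x ^ 2) hMσ (hFc.pow 2)
    have hi2 : Integrable (fun η => l1 (σ • (η - μ)) ^ k) (M σ) :=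
      integrable_rescaled (F := fun x => l1 x ^ k) hMσ (continuous_l1.pow k)
    constructor
    · exact (integrable_map_measure (hGc.pow 2).aestronglyMeasurable
        (continuous_rescale μ σ).measurable.aemeasurable).2 hi1
    · rw [integral_rescaledLaw μ σ (M σ) (f := fun z => F z.ofLp ^ 2)
        (hGc.pow 2).stronglyMeasurable]
      calc ∫ η, F (σ • (η - μ)) ^ 2 ∂(M σ) ≤ ∫ η, C * (1 + l1 (σ • (η - μ)) ^ k) ∂(M σ) :=
            integral_mono hi1 (((integrable_const _).add hi2).const_mul C) fun η => hC _
        _ = C * (1 + ∫ η, l1 (σ • (η - μ)) ^ k ∂(M σ)) := by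
            rw [integral_const_mul, integral_add (integrable_const _) hi2]
            simp
        _ ≤ C * (1 + B) := by
            have := hB σ hσ (M σ) hMσ
            gcongr

end Rescaled

section Errors
variable {d : ℕ} {Λ : Matrix (Fin d) (Fin d) ℝ}

theorem maxAtoms_nonempty (hd : 0 < d) (μ : Fin d → ℝ) : Nonempty (maxAtoms μ) := by
  have : Nonempty (Fin d) := ⟨⟨0, hd⟩⟩
  obtain ⟨i, hi⟩ := Finite.exists_max μ
  exact ⟨⟨i, hi⟩⟩

theorem maxCoord_eq_of_mem (hd : 0 < d) {μ : Fin d → ℝ} {i : Fin d} (hi : i ∈ maxAtoms μ) :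
    maxCoord μ = μ i :=
  le_antisymm (maxCoord_le hd hi) (le_maxCoord μ i)

/-- The largest coordinate among those with index in a set. -/
def maxCoordOn (S : Set (Fin d)) (x : Fin d → ℝ) : ℝ := ⨆ j : S, x j

theorem le_maxCoordOn {S : Set (Fin d)} (x : Fin d → ℝ) {j : Fin d} (hj : j ∈ S) :
    x j ≤ maxCoordOn S x :=
  le_ciSup (f := fun j : S => x j) (Set.finite_range _).bddAbove ⟨j, hj⟩

theorem maxCoordOn_le {S : Set (Fin d)} [Nonempty S] {x : Fin d → ℝ} {b : ℝ}
    (hb : ∀ j ∈ S, x j ≤ b) : maxCoordOn S x ≤ b :=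
  ciSup_le fun j => hb j j.2

theorem abs_maxCoordOn_sub_le {S : Set (Fin d)} [Nonempty S] (x y : Fin d → ℝ) :
    |maxCoordOn S x - maxCoordOn S y| ≤ ‖x - y‖ := by
  have key : ∀ x y : Fin d → ℝ, maxCoordOn S x ≤ maxCoordOn S y + ‖x - y‖ := fun x y =>
    maxCoordOn_le fun j hj => by
      have h1 := norm_le_pi_norm (x - y) j
      have h2 := le_maxCoordOn y hj
      have h3 := le_abs_self ((x - y) j)
      rw [Real.norm_eq_abs] at h1
      simp only [Pi.sub_apply] at h1 h3
      linarith
  have h1 := key x y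
  have h2 := key y x
  rw [norm_sub_rev] at h2
  rw [abs_le]
  constructor <;> linarith

theorem continuous_maxCoordOn (S : Set (Fin d)) [Nonempty S] : Continuous (maxCoordOn S) :=
  (LipschitzWith.of_dist_le_mul (K := 1) fun x y => by
    rw [Real.dist_eq, dist_eq_norm, NNReal.coe_one, one_mul]
    exact abs_maxCoordOn_sub_le x y).continuous

theorem polynomialGrowth_maxCoordOn (S : Set (Fin d)) [Nonempty S] :
    PolynomialGrowth (maxCoordOn S) := by
  refine ⟨1, 1, fun x => ?_⟩
  have h0 : maxCoordOn S 0 = 0 := by simp [maxCoordOn]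
  have h1 := abs_maxCoordOn_sub_le (S := S) x 0
  rw [h0, sub_zero, sub_zero] at h1
  rw [pow_one, one_mul]
  linarith

theorem exists_gap (μ : Fin d → ℝ) : ∃ g : ℝ, 0 < g ∧ ∀ i ∉ maxAtoms μ, μ i ≤ maxCoord μ - g := by
  have h1 : ∀ᶠ g : ℝ in 𝓝[>] 0, ∀ i, i ∉ maxAtoms μ → μ i ≤ maxCoord μ - g := by
    rw [eventually_all]
    intro i
    by_cases hi : i ∈ maxAtoms μ
    · exact Eventually.of_forall fun g h => absurd hi h
    · simp only [maxAtoms, Set.mem_ofPred_eq, not_forall, not_le] at hi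
      obtain ⟨j, hj⟩ := hi
      have h2 : 0 < maxCoord μ - μ i := by linarith [le_maxCoord μ j]
      filter_upwards [nhdsWithin_le_nhds (Iio_mem_nhds h2)] with g hg _
      rw [Set.mem_Iio] at hg
      linarith
  obtain ⟨g, hg, hg0⟩ := (h1.and self_mem_nhdsWithin).exists
  exact ⟨g, hg0, hg⟩

theorem abs_maxCoord_expansion_le (hd : 0 < d) {μ : Fin d → ℝ} {g : ℝ} (hg : 0 < g)
    (hgap : ∀ i ∉ maxAtoms μ, μ i ≤ maxCoord μ - g) {σ : ℝ} (hσ : 0 < σ) (η : Fin d → ℝ) (p : ℕ) :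
    |σ * (maxCoord η - maxCoord μ) - maxCoordOn (maxAtoms μ) (σ • (η - μ))| ≤
      2 * (2 / g) ^ p * l1 (σ • (η - μ)) ^ (p + 1) / σ ^ p := by
  have := maxAtoms_nonempty hd μ
  set ζ := σ • (η - μ) with hζ
  set m := maxCoord μ with hm
  set f := maxCoordOn (maxAtoms μ) ζ with hf
  have hζi : ∀ i, ζ i = σ * (η i - μ i) := fun i => rfl
  have hl : ∀ i, |ζ i| ≤ l1 ζ := abs_le_l1 ζ
  have hl0 : 0 ≤ l1 ζ := l1_nonneg ζ
  have hlow : f ≤ σ * (maxCoord η - m) := by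
    refine maxCoordOn_le fun j hj => ?_
    rw [hζi, hm, maxCoord_eq_of_mem hd hj]
    exact mul_le_mul_of_nonneg_left (sub_le_sub_right (le_maxCoord η j) _) hσ.le
  have hrhs : 0 ≤ 2 * (2 / g) ^ p * l1 ζ ^ (p + 1) / σ ^ p := by positivity
  obtain ⟨j₀, hj₀⟩ := this
  have hf0 : -l1 ζ ≤ f := by
    have := (abs_le.1 (hl j₀)).1
    exact this.trans (le_maxCoordOn ζ hj₀)
  rw [abs_of_nonneg (by linarith)]
  rcases lt_or_ge (l1 ζ) (σ * g / 2) with hs | hs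
  · have hup : σ * (maxCoord η - m) ≤ f := by
      have h1 : maxCoord η ≤ m + f / σ := by
        refine maxCoord_le hd fun i => ?_
        by_cases hi : i ∈ maxAtoms μ
        · have h2 := le_maxCoordOn ζ hi
          rw [hζi] at h2
          have h3 : η i - μ i ≤ f / σ := by
            rw [le_div_iff₀ hσ]
            linarith
          rw [hm, maxCoord_eq_of_mem hd hi]
          linarith
        · have h2 := hgap i hi
          have h3 := (abs_le.1 (hl i)).2
          rw [hζi] at h3
          have h4 : η i - μ i ≤ g / 2 := by
            by_contra h
            push Not at h
            nlinarith
          have h5 : -(g / 2) ≤ f / σ := by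
            rw [le_div_iff₀ hσ]
            linarith
          linarith
      have h2 := mul_le_mul_of_nonneg_left (sub_le_iff_le_add'.2 h1) hσ.le
      rwa [mul_div_cancel₀ _ hσ.ne'] at h2
    linarith
  · have hup : σ * (maxCoord η - m) ≤ l1 ζ := by
      have h1 : maxCoord η ≤ m + l1 ζ / σ := by
        refine maxCoord_le hd fun i => ?_
        have h3 := (abs_le.1 (hl i)).2
        rw [hζi] at h3
        have h4 : η i - μ i ≤ l1 ζ / σ := by
          rw [le_div_iff₀ hσ]
          linarith
        linarith [le_maxCoord μ i]
      have h2 := mul_le_mul_of_nonneg_left (sub_le_iff_le_add'.2 h1) hσ.le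
      rwa [mul_div_cancel₀ _ hσ.ne'] at h2
    have h1 : 1 ≤ 2 / g * l1 ζ / σ := by
      rw [le_div_iff₀ hσ, div_mul_eq_mul_div, le_div_iff₀ hg]
      linarith
    have h2 : (1 : ℝ) ≤ (2 / g * l1 ζ / σ) ^ p := one_le_pow₀ h1
    calc σ * (maxCoord η - m) - f ≤ 2 * l1 ζ * 1 := by linarith
      _ ≤ 2 * l1 ζ * (2 / g * l1 ζ / σ) ^ p := mul_le_mul_of_nonneg_left h2 (by positivity)
      _ = _ := by
        rw [div_pow, mul_pow, pow_succ]
        ring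

/-- The limit of the minimal error probabilities, when the filter has invariant measure `M`. -/
def limitError (M : Measure (Fin d → ℝ)) : ℝ := 1 - ∫ η, maxCoord η ∂M

theorem exists_priorError_sub_le (hd : 0 < d) (hΛ : Λ ∈ Matrix.rowStochastic ℝ (Fin d))
    {μ : Fin d → ℝ} (hμ : IsErgodic Λ μ) (h : Fin d → ℝ) (p : ℕ) :
    ∃ C : ℝ, ∀ σ : ℝ, 1 ≤ σ → ∀ M, IsInvariantFilterMeasure Λ h σ M →
      |σ * (priorError μ - limitError M) - ∫ η, maxCoordOn (maxAtoms μ) (σ • (η - μ)) ∂M| ≤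
        C / σ ^ p := by
  have := maxAtoms_nonempty hd μ
  obtain ⟨B, -, hB⟩ := exists_moment_bound hd hΛ hμ h (p + 1)
  obtain ⟨g, hg, hgap⟩ := exists_gap μ
  refine ⟨2 * (2 / g) ^ p * B, fun σ hσ M hM => ?_⟩
  have hσ0 : 0 < σ := by linarith
  have hMp := hM.isProbabilityMeasure
  have hi1 : Integrable (fun η => maxCoord η) M :=
    integrable_of_simplex hM.simplex measurable_maxCoord (isTestFun_maxCoord hd).bound
  have hi2 : Integrable (fun η => σ * (maxCoord η - maxCoord μ)) M :=
    (hi1.sub (integrable_const _)).const_mul σ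
  have hi3 : Integrable (fun η => maxCoordOn (maxAtoms μ) (σ • (η - μ))) M :=
    integrable_rescaled hM (continuous_maxCoordOn _)
  have hi4 : Integrable (fun η => l1 (σ • (η - μ)) ^ (p + 1)) M :=
    integrable_rescaled (F := fun x => l1 x ^ (p + 1)) hM (continuous_l1.pow _)
  have h1 : σ * (priorError μ - limitError M) = ∫ η, σ * (maxCoord η - maxCoord μ) ∂M := by
    rw [integral_const_mul, integral_sub hi1 (integrable_const _), integral_const, probReal_univ,
      one_smul]
    simp only [priorError, limitError, maxCoord]
    ring
  rw [h1, ← integral_sub hi2 hi3, ← Real.norm_eq_abs]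
  refine (norm_integral_le_of_norm_le ((hi4.const_mul (2 * (2 / g) ^ p)).div_const (σ ^ p))
    (Eventually.of_forall fun η => abs_maxCoord_expansion_le hd hg hgap hσ0 η p)).trans ?_
  rw [integral_div, integral_const_mul]
  have := hB σ hσ M hM
  gcongr

theorem tendsto_mul_priorError_sub (hd : 0 < d) (hΛ : Λ ∈ Matrix.rowStochastic ℝ (Fin d))
    {μ : Fin d → ℝ} (hμ : IsErgodic Λ μ) (h : Fin d → ℝ) {P : Matrix (Fin d) (Fin d) ℝ}
    (hP : IsLyapunovSolution Λ μ h 1 P) {M : ℝ → Measure (Fin d → ℝ)}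
    (hM : ∀ σ : ℝ, 0 < σ → IsInvariantFilterMeasure Λ h σ (M σ)) :
    Tendsto (fun σ : ℝ => σ * (priorError μ - limitError (M σ))) atTop
      (𝓝 (∫ z, maxCoordOn (maxAtoms μ) z.ofLp ∂(multivariateGaussian 0 P))) := by
  have := maxAtoms_nonempty hd μ
  obtain ⟨C, hC⟩ := exists_priorError_sub_le hd hΛ hμ h 1
  have h1 := tendsto_integral_rescaled hd hΛ hμ h hP hM (continuous_maxCoordOn (maxAtoms μ))
    (polynomialGrowth_maxCoordOn _)
  have h2 : Tendsto (fun σ : ℝ => σ * (priorError μ - limitError (M σ)) -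
      ∫ η, maxCoordOn (maxAtoms μ) (σ • (η - μ)) ∂(M σ)) atTop (𝓝 0) := by
    refine squeeze_zero_norm' ?_ (tendsto_const_nhds.div_atTop tendsto_id : Tendsto
      (fun σ : ℝ => C / σ) atTop (𝓝 0))
    filter_upwards [eventually_ge_atTop 1] with σ hσ
    simpa using hC σ hσ (M σ) (hM σ (by linarith))
  simpa using h2.add h1

theorem tendsto_pow_mul_priorError_sub (hd : 0 < d) (hΛ : Λ ∈ Matrix.rowStochastic ℝ (Fin d))
    {μ : Fin d → ℝ} (hμ : IsErgodic Λ μ) (h : Fin d → ℝ) {M : ℝ → Measure (Fin d → ℝ)}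
    (hM : ∀ σ : ℝ, 0 < σ → IsInvariantFilterMeasure Λ h σ (M σ))
    (huniq : ∃! i, i ∈ maxAtoms μ) {p : ℕ} (hp : 1 ≤ p) :
    Tendsto (fun σ : ℝ => σ ^ p * (priorError μ - limitError (M σ))) atTop (𝓝 0) := by
  obtain ⟨i, hi, hiu⟩ := huniq
  have hS : ∀ x : Fin d → ℝ, maxCoordOn (maxAtoms μ) x = x i := fun x => by
    have := maxAtoms_nonempty hd μ
    refine le_antisymm (maxCoordOn_le fun j hj => ?_) (le_maxCoordOn x hi)
    rw [hiu j hj]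
  obtain ⟨C, hC⟩ := exists_priorError_sub_le hd hΛ hμ h p
  refine squeeze_zero_norm' ?_ (tendsto_const_nhds.div_atTop tendsto_id : Tendsto
    (fun σ : ℝ => C / σ) atTop (𝓝 0))
  filter_upwards [eventually_ge_atTop 1] with σ hσ
  have hσ0 : 0 < σ := by linarith
  have hMσ := hM σ hσ0
  have hMp := hMσ.isProbabilityMeasure
  have h1 := hC σ hσ (M σ) hMσ
  have h2 : ∫ η, maxCoordOn (maxAtoms μ) (σ • (η - μ)) ∂(M σ) = 0 := by
    have hi1 : Integrable (fun η : Fin d → ℝ => η i) (M σ) :=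
      integrable_of_simplex hMσ.simplex (measurable_pi_apply i)
        fun x hx => abs_apply_le_one hx i
    have hb : ∫ η, η i ∂(M σ) = μ i := congrFun (hMσ.barycenter_eq hΛ h hσ0 hμ) i
    simp only [hS, Pi.smul_apply, Pi.sub_apply, smul_eq_mul]
    rw [integral_const_mul, integral_sub hi1 (integrable_const _), hb]
    simp
  rw [h2, sub_zero, abs_mul, abs_of_pos hσ0] at h1
  obtain ⟨q, rfl⟩ : ∃ q, p = q + 1 := ⟨p - 1, by omega⟩
  rw [Real.norm_eq_abs, abs_mul, abs_of_pos (pow_pos hσ0 _)]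
  have h3 := mul_le_mul_of_nonneg_left h1 (pow_pos hσ0 q).le
  calc σ ^ (q + 1) * |priorError μ - limitError (M σ)| =
        σ ^ q * (σ * |priorError μ - limitError (M σ)|) := by ring
    _ ≤ _ := h3
    _ = C / σ := by
      rw [pow_succ]
      field_simp

end Errors
end
end StrongNoise

theorem theorem2p3 {d : ℕ} (hd : 0 < d)
    (a : Fin d → ℝ) (ha : Function.Injective a) (h : Fin d → ℝ)
    (Λ : Matrix (Fin d) (Fin d) ℝ) (hΛ : Λ ∈ Matrix.rowStochastic ℝ (Fin d))
    (μ : Fin d → ℝ) (hμ : StrongNoise.IsErgodic Λ μ) :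
    ∃ (P : Matrix (Fin d) (Fin d) ℝ) (M : ℝ → Measure (Fin d → ℝ)) (errorLimit : ℝ → ℝ),
      -- `P` is the unique solution of the Lyapunov equation with `I = 1`
      (StrongNoise.IsLyapunovSolution Λ μ h 1 P ∧
        ∀ P', StrongNoise.IsLyapunovSolution Λ μ h 1 P' → P' = P) ∧
      -- `M σ` is the unique invariant measure of the filter
      (∀ σ : ℝ, 0 < σ → StrongNoise.IsInvariantFilterMeasure Λ h σ (M σ) ∧
        ∀ M', StrongNoise.IsInvariantFilterMeasure Λ h σ M' → M' = M σ) ∧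
      -- `errorLimit σ` is the steady state minimal error probability, for any initial distribution
      (∀ σ : ℝ, 0 < σ → ∀ ν ∈ stdSimplex ℝ (Fin d),
        ∀ (Ω : Type*) [MeasurableSpace Ω] (prob : Measure Ω) [IsProbabilityMeasure prob]
          (X : ℕ → Ω → Fin d) (ξ : ℕ → Ω → ℝ), StrongNoise.IsModel Λ ν prob X ξ →
          Tendsto (fun n => StrongNoise.minError a h σ prob X ξ n) atTop (𝓝 (errorLimit σ))) ∧
      -- convergence of the rescaled invariant measures
      (∀ F : (Fin d → ℝ) → ℝ, Continuous F → StrongNoise.PolynomialGrowth F →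
        Integrable (fun z : EuclideanSpace ℝ (Fin d) => F z.ofLp) (multivariateGaussian 0 P) ∧
        Tendsto (fun σ : ℝ => ∫ η, F (σ • (η - μ)) ∂(M σ)) atTop
          (𝓝 (∫ z, F z.ofLp ∂(multivariateGaussian 0 P)))) ∧
      -- asymptotics of the minimal error probability
      Tendsto (fun σ : ℝ => σ * (StrongNoise.priorError μ - errorLimit σ)) atTop
        (𝓝 (∫ z, (⨆ j : StrongNoise.maxAtoms μ, z.ofLp j) ∂(multivariateGaussian 0 P))) ∧
      -- the case of a unique maximal atom
      ((∃! i, i ∈ StrongNoise.maxAtoms μ) → ∀ p : ℕ, 1 ≤ p →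
        Tendsto (fun σ : ℝ => σ ^ p * (StrongNoise.priorError μ - errorLimit σ)) atTop (𝓝 0)) := by
  classical
  have hμΔ := hμ.mem_stdSimplex hd hΛ
  obtain ⟨P, hP⟩ := StrongNoise.exists_isLyapunovSolution hd hΛ hμ h
  have hex : ∀ σ : ℝ, ∃ M, 0 < σ → StrongNoise.IsInvariantFilterMeasure Λ h σ M := fun σ => by
    by_cases hσ : 0 < σ
    · obtain ⟨M, hM⟩ := StrongNoise.exists_isInvariantFilterMeasure hΛ h hσ hd hμ
      exact ⟨M, fun _ => hM⟩
    · exact ⟨0, fun h => absurd h hσ⟩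
  choose M hM using hex
  refine ⟨P, M, fun σ => StrongNoise.limitError (M σ), ⟨hP, fun P' hP' => hP.unique hμ hP'⟩,
    fun σ hσ => ⟨hM σ hσ, fun M' hM' =>
      StrongNoise.isInvariantFilterMeasure_unique hΛ h hσ hd hμ (hM σ hσ) hM'⟩, ?_,
    fun F hFc hF => ⟨StrongNoise.integrable_gaussian_of_polynomialGrowth P hFc hF,
      StrongNoise.tendsto_integral_rescaled hd hΛ hμ h hP hM hFc hF⟩,
    StrongNoise.tendsto_mul_priorError_sub hd hΛ hμ h hP hM,
    fun huniq p hp => StrongNoise.tendsto_pow_mul_priorError_sub hd hΛ hμ h hM huniq hp⟩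
  intro σ hσ ν hν Ω _ prob _ X ξ hX
  simp only [hX.minError_eq hd hΛ hν ha h hσ]
  exact (StrongNoise.tendsto_integral_simplexKernel_pow hΛ h hσ hd hμ (hM σ hσ) hν
    (StrongNoise.isTestFun_maxCoord hd) zero_le_one).const_sub 1
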